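/- Let $\mu\in C^1(\mathbb R)\cap L^\infty(\mathbb R)$ be even with $\mu'<0$ in $(0,\infty)$ and $\mu(\xi)=0$ for a unique $\xi>0$, and let $f\in L^1(\mathbb R)\cap L^\infty(\mathbb R)\cap C(\mathbb R)$ be odd with $f(x)>0$ for all $x>0$. For $a\ge 0$ and $\epsilon>0$ consider on $H^1(\mathbb R)$ the energy $$E(u)=\int_{\mathbb R}\Big(\frac{\epsilon}{2}|u'|^2-\frac1{2\epsilon}\mu u^2+\frac1{4\epsilon}|u|^4-a f u\Big)\,dx .$$ For all $a\ge0$ and $\epsilon>0$ the energy $E$ has a global minimizer in $H^1(\mathbb R)$. Global minimizers are identified with their continuous representatives. With $a\ge 0$ fixed, the following hold. (i) Let $a=0$. For all sufficiently small $\epsilon>0$, every global minimizer $v$ is even, and either $v>0$ on $\mathbb R$ or $v<0$ on $\mathbb R$. (ii) Let $a>0$. There are constants $C$ and $\epsilon_0>0$ (depending on $a,\mu,f$) such that for all $0<\epsilon<\epsilon_0$ every global minimizer $v$ has a unique zero $\bar x$; moreover $|\bar x|\le \xi+C\sqrt\epsilon$, $v(x)>0$ for all $x>\bar x$, and $v(x)<0$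 for all $x<\bar x$. In (iii) and (iv), $v=v_\epsilon$ denotes an arbitrary choice of a global minimizer for each small $\epsilon>0$, $\bar x=\bar x_\epsilon$ is its zero (for $a>0$), and the limits as $\epsilon\to0^+$ of functions of $s$ are taken in $C^1_{\mathrm{loc}}(\mathbb R)$ with respect to $s$, for each fixed $x$. (iii) Suppose that $$a^*:=\sup_{x\in[-\xi,0)}\frac{\sqrt2\,\big(\mu(0)^{3/2}-\mu(x)^{3/2}\big)}{3\int_x^0|f|\sqrt\mu}<\infty .$$ Then for every $a>a^*$ one has $\bar x\to0$ as $\epsilon\to0^+$, and $$\lim_{\epsilon\to0^+}v(\bar x+\epsilon s)=\sqrt{\mu(0)}\,\tanh\big(s\sqrt{\mu(0)/2}\big),\qquad \lim_{\epsilon\to0^+}v(x+\epsilon s)=\begin{cases}\sqrt{\mu(x)}&\text{for }0<x<\xi,\\-\sqrt{\mu(x)}&\text{for }-\xi<x<0,\\0&\text{for }|x|\ge\xi.\end{cases}$$ (iv) Let $$a_*:=\inf_{x\in(-\xi,0]}\frac{\sqrt2\,\mu(x)^{3/2}}{3\int_{-\xi}^x|f|\sqrt\mu}.$$ Then $a_*\in(0,\infty)$.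 For every $a\in(0,a_*)$, after replacing, for some values of $\epsilon$, the function $v(x)$ by $-v(-x)$, one has $\bar x\to-\xi$ as $\epsilon\to0^+$, and $$\lim_{\epsilon\to0^+}v(x+\epsilon s)=\begin{cases}\sqrt{\mu(x)}&\text{for }|x|<\xi,\\0&\text{for }|x|\ge\xi.\end{cases}$$ The last formula holds, after the same kind of replacement, also when $a=0$. Moreover, if $f=-\mu'/2$, then $a_*=a^*=\sqrt2$. -/

import Mathlib

open MeasureTheory Set Filter Topology
open scoped ContDiff

noncomputable section

namespace ShadowKink

/-- The standing assumptions on the coefficients `μ`, `f`, with `ξ` the positive zero of `μ`. -/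
structure Assumptions (μ f : ℝ → ℝ) (ξ : ℝ) : Prop where
  mu_contDiff : ContDiff ℝ 1 μ
  mu_bounded : MemLp μ ⊤ volume
  mu_even : ∀ x, μ (-x) = μ x
  mu_deriv_neg : ∀ x, 0 < x → deriv μ x < 0
  xi_pos : 0 < ξ
  mu_zero_iff : ∀ x, 0 < x → (μ x = 0 ↔ x = ξ)
  f_integrable : MemLp f 1 volume
  f_bounded : MemLp f ⊤ volume
  f_continuous : Continuous f
  f_odd : ∀ x, f (-x) = -f x
  f_pos : ∀ x, 0 < x → 0 < f x

/-- `g` is a weak derivative of `u` on the real line. -/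
def HasWeakDeriv (u g : ℝ → ℝ) : Prop :=
  LocallyIntegrable u volume ∧ LocallyIntegrable g volume ∧
    ∀ φ : ℝ → ℝ, ContDiff ℝ ∞ φ → HasCompactSupport φ →
      ∫ x, u x * deriv φ x = -∫ x, g x * φ x

/-- `u` represents an element of the Sobolev space `H¹(ℝ)`. -/
def MemH1 (u : ℝ → ℝ) : Prop :=
  MemLp u 2 volume ∧ ∃ g : ℝ → ℝ, MemLp g 2 volume ∧ HasWeakDeriv u g

open Classical in
/-- A weak derivative of `u` (unique up to null sets) if there is one, and `0` otherwise. -/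
def weakDeriv (u : ℝ → ℝ) : ℝ → ℝ :=
  if h : ∃ g : ℝ → ℝ, HasWeakDeriv u g then h.choose else 0

/-- The energy `E(u)`. -/
def energy (μ f : ℝ → ℝ) (a ε : ℝ) (u : ℝ → ℝ) : ℝ :=
  ∫ x, (ε / 2 * |weakDeriv u x| ^ 2 - 1 / (2 * ε) * μ x * u x ^ 2
    + 1 / (4 * ε) * |u x| ^ 4 - a * f x * u x)

/-- `v` is (the continuous representative of) a global minimizer of the energy in `H¹(ℝ)`.
Every class in `H¹(ℝ)` has exactly one continuous representative. -/
def IsGlobalMinimizer (μ f : ℝ → ℝ) (a ε : ℝ) (v : ℝ → ℝ) : Prop :=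
  Continuous v ∧ MemH1 v ∧ ∀ w : ℝ → ℝ, MemH1 w → energy μ f a ε v ≤ energy μ f a ε w

/-- `v ε` is a global minimizer for all sufficiently small `ε > 0`. -/
def IsMinimizerFamily (μ f : ℝ → ℝ) (a : ℝ) (v : ℝ → ℝ → ℝ) : Prop :=
  ∀ᶠ ε in 𝓝[>] (0 : ℝ), IsGlobalMinimizer μ f a ε (v ε)

/-- `u ε → U` in `C¹_loc(ℝ)` as `ε → 0⁺`. -/
def TendstoC1Loc (u : ℝ → ℝ → ℝ) (U : ℝ → ℝ) : Prop :=
  ContDiff ℝ 1 U ∧ (∀ᶠ ε in 𝓝[>] (0 : ℝ), ContDiff ℝ 1 (u ε)) ∧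
    TendstoLocallyUniformly u U (𝓝[>] (0 : ℝ)) ∧
    TendstoLocallyUniformly (fun ε => deriv (u ε)) (deriv U) (𝓝[>] (0 : ℝ))

/-- For each `ε`, `w ε` is either `v ε` or its image under the odd symmetry `v(x) ↦ -v(-x)`. -/
def EqUpToOddSymmetry (v w : ℝ → ℝ → ℝ) : Prop :=
  ∀ ε, w ε = v ε ∨ w ε = fun x => -v ε (-x)

/-- `w ε (x + ε s)` converges in `C¹_loc` in `s` to `√μ(x)` if `|x| < ξ`, to `0` if `|x| ≥ ξ`. -/
def ThomasFermiLimit (μ : ℝ → ℝ) (ξ : ℝ) (w : ℝ → ℝ → ℝ) : Prop :=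
  (∀ x, |x| < ξ → TendstoC1Loc (fun ε s => w ε (x + ε * s)) (fun _ => √(μ x))) ∧
    (∀ x, ξ ≤ |x| → TendstoC1Loc (fun ε s => w ε (x + ε * s)) (fun _ => 0))

/-- The set of quotients whose supremum is `a^*`. -/
def upperSet (μ f : ℝ → ℝ) (ξ : ℝ) : Set ℝ :=
  (fun x => √2 * (μ 0 ^ (3 / 2 : ℝ) - μ x ^ (3 / 2 : ℝ)) / (3 * ∫ t in x..0, |f t| * √(μ t))) ''
    Ico (-ξ) 0

/-- The number `a^*`; meaningful when `upperSet μ f ξ` is bounded above, i.e. when `a^* < ∞`. -/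
def aUpper (μ f : ℝ → ℝ) (ξ : ℝ) : ℝ := sSup (upperSet μ f ξ)

/-- The number `a_*`: an infimum of nonnegative numbers. -/
def aLower (μ f : ℝ → ℝ) (ξ : ℝ) : ℝ :=
  sInf ((fun x => √2 * μ x ^ (3 / 2 : ℝ) / (3 * ∫ t in (-ξ)..x, |f t| * √(μ t))) '' Ioc (-ξ) 0)

end ShadowKink

end

noncomputable section

namespace ShadowKink

section


/-- A test function vanishes outside some interval `(-R, R)`. -/
lemma exists_support_subset_Ioo {φ : ℝ → ℝ} (hφ : HasCompactSupport φ) :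
    ∃ R : ℝ, 0 < R ∧ ∀ x, x ∉ Ioo (-R) R → φ x = 0 := by
  obtain ⟨r, hr⟩ := hφ.isCompact.isBounded.subset_closedBall 0
  refine ⟨|r| + 1, by positivity, fun x hx => ?_⟩
  by_contra h
  have := hr (subset_tsupport φ h)
  rw [Metric.mem_closedBall, Real.dist_eq, sub_zero] at this
  have h2 := le_abs_self r
  exact hx (abs_lt.1 (by linarith))

lemma integral_eq_intervalIntegral_of_eq_zero {F : ℝ → ℝ} {R : ℝ}
    (hF : ∀ x, x ∉ Ioo (-R) R → F x = 0) : ∫ x, F x = ∫ x in (-R)..R, F x := by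
  refine (intervalIntegral.integral_eq_integral_of_support_subset fun x hx => ?_).symm
  by_contra h
  exact hx (hF x fun h' => h ⟨h'.1, h'.2.le⟩)

lemma eq_primitive {v g : ℝ → ℝ} (hv : ∀ x y, v y - v x = ∫ t in x..y, g t) (c : ℝ) :
    v = fun x => v c + ∫ t in c..x, g t := by
  ext x; rw [← hv]; ring

lemma intervalIntegrable_of_locallyIntegrable {g : ℝ → ℝ} (hg : LocallyIntegrable g volume)
    (x y : ℝ) : IntervalIntegrable g volume x y :=
  intervalIntegrable_iff.mpr <|
    (hg.integrableOn_isCompact isCompact_uIcc).mono_set uIoc_subset_uIcc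

lemma continuous_of_primitive {v g : ℝ → ℝ} (hg : LocallyIntegrable g volume)
    (hv : ∀ x y, v y - v x = ∫ t in x..y, g t) : Continuous v := by
  rw [eq_primitive hv 0]
  exact continuous_const.add
    (intervalIntegral.continuous_primitive (intervalIntegrable_of_locallyIntegrable hg) 0)

/-- A primitive of a locally integrable function has it as weak derivative. -/
lemma hasWeakDeriv_of_primitive {v g : ℝ → ℝ} (hg : LocallyIntegrable g volume)
    (hv : ∀ x y, v y - v x = ∫ t in x..y, g t) : HasWeakDeriv v g := by
  refine ⟨(continuous_of_primitive hg hv).locallyIntegrable, hg, fun φ hφ hc => ?_⟩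
  obtain ⟨R, hR, hsupp⟩ := exists_support_subset_Ioo hc
  obtain ⟨R', hR', hsupp'⟩ := exists_support_subset_Ioo hc.deriv
  have hS : ∀ x, x ∉ Ioo (-(max R R')) (max R R') → φ x = 0 := fun x hx => hsupp x fun h =>
    hx ⟨(neg_le_neg (le_max_left _ _)).trans_lt h.1, h.2.trans_le (le_max_left _ _)⟩
  have hS' : ∀ x, x ∉ Ioo (-(max R R')) (max R R') → deriv φ x = 0 := fun x hx => hsupp' x fun h =>
    hx ⟨(neg_le_neg (le_max_right _ _)).trans_lt h.1, h.2.trans_le (le_max_right _ _)⟩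
  set S := max R R'
  rw [integral_eq_intervalIntegral_of_eq_zero (R := S) fun x hx => by rw [hS' x hx, mul_zero],
    integral_eq_intervalIntegral_of_eq_zero (R := S) fun x hx => by rw [hS x hx, mul_zero]]
  have hac : AbsolutelyContinuousOnInterval v (-S) S := by
    rw [eq_primitive hv (-S)]
    refine AbsolutelyContinuousOnInterval.add ?_ ?_
    · exact (contDiff_const.contDiffOn (n := 1)).absolutelyContinuousOnInterval
    · exact (intervalIntegrable_of_locallyIntegrable hg
        _ _).absolutelyContinuousOnInterval_intervalIntegral (by simp)
  have hφac : AbsolutelyContinuousOnInterval φ (-S) S :=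
    ((hφ.of_le (by simp)).contDiffOn (n := 1)).absolutelyContinuousOnInterval
  rw [hac.integral_mul_deriv_eq_deriv_mul hφac, hS S (by simp), hS (-S) (by simp)]
  simp only [mul_zero, sub_zero, zero_sub, neg_inj]
  refine intervalIntegral.integral_congr_ae ?_
  filter_upwards [LocallyIntegrable.ae_hasDerivAt_integral hg] with x hx _
  have h1 : HasDerivAt v (g x) x := by
    rw [eq_primitive hv 0]
    exact (hx 0).const_add _
  rw [h1.deriv]

/-- A function with vanishing weak derivative is almost everywhere constant. -/
lemma ae_const_of_weakDeriv_zero {h : ℝ → ℝ} (hh : LocallyIntegrable h volume)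
    (h0 : ∀ φ : ℝ → ℝ, ContDiff ℝ ∞ φ → HasCompactSupport φ → ∫ x, h x * deriv φ x = 0) :
    ∃ c : ℝ, h =ᵐ[volume] fun _ => c := by
  let b : ContDiffBump (0 : ℝ) := ⟨1, 2, one_pos, one_lt_two⟩
  let ψ₀ : ℝ → ℝ := b.normed volume
  have hψ₀ : ContDiff ℝ ∞ ψ₀ := b.contDiff_normed
  have hψ₀c : HasCompactSupport ψ₀ := b.hasCompactSupport_normed
  have hψ₀i : ∫ x, ψ₀ x = 1 := b.integral_normed
  refine ⟨∫ x, ψ₀ x * h x, ?_⟩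
  set c := ∫ x, ψ₀ x * h x
  have hint : ∀ ψ : ℝ → ℝ, ContDiff ℝ ∞ ψ → HasCompactSupport ψ →
      Integrable (fun x => ψ x * h x) volume := fun ψ hψ hψc => by
    have := hh.integrable_smul_left_of_hasCompactSupport hψ.continuous hψc
    simpa [smul_eq_mul] using this
  refine ae_eq_of_integral_contDiff_smul_eq hh (locallyIntegrable_const c) fun ψ hψ hψc => ?_
  simp only [smul_eq_mul]
  rw [integral_mul_const]
  let I := ∫ x, ψ x
  let χ : ℝ → ℝ := fun x => ψ x - I * ψ₀ x
  have hχ : ContDiff ℝ ∞ χ := hψ.sub (contDiff_const.mul hψ₀)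
  obtain ⟨R, hR, hψR⟩ := exists_support_subset_Ioo hψc
  obtain ⟨R', hR', hψR'⟩ := exists_support_subset_Ioo hψ₀c
  set S := max R R'
  have hχS : ∀ x, x ∉ Ioo (-S) S → χ x = 0 := fun x hx => by
    have h1 : ψ x = 0 := hψR x fun h =>
      hx ⟨(neg_le_neg (le_max_left _ _)).trans_lt h.1, h.2.trans_le (le_max_left _ _)⟩
    have h2 : ψ₀ x = 0 := hψR' x fun h =>
      hx ⟨(neg_le_neg (le_max_right _ _)).trans_lt h.1, h.2.trans_le (le_max_right _ _)⟩
    simp [χ, h1, h2]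
  have hχi : ∫ x, χ x = 0 := by
    simp only [χ]
    rw [integral_sub (hψ.continuous.integrable_of_hasCompactSupport hψc)
      ((hψ₀.continuous.integrable_of_hasCompactSupport hψ₀c).const_mul _), integral_const_mul,
      hψ₀i]
    simp [I]
  let φ : ℝ → ℝ := fun x => ∫ t in (-S)..x, χ t
  have hφd : ∀ x, HasDerivAt φ (χ x) x := fun x =>
    intervalIntegral.integral_hasDerivAt_right (hχ.continuous.intervalIntegrable _ _)
      (hχ.continuous.stronglyMeasurableAtFilter _ _) hχ.continuous.continuousAt
  have hφ' : deriv φ = χ := funext fun x => (hφd x).deriv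
  have hφ : ContDiff ℝ ∞ φ :=
    contDiff_infty_iff_deriv.2 ⟨fun x => (hφd x).differentiableAt, hφ' ▸ hχ⟩
  have hφc : HasCompactSupport φ := by
    refine HasCompactSupport.intro (isCompact_Icc (a := -S) (b := S)) fun x hx => ?_
    simp only [φ]
    rcases lt_or_ge x (-S) with h1 | h1
    · rw [intervalIntegral.integral_congr (g := fun _ => (0 : ℝ))]
      · simp
      · intro t ht
        rw [uIcc_of_ge h1.le] at ht
        exact hχS t fun h => absurd ht.2 (not_le.2 h.1)
    · have h2 : S < x := not_le.1 fun h => hx ⟨h1, h⟩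
      rw [← hχi]
      refine intervalIntegral.integral_eq_integral_of_support_subset fun t ht => ?_
      by_contra h
      exact ht (hχS t fun h' => h ⟨h'.1, h'.2.le.trans h2.le⟩)
  have key := h0 φ hφ hφc
  rw [hφ'] at key
  have h3 : ∫ x, h x * χ x = (∫ x, ψ x * h x) - I * c := by
    rw [← integral_const_mul, ← integral_sub (hint ψ hψ hψc) ((hint ψ₀ hψ₀ hψ₀c).const_mul _)]
    congr 1; ext x; simp only [χ]; ring
  rw [h3] at key
  linarith

lemma HasWeakDeriv.ae_eq_primitive {u g : ℝ → ℝ} (h : HasWeakDeriv u g) :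
    ∃ c : ℝ, u =ᵐ[volume] fun x => c + ∫ t in (0 : ℝ)..x, g t := by
  obtain ⟨hu, hg, hφ⟩ := h
  have hG : HasWeakDeriv (fun x => ∫ t in (0 : ℝ)..x, g t) g :=
    hasWeakDeriv_of_primitive hg fun x y =>
      intervalIntegral.integral_interval_sub_left (intervalIntegrable_of_locallyIntegrable hg _ _)
        (intervalIntegrable_of_locallyIntegrable hg _ _)
  obtain ⟨c, hc⟩ := ae_const_of_weakDeriv_zero (hu.sub hG.1) fun φ h1 h2 => by
    have hi : ∀ w : ℝ → ℝ, LocallyIntegrable w volume →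
        Integrable (fun x => w x * deriv φ x) volume := fun w hw => by
      have := hw.integrable_smul_left_of_hasCompactSupport
        (h1.continuous_deriv (by simp)) h2.deriv
      simpa [smul_eq_mul, mul_comm] using this
    simp only [Pi.sub_apply, sub_mul]
    rw [integral_sub (hi _ hu) (hi _ hG.1), hφ φ h1 h2, hG.2.2 φ h1 h2, sub_self]
  refine ⟨c, ?_⟩
  filter_upwards [hc] with x hx
  simp only [Pi.sub_apply] at hx
  linarith

lemma HasWeakDeriv.ae_unique {u g g' : ℝ → ℝ} (h : HasWeakDeriv u g) (h' : HasWeakDeriv u g') :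
    g =ᵐ[volume] g' := by
  refine ae_eq_of_integral_contDiff_smul_eq h.2.1 h'.2.1 fun φ h1 h2 => ?_
  have := (h.2.2 φ h1 h2).symm.trans (h'.2.2 φ h1 h2)
  simpa [smul_eq_mul, mul_comm] using this

lemma HasWeakDeriv.weakDeriv_ae_eq {u g : ℝ → ℝ} (h : HasWeakDeriv u g) :
    weakDeriv u =ᵐ[volume] g := by
  have hex : ∃ g : ℝ → ℝ, HasWeakDeriv u g := ⟨g, h⟩
  rw [weakDeriv, dif_pos hex]
  exact hex.choose_spec.ae_unique h

/-- `v` is the continuous representative of an element of `H¹(ℝ)` with weak derivative `g`. -/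
structure H1Pair (v g : ℝ → ℝ) : Prop where
  memLp : MemLp v 2 volume
  memLp_deriv : MemLp g 2 volume
  sub_eq : ∀ x y, v y - v x = ∫ t in x..y, g t

lemma H1Pair.locallyIntegrable {v g : ℝ → ℝ} (h : H1Pair v g) : LocallyIntegrable g volume :=
  h.memLp_deriv.locallyIntegrable (by norm_num)

lemma H1Pair.intervalIntegrable {v g : ℝ → ℝ} (h : H1Pair v g) (x y : ℝ) :
    IntervalIntegrable g volume x y :=
  intervalIntegrable_of_locallyIntegrable h.locallyIntegrable x y

lemma H1Pair.continuous {v g : ℝ → ℝ} (h : H1Pair v g) : Continuous v :=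
  continuous_of_primitive h.locallyIntegrable h.sub_eq

lemma H1Pair.hasWeakDeriv {v g : ℝ → ℝ} (h : H1Pair v g) : HasWeakDeriv v g :=
  hasWeakDeriv_of_primitive h.locallyIntegrable h.sub_eq

lemma H1Pair.memH1 {v g : ℝ → ℝ} (h : H1Pair v g) : MemH1 v :=
  ⟨h.memLp, g, h.memLp_deriv, h.hasWeakDeriv⟩

lemma MemH1.exists_h1Pair {w : ℝ → ℝ} (h : MemH1 w) :
    ∃ v g, H1Pair v g ∧ w =ᵐ[volume] v ∧ weakDeriv w =ᵐ[volume] g := by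
  obtain ⟨hw, g, hg, hwg⟩ := h
  obtain ⟨c, hc⟩ := hwg.ae_eq_primitive
  refine ⟨_, g, ⟨hw.ae_eq hc, hg, fun x y => ?_⟩, hc, hwg.weakDeriv_ae_eq⟩
  have hi := intervalIntegrable_of_locallyIntegrable hwg.2.1
  simp only [add_sub_add_left_eq_sub]
  exact intervalIntegral.integral_interval_sub_left (hi _ _) (hi _ _)

lemma MemH1.exists_h1Pair_of_continuous {v : ℝ → ℝ} (h : MemH1 v) (hv : Continuous v) :
    ∃ g, H1Pair v g := by
  obtain ⟨v', g, hp, hae, -⟩ := h.exists_h1Pair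
  have : v = v' := (hv.ae_eq_iff_eq volume hp.continuous).1 hae
  exact ⟨g, this ▸ hp⟩

end

section


lemma abs_le_of_ae_abs_le {φ : ℝ → ℝ} (hφ : Continuous φ) {B : ℝ}
    (h : ∀ᵐ x ∂volume, |φ x| ≤ B) (x : ℝ) : |φ x| ≤ B := by
  have h1 : (fun x => min |φ x| B) =ᵐ[volume] fun x => |φ x| := by
    filter_upwards [h] with x hx
    exact min_eq_left hx
  have h2 := ((hφ.abs.min continuous_const).ae_eq_iff_eq volume hφ.abs).1 h1
  have h3 := congrFun h2 x
  exact min_eq_left_iff.1 h3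

lemma exists_bound_of_memLp_top {φ : ℝ → ℝ} (hφ : Continuous φ) (h : MemLp φ ⊤ volume) :
    ∃ B : ℝ, 0 < B ∧ ∀ x, |φ x| ≤ B := by
  have h1 := ae_le_eLpNormEssSup (f := φ) (μ := volume)
  have h2 : eLpNormEssSup φ volume ≠ ⊤ := by
    have := h.2.ne
    rwa [eLpNorm_exponent_top] at this
  refine ⟨(eLpNormEssSup φ volume).toReal + 1, by positivity, abs_le_of_ae_abs_le hφ ?_⟩
  filter_upwards [h1] with x hx
  have := ENNReal.toReal_mono h2 hx
  simp only [toReal_enorm, Real.norm_eq_abs] at this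
  linarith

namespace Assumptions

variable {μ f : ℝ → ℝ} {ξ : ℝ}

lemma mu_continuous (h : Assumptions μ f ξ) : Continuous μ := h.mu_contDiff.continuous

lemma mu_abs (h : Assumptions μ f ξ) (x : ℝ) : μ |x| = μ x := by
  rcases abs_choice x with hx | hx <;> rw [hx]
  exact h.mu_even x

lemma mu_strictAntiOn (h : Assumptions μ f ξ) : StrictAntiOn μ (Ici 0) := by
  refine strictAntiOn_of_deriv_neg (convex_Ici 0) h.mu_continuous.continuousOn fun x hx => ?_
  rw [interior_Ici] at hx
  exact h.mu_deriv_neg x hx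

lemma mu_lt_of_abs_lt (h : Assumptions μ f ξ) {x y : ℝ} (hxy : |x| < |y|) : μ y < μ x := by
  rw [← h.mu_abs x, ← h.mu_abs y]
  exact h.mu_strictAntiOn (abs_nonneg x) (abs_nonneg y) hxy

lemma mu_le_of_abs_le (h : Assumptions μ f ξ) {x y : ℝ} (hxy : |x| ≤ |y|) : μ y ≤ μ x := by
  rw [← h.mu_abs x, ← h.mu_abs y]
  exact h.mu_strictAntiOn.antitoneOn (abs_nonneg x) (abs_nonneg y) hxy

lemma mu_xi (h : Assumptions μ f ξ) : μ ξ = 0 := (h.mu_zero_iff ξ h.xi_pos).2 rfl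

lemma mu_pos (h : Assumptions μ f ξ) {x : ℝ} (hx : |x| < ξ) : 0 < μ x := by
  have := h.mu_lt_of_abs_lt (x := x) (y := ξ) (by rwa [abs_of_pos h.xi_pos])
  rwa [h.mu_xi] at this

lemma mu_nonpos (h : Assumptions μ f ξ) {x : ℝ} (hx : ξ ≤ |x|) : μ x ≤ 0 := by
  have := h.mu_le_of_abs_le (x := ξ) (y := x) (by rwa [abs_of_pos h.xi_pos])
  rwa [h.mu_xi] at this

lemma mu_zero_pos (h : Assumptions μ f ξ) : 0 < μ 0 := h.mu_pos (by simpa using h.xi_pos)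

lemma mu_le (h : Assumptions μ f ξ) (x : ℝ) : μ x ≤ μ 0 := h.mu_le_of_abs_le (by simp)

lemma exists_mu_bound (h : Assumptions μ f ξ) : ∃ B : ℝ, 0 < B ∧ ∀ x, |μ x| ≤ B :=
  exists_bound_of_memLp_top h.mu_continuous h.mu_bounded

lemma exists_f_bound (h : Assumptions μ f ξ) : ∃ B : ℝ, 0 < B ∧ ∀ x, |f x| ≤ B :=
  exists_bound_of_memLp_top h.f_continuous h.f_bounded

lemma f_int (h : Assumptions μ f ξ) : Integrable f volume := memLp_one_iff_integrable.1 h.f_integrable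

lemma f_neg (h : Assumptions μ f ξ) {x : ℝ} (hx : x < 0) : f x < 0 := by
  have := h.f_pos (-x) (by linarith)
  rw [h.f_odd] at this
  linarith

lemma f_zero (h : Assumptions μ f ξ) : f 0 = 0 := by
  have := h.f_odd 0
  rw [neg_zero] at this
  linarith

end Assumptions

/-- The positive part of `μ`. -/
def posPart (μ : ℝ → ℝ) (x : ℝ) : ℝ := max (μ x) 0

lemma posPart_nonneg (μ : ℝ → ℝ) (x : ℝ) : 0 ≤ posPart μ x := le_max_right _ _

/-- The nonnegative renormalised double-well potential. -/
def well (μ : ℝ → ℝ) (x u : ℝ) : ℝ := u ^ 4 / 4 - μ x * u ^ 2 / 2 + posPart μ x ^ 2 / 4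

lemma well_ge (μ : ℝ → ℝ) (x u : ℝ) : (u ^ 2 - posPart μ x) ^ 2 / 4 ≤ well μ x u := by
  have h1 : μ x ≤ posPart μ x := le_max_left _ _
  unfold well
  nlinarith [mul_nonneg (sub_nonneg.2 h1) (sq_nonneg u)]

lemma well_nonneg (μ : ℝ → ℝ) (x u : ℝ) : 0 ≤ well μ x u :=
  le_trans (by positivity) (well_ge μ x u)

/-- The renormalised energy density, without the linear term. -/
def density (μ : ℝ → ℝ) (ε : ℝ) (v g : ℝ → ℝ) (x : ℝ) : ℝ :=
  ε / 2 * g x ^ 2 + well μ x (v x) / ε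

/-- The renormalised energy. -/
def renEnergy (μ f : ℝ → ℝ) (a ε : ℝ) (v g : ℝ → ℝ) : ℝ :=
  ∫ x, (density μ ε v g x - a * f x * v x)

lemma density_nonneg (μ : ℝ → ℝ) {ε : ℝ} (hε : 0 < ε) (v g : ℝ → ℝ) (x : ℝ) :
    0 ≤ density μ ε v g x := by
  have := well_nonneg μ x (v x)
  unfold density; positivity

namespace Assumptions

variable {μ f : ℝ → ℝ} {ξ : ℝ}

lemma posPart_continuous (h : Assumptions μ f ξ) : Continuous (posPart μ) :=
  h.mu_continuous.max continuous_const

lemma posPart_of_le (h : Assumptions μ f ξ) {x : ℝ} (hx : ξ ≤ |x|) : posPart μ x = 0 :=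
  max_eq_right (h.mu_nonpos hx)

lemma posPart_of_lt (h : Assumptions μ f ξ) {x : ℝ} (hx : |x| < ξ) : posPart μ x = μ x :=
  max_eq_left (h.mu_pos hx).le

lemma posPart_le (h : Assumptions μ f ξ) (x : ℝ) : posPart μ x ≤ μ 0 :=
  max_le (h.mu_le x) h.mu_zero_pos.le

lemma posPart_even (h : Assumptions μ f ξ) (x : ℝ) : posPart μ (-x) = posPart μ x := by
  rw [posPart, posPart, h.mu_even]

lemma posPart_sq_integrable (h : Assumptions μ f ξ) :
    Integrable (fun x => posPart μ x ^ 2) volume := by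
  refine (h.posPart_continuous.pow 2).integrable_of_hasCompactSupport ?_
  refine HasCompactSupport.intro (isCompact_Icc (a := -ξ) (b := ξ)) fun x hx => ?_
  rw [Pi.pow_apply, h.posPart_of_le, zero_pow two_ne_zero]
  by_contra h'
  exact hx (abs_le.1 (not_le.1 h').le)

end Assumptions

lemma H1Pair.sq_integrable {v g : ℝ → ℝ} (h : H1Pair v g) : Integrable (fun x => v x ^ 2) volume :=
  h.memLp.integrable_sq

lemma H1Pair.deriv_sq_integrable {v g : ℝ → ℝ} (h : H1Pair v g) :
    Integrable (fun x => g x ^ 2) volume :=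
  h.memLp_deriv.integrable_sq

/-- An explicit Sobolev bound. -/
lemma H1Pair.abs_le {v g : ℝ → ℝ} (h : H1Pair v g) (x : ℝ) :
    |v x| ≤ 1 + ((∫ t, v t ^ 2) + ∫ t, g t ^ 2) / 2 := by
  have hloc : ∀ y ∈ Icc x (x + 1), |v x| ≤ |v y| + (1 + ∫ t, g t ^ 2) / 2 := by
    intro y hy
    have h1 : |v y - v x| ≤ (1 + ∫ t, g t ^ 2) / 2 := by
      rw [h.sub_eq]
      calc |∫ t in x..y, g t| ≤ ∫ t in x..y, |g t| :=
            intervalIntegral.abs_integral_le_integral_abs hy.1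
        _ ≤ ∫ t in x..y, (1 + g t ^ 2) / 2 := by
            refine intervalIntegral.integral_mono_on hy.1 (h.intervalIntegrable _ _).abs
              ((intervalIntegrable_const.add
                h.deriv_sq_integrable.intervalIntegrable).div_const _) fun t _ => ?_
            nlinarith [sq_nonneg (|g t| - 1), sq_abs (g t)]
        _ = ((y - x) + ∫ t in x..y, g t ^ 2) / 2 := by
            rw [intervalIntegral.integral_div, intervalIntegral.integral_add
              intervalIntegrable_const h.deriv_sq_integrable.intervalIntegrable]
            simp
        _ ≤ (1 + ∫ t, g t ^ 2) / 2 := by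
            have h2 : ∫ t in x..y, g t ^ 2 ≤ ∫ t, g t ^ 2 := by
              rw [intervalIntegral.integral_of_le hy.1]
              exact setIntegral_le_integral h.deriv_sq_integrable
                (Eventually.of_forall fun t => sq_nonneg _)
            linarith [hy.2]
    have h3 := abs_sub_abs_le_abs_sub (v x) (v y)
    rw [abs_sub_comm] at h3
    linarith
  have hx1 : x ≤ x + 1 := by linarith
  have hci : IntervalIntegrable (fun y => (1 + v y ^ 2) / 2 + (1 + ∫ t, g t ^ 2) / 2) volume
      x (x + 1) :=
    Continuous.intervalIntegrable (by have := h.continuous; fun_prop) _ _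
  have h4 : ∫ _ in x..(x + 1), |v x| ≤
      ∫ y in x..(x + 1), ((1 + v y ^ 2) / 2 + (1 + ∫ t, g t ^ 2) / 2) := by
    refine intervalIntegral.integral_mono_on hx1 intervalIntegrable_const hci fun y hy => ?_
    have := hloc y hy
    nlinarith [sq_nonneg (|v y| - 1), sq_abs (v y)]
  have h5 : ∫ y in x..(x + 1), v y ^ 2 ≤ ∫ t, v t ^ 2 := by
    rw [intervalIntegral.integral_of_le hx1]
    exact setIntegral_le_integral h.sq_integrable (Eventually.of_forall fun t => sq_nonneg _)
  have hv2 : IntervalIntegrable (fun y => v y ^ 2) volume x (x + 1) :=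
    h.sq_integrable.intervalIntegrable
  rw [intervalIntegral.integral_add ((intervalIntegrable_const.add hv2).div_const _)
    intervalIntegrable_const, intervalIntegral.integral_div,
    intervalIntegral.integral_add intervalIntegrable_const hv2] at h4
  simp only [intervalIntegral.integral_const, add_sub_cancel_left, smul_eq_mul, one_mul] at h4
  linarith

lemma H1Pair.pow_four_integrable {v g : ℝ → ℝ} (h : H1Pair v g) :
    Integrable (fun x => v x ^ 4) volume := by
  set B := 1 + ((∫ t, v t ^ 2) + ∫ t, g t ^ 2) / 2
  refine (h.sq_integrable.const_mul (B ^ 2)).mono'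
    (h.continuous.pow 4).aestronglyMeasurable (Eventually.of_forall fun x => ?_)
  have h1 : |v x| ≤ B := h.abs_le x
  rw [Real.norm_eq_abs, abs_of_nonneg (by positivity)]
  have : v x ^ 2 ≤ B ^ 2 := sq_le_sq' (by linarith [neg_abs_le (v x)]) (le_trans (le_abs_self _) h1)
  nlinarith [sq_nonneg (v x)]

section Energy

variable {μ f : ℝ → ℝ} {ξ : ℝ}

lemma H1Pair.mu_mul_integrable {v g : ℝ → ℝ} (hp : H1Pair v g) (h : Assumptions μ f ξ) :
    Integrable (fun x => μ x * v x ^ 2) volume := by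
  obtain ⟨B, hB, hμ⟩ := h.exists_mu_bound
  exact hp.sq_integrable.bdd_mul h.mu_continuous.aestronglyMeasurable
    (Eventually.of_forall fun x => hμ x)

lemma H1Pair.f_mul_integrable {v g : ℝ → ℝ} (hp : H1Pair v g) (h : Assumptions μ f ξ) :
    Integrable (fun x => f x * v x) volume :=
  h.f_int.mul_bdd hp.continuous.aestronglyMeasurable
    (Eventually.of_forall fun x => hp.abs_le x)

lemma H1Pair.well_integrable {v g : ℝ → ℝ} (hp : H1Pair v g) (h : Assumptions μ f ξ) :
    Integrable (fun x => well μ x (v x)) volume :=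
  ((hp.pow_four_integrable.div_const 4).sub ((hp.mu_mul_integrable h).div_const 2)).add
    (h.posPart_sq_integrable.div_const 4)

lemma H1Pair.density_integrable {v g : ℝ → ℝ} (hp : H1Pair v g) (h : Assumptions μ f ξ) (ε : ℝ) :
    Integrable (density μ ε v g) volume :=
  (hp.deriv_sq_integrable.const_mul _).add ((hp.well_integrable h).div_const ε)

lemma H1Pair.linear_integrable {v g : ℝ → ℝ} (hp : H1Pair v g) (h : Assumptions μ f ξ) (a : ℝ) :
    Integrable (fun x => a * f x * v x) volume := by
  simpa only [mul_assoc] using (hp.f_mul_integrable h).const_mul a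

lemma H1Pair.renEnergy_eq {v g : ℝ → ℝ} (hp : H1Pair v g) (h : Assumptions μ f ξ) (a ε : ℝ) :
    renEnergy μ f a ε v g = (∫ x, density μ ε v g x) - a * ∫ x, f x * v x := by
  rw [renEnergy, integral_sub (hp.density_integrable h ε) (hp.linear_integrable h a),
    ← integral_const_mul]
  simp only [mul_assoc]

lemma energy_eq_of_ae {w v g : ℝ → ℝ} (hp : H1Pair v g) (h : Assumptions μ f ξ) (a ε : ℝ)
    (hw : w =ᵐ[volume] v) (hg : weakDeriv w =ᵐ[volume] g) :
    energy μ f a ε w = renEnergy μ f a ε v g - ∫ x, posPart μ x ^ 2 / (4 * ε) := by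
  have hi : Integrable (fun x => density μ ε v g x - a * f x * v x) volume :=
    (hp.density_integrable h ε).sub (hp.linear_integrable h a)
  rw [renEnergy, ← integral_sub hi (h.posPart_sq_integrable.div_const _), energy]
  refine integral_congr_ae ?_
  filter_upwards [hw, hg] with x h1 h2
  rw [h1, h2, density, well, sq_abs, Even.pow_abs (by decide)]
  rcases eq_or_ne ε 0 with rfl | hε
  · simp
  · field_simp
    ring

/-- `v`, with derivative `g`, minimises the renormalised energy. -/
structure IsMinPair (μ f : ℝ → ℝ) (a ε : ℝ) (v g : ℝ → ℝ) : Prop where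
  pair : H1Pair v g
  le : ∀ w k, H1Pair w k → renEnergy μ f a ε v g ≤ renEnergy μ f a ε w k

lemma IsMinPair.isGlobalMinimizer (h : Assumptions μ f ξ) {a ε : ℝ} {v g : ℝ → ℝ}
    (hm : IsMinPair μ f a ε v g) : IsGlobalMinimizer μ f a ε v := by
  refine ⟨hm.pair.continuous, hm.pair.memH1, fun w hw => ?_⟩
  obtain ⟨w', k, hp, h1, h2⟩ := hw.exists_h1Pair
  rw [energy_eq_of_ae hp h a ε h1 h2,
    energy_eq_of_ae hm.pair h a ε (ae_eq_refl v) hm.pair.hasWeakDeriv.weakDeriv_ae_eq]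
  linarith [hm.le w' k hp]

lemma IsGlobalMinimizer.exists_isMinPair (h : Assumptions μ f ξ) {a ε : ℝ} {v : ℝ → ℝ}
    (hv : IsGlobalMinimizer μ f a ε v) : ∃ g, IsMinPair μ f a ε v g := by
  obtain ⟨hc, hH, hle⟩ := hv
  obtain ⟨g, hp⟩ := hH.exists_h1Pair_of_continuous hc
  refine ⟨g, hp, fun w k hwk => ?_⟩
  have := hle w hwk.memH1
  rw [energy_eq_of_ae hp h a ε (ae_eq_refl v) hp.hasWeakDeriv.weakDeriv_ae_eq,
    energy_eq_of_ae hwk h a ε (ae_eq_refl w) hwk.hasWeakDeriv.weakDeriv_ae_eq] at this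
  linarith

end Energy

end

section


lemma inner_toLp_eq_integral {g k : ℝ → ℝ} (hg : MemLp g 2 volume) (hk : MemLp k 2 volume) :
    inner ℝ (hg.toLp g) (hk.toLp k) = ∫ t, g t * k t := by
  rw [L2.inner_def]
  refine integral_congr_ae ?_
  filter_upwards [hg.coeFn_toLp, hk.coeFn_toLp] with x h1 h2
  rw [h1, h2, real_inner_eq_re_inner]
  simp [mul_comm]

/-- A bounded sequence in `L²(ℝ)` has a subsequence which converges weakly, tested against
indicators of intervals and against the limit. -/
lemma exists_weak_subseq {g : ℕ → ℝ → ℝ} (hg : ∀ n, MemLp (g n) 2 volume) {B : ℝ}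
    (hB : ∀ n, ∫ t, g n t ^ 2 ≤ B) :
    ∃ G : ℝ → ℝ, MemLp G 2 volume ∧ ∃ φ : ℕ → ℕ, StrictMono φ ∧
      (∀ x y : ℝ, Tendsto (fun n => ∫ t in x..y, g (φ n) t) atTop (𝓝 (∫ t in x..y, G t))) ∧
      Tendsto (fun n => ∫ t, g (φ n) t * G t) atTop (𝓝 (∫ t, G t ^ 2)) := by
  have : Fact ((2 : ENNReal) ≠ ⊤) := ⟨by norm_num⟩
  let H := Lp ℝ 2 (volume : Measure ℝ)
  let T : ℕ → H := fun n => (hg n).toLp (g n)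
  have hT : ∀ n, ‖T n‖ ≤ √B := fun n => by
    refine Real.le_sqrt_of_sq_le ?_
    rw [← real_inner_self_eq_norm_sq, inner_toLp_eq_integral]
    simpa [sq] using hB n
  obtain ⟨ℓ, -, φ, hφ, hlim⟩ := WeakDual.isSeqCompact_closedBall ℝ H 0 (√B)
    (x := fun n => WeakDual.toStrongDual.symm (InnerProductSpace.toDual ℝ H (T n)))
    fun n => by simpa using hT n
  let L : H := (InnerProductSpace.toDual ℝ H).symm (WeakDual.toStrongDual ℓ)
  have hL : ∀ k : H, Tendsto (fun n => inner ℝ (T (φ n)) k) atTop (𝓝 (inner ℝ L k)) := fun k => by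
    have h1 := ((WeakDual.eval_continuous k).tendsto ℓ).comp hlim
    have h2 : inner ℝ L k = ℓ k := InnerProductSpace.toDual_symm_apply
    rw [h2]
    exact h1
  refine ⟨L, Lp.memLp L, φ, hφ, fun x y => ?_, ?_⟩
  · have hμ : volume (uIoc x y) ≠ ⊤ := by simp [uIoc]
    have h1 := hL (indicatorConstLp 2 measurableSet_uIoc hμ 1)
    have hsw : ∀ K : H, inner ℝ K (indicatorConstLp 2 measurableSet_uIoc hμ 1) =
        ∫ t in uIoc x y, K t := fun K => by
      rw [real_inner_comm]
      exact L2.inner_indicatorConstLp_one measurableSet_uIoc hμ K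
    simp only [hsw] at h1
    simp_rw [intervalIntegral.intervalIntegral_eq_integral_uIoc]
    refine Tendsto.const_smul ?_ _
    refine h1.congr fun n => ?_
    exact integral_congr_ae (ae_restrict_of_ae (hg (φ n)).coeFn_toLp)
  · have h1 := hL ((Lp.memLp L).toLp L)
    have h2 : L = (Lp.memLp L).toLp L := (Lp.toLp_coeFn L (Lp.memLp L)).symm
    have h3 : inner ℝ L ((Lp.memLp L).toLp L) = ∫ t, L t ^ 2 := by
      conv_lhs => rw [h2]
      rw [Lp.toLp_coeFn, L2.inner_def]
      refine integral_congr_ae (Eventually.of_forall fun t => ?_)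
      simp [sq]
    rw [h3] at h1
    refine h1.congr fun n => ?_
    exact inner_toLp_eq_integral _ _

/-- The Fatou lemma for nonnegative integrable real functions. -/
lemma integrable_and_integral_le_of_tendsto {P : ℕ → ℝ → ℝ} {Q : ℝ → ℝ} {c : ℕ → ℝ} {C : ℝ}
    (hP : ∀ n, Integrable (P n) volume) (hP0 : ∀ n x, 0 ≤ P n x)
    (hPQ : ∀ x, Tendsto (fun n => P n x) atTop (𝓝 (Q x))) (hc : ∀ n, ∫ x, P n x ≤ c n)
    (hC : Tendsto c atTop (𝓝 C)) : Integrable Q volume ∧ ∫ x, Q x ≤ C := by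
  have hQ0 : ∀ x, 0 ≤ Q x := fun x => ge_of_tendsto' (hPQ x) fun n => hP0 n x
  have hQm : AEStronglyMeasurable Q volume :=
    aestronglyMeasurable_of_tendsto_ae atTop (fun n => (hP n).1) (Eventually.of_forall hPQ)
  have hC0 : 0 ≤ C := ge_of_tendsto' hC fun n => (integral_nonneg (hP0 n)).trans (hc n)
  have key : ∫⁻ x, ENNReal.ofReal (Q x) ≤ ENNReal.ofReal C := by
    calc ∫⁻ x, ENNReal.ofReal (Q x)
        = ∫⁻ x, liminf (fun n => ENNReal.ofReal (P n x)) atTop := by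
          refine lintegral_congr fun x => ?_
          exact ((ENNReal.continuous_ofReal.tendsto _).comp (hPQ x)).liminf_eq.symm
      _ ≤ liminf (fun n => ∫⁻ x, ENNReal.ofReal (P n x)) atTop :=
          lintegral_liminf_le' fun n => (hP n).1.aemeasurable.ennreal_ofReal
      _ ≤ liminf (fun n => ENNReal.ofReal (c n)) atTop := by
          refine liminf_le_liminf (Eventually.of_forall fun n => ?_)
          rw [← ofReal_integral_eq_lintegral_ofReal (hP n) (Eventually.of_forall (hP0 n))]
          exact ENNReal.ofReal_le_ofReal (hc n)
      _ = ENNReal.ofReal C := ((ENNReal.continuous_ofReal.tendsto _).comp hC).liminf_eq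
  have hQi : Integrable Q volume := by
    refine ⟨hQm, ?_⟩
    rw [hasFiniteIntegral_iff_ofReal (Eventually.of_forall hQ0)]
    exact key.trans_lt ENNReal.ofReal_lt_top
  refine ⟨hQi, ?_⟩
  rw [← ofReal_integral_eq_lintegral_ofReal hQi (Eventually.of_forall hQ0)] at key
  exact (ENNReal.ofReal_le_ofReal_iff hC0).1 key

/-- An elementary Young inequality. -/
lemma abs_le_add_pow_four {l : ℝ} (hl : 0 < l) (u : ℝ) : |u| ≤ l + u ^ 4 / l ^ 3 := by
  have h0 : 0 ≤ u ^ 4 / l ^ 3 := by positivity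
  rcases le_total |u| l with h | h
  · linarith
  · have h1 : |u| ≤ u ^ 4 / l ^ 3 := by
      rw [le_div_iff₀ (by positivity), ← Even.pow_abs (by decide : Even 4) u]
      have : l ^ 3 ≤ |u| ^ 3 := pow_le_pow_left₀ hl.le h 3
      nlinarith [abs_nonneg u]
    linarith

variable {μ f : ℝ → ℝ} {ξ : ℝ}

lemma pow_four_le_well (μ : ℝ → ℝ) (x u : ℝ) :
    u ^ 4 ≤ 8 * well μ x u + 2 * posPart μ x ^ 2 := by
  have := well_ge μ x u
  nlinarith [sq_nonneg (u ^ 2 - 2 * posPart μ x)]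

/-- The linear term is controlled by half of the potential and an integrable function. -/
lemma exists_linear_le (h : Assumptions μ f ξ) {a ε : ℝ} (ha : 0 ≤ a) (hε : 0 < ε) :
    ∃ k : ℝ → ℝ, Integrable k volume ∧
      ∀ x u, a * f x * u ≤ well μ x u / (2 * ε) + k x := by
  obtain ⟨F, hF, hf⟩ := h.exists_f_bound
  obtain ⟨l, hl1, hl⟩ : ∃ l : ℝ, 1 ≤ l ∧ 16 * a * F * ε ≤ l :=
    ⟨max 1 (16 * a * F * ε), le_max_left _ _, le_max_right _ _⟩
  have hl0 : 0 < l := by linarith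
  refine ⟨fun x => a * l * |f x| + a * F / l ^ 3 * (2 * posPart μ x ^ 2),
    (h.f_int.abs.const_mul _).add ((h.posPart_sq_integrable.const_mul 2).const_mul _),
    fun x u => ?_⟩
  have hW := well_nonneg μ x u
  have h1 : a * f x * u ≤ a * (|f x| * |u|) := by
    rw [mul_assoc, ← abs_mul]
    exact mul_le_mul_of_nonneg_left (le_abs_self _) ha
  have h2 : |f x| * |u| ≤ l * |f x| + F * (u ^ 4 / l ^ 3) := by
    calc |f x| * |u| ≤ |f x| * (l + u ^ 4 / l ^ 3) :=
          mul_le_mul_of_nonneg_left (abs_le_add_pow_four hl0 u) (abs_nonneg _)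
      _ = l * |f x| + |f x| * (u ^ 4 / l ^ 3) := by ring
      _ ≤ _ := by
          have : |f x| * (u ^ 4 / l ^ 3) ≤ F * (u ^ 4 / l ^ 3) :=
            mul_le_mul_of_nonneg_right (hf x) (by positivity)
          linarith
  have h3 : a * (F * (u ^ 4 / l ^ 3)) ≤
      a * F / l ^ 3 * (8 * well μ x u) + a * F / l ^ 3 * (2 * posPart μ x ^ 2) := by
    have : a * (F * (u ^ 4 / l ^ 3)) = a * F / l ^ 3 * u ^ 4 := by ring
    rw [this, ← mul_add]
    exact mul_le_mul_of_nonneg_left (pow_four_le_well μ x u) (by positivity)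
  have h4 : a * F / l ^ 3 * (8 * well μ x u) ≤ well μ x u / (2 * ε) := by
    rw [div_mul_eq_mul_div, div_le_div_iff₀ (by positivity) (by positivity)]
    have : l ≤ l ^ 3 := le_self_pow₀ hl1 (by norm_num)
    nlinarith [mul_le_mul_of_nonneg_right (hl.trans this) hW]
  have h5 := mul_le_mul_of_nonneg_left h2 ha
  nlinarith

lemma exists_sq_le_well (h : Assumptions μ f ξ) :
    ∃ C : ℝ, 0 ≤ C ∧ ∃ k : ℝ → ℝ, Integrable k volume ∧ ∀ x u, u ^ 2 ≤ C * well μ x u + k x := by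
  have hξ := h.xi_pos
  have hm : μ (2 * ξ) < 0 := by
    have := h.mu_lt_of_abs_lt (x := ξ) (y := 2 * ξ) (by
      rw [abs_of_pos hξ, abs_of_pos (by linarith)]; linarith)
    rwa [h.mu_xi] at this
  set m := -μ (2 * ξ) with hmdef
  have hm0 : 0 < m := by linarith
  refine ⟨8 + 2 / m, by positivity, fun x => (Icc (-(2 * ξ)) (2 * ξ)).indicator (fun _ => 1) x +
    2 * posPart μ x ^ 2, ?_, fun x u => ?_⟩
  · refine Integrable.add ?_ (h.posPart_sq_integrable.const_mul 2)
    exact (integrable_indicator_iff measurableSet_Icc).2 (integrableOn_const (by simp))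
  have hW := well_nonneg μ x u
  beta_reduce
  by_cases hx : x ∈ Icc (-(2 * ξ)) (2 * ξ)
  · rw [indicator_of_mem hx]
    have h1 := pow_four_le_well μ x u
    have h2 : 0 ≤ 2 / m * well μ x u := by positivity
    nlinarith [sq_nonneg (u ^ 2 - 1), sq_nonneg u]
  · rw [indicator_of_notMem hx]
    have hx' : 2 * ξ ≤ |x| := by
      by_contra h'
      exact hx (abs_le.1 (not_le.1 h').le)
    have h1 : μ x ≤ -m := by
      have := h.mu_le_of_abs_le (x := 2 * ξ) (y := x) (by rwa [abs_of_pos (by linarith)])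
      linarith
    have h2 : m * u ^ 2 / 2 ≤ well μ x u := by
      unfold well
      nlinarith [sq_nonneg (u ^ 2), sq_nonneg (posPart μ x), sq_nonneg u]
    have h3 : u ^ 2 ≤ 2 / m * well μ x u := by
      rw [div_mul_eq_mul_div, le_div_iff₀ hm0]
      linarith
    nlinarith [sq_nonneg (posPart μ x)]

lemma h1Pair_zero : H1Pair (fun _ => 0) (fun _ => 0) :=
  ⟨MemLp.zero, MemLp.zero, fun x y => by simp⟩

/-- The energy is coercive. -/
lemma le_renEnergy (h : Assumptions μ f ξ) {a ε : ℝ} (ha : 0 ≤ a) (hε : 0 < ε) :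
    ∃ C : ℝ, ∀ v g, H1Pair v g →
      ε / 2 * (∫ x, g x ^ 2) + (∫ x, well μ x (v x)) / (2 * ε) ≤ renEnergy μ f a ε v g + C := by
  obtain ⟨k, hk, hle⟩ := exists_linear_le h ha hε
  refine ⟨∫ x, k x, fun v g hp => ?_⟩
  have hi : Integrable (fun x => density μ ε v g x - a * f x * v x) volume :=
    (hp.density_integrable h ε).sub (hp.linear_integrable h a)
  rw [renEnergy, ← integral_add hi hk, ← integral_const_mul, ← integral_div,
    ← integral_add (hp.deriv_sq_integrable.const_mul _) ((hp.well_integrable h).div_const _)]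
  refine integral_mono ((hp.deriv_sq_integrable.const_mul _).add
    ((hp.well_integrable h).div_const _)) (hi.add hk) fun x => ?_
  have := hle x (v x)
  have h2 : well μ x (v x) / ε = well μ x (v x) / (2 * ε) + well μ x (v x) / (2 * ε) := by
    field_simp; ring
  simp only [density]
  linarith

theorem exists_isMinPair (h : Assumptions μ f ξ) {a ε : ℝ} (ha : 0 ≤ a) (hε : 0 < ε) :
    ∃ v g, IsMinPair μ f a ε v g := by
  obtain ⟨C, hC⟩ := le_renEnergy h ha hε
  let S : Set ℝ := {r | ∃ v g, H1Pair v g ∧ renEnergy μ f a ε v g = r}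
  have hSne : S.Nonempty := ⟨_, _, _, h1Pair_zero, rfl⟩
  have hnn : ∀ v g, H1Pair v g → 0 ≤ ∫ x, g x ^ 2 := fun v g _ =>
    integral_nonneg fun x => sq_nonneg _
  have hnW : ∀ v : ℝ → ℝ, 0 ≤ ∫ x, well μ x (v x) := fun v =>
    integral_nonneg fun x => well_nonneg _ _ _
  have hSb : BddBelow S := ⟨-C, by
    rintro r ⟨v, g, hp, rfl⟩
    have h1 := hC v g hp
    have h2 := hnn v g hp
    have h3 := hnW v
    have : 0 ≤ ε / 2 * (∫ x, g x ^ 2) + (∫ x, well μ x (v x)) / (2 * ε) := by positivity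
    linarith⟩
  obtain ⟨r, hr, hrlim, hrS⟩ := exists_seq_tendsto_sInf hSne hSb
  choose v g hp hrv using hrS
  set m := sInf S
  have hr0 : ∀ n, r n ≤ r 0 := fun n => hr (Nat.zero_le n)
  have hgB : ∀ n, ∫ t, g n t ^ 2 ≤ (r 0 + C) / (ε / 2) := fun n => by
    have h1 := hC _ _ (hp n)
    have h3 := hnW (v n)
    have : 0 ≤ (∫ x, well μ x (v n x)) / (2 * ε) := by positivity
    rw [le_div_iff₀ (by positivity)]
    linarith [hr0 n, hrv n]
  have hWB : ∀ n, ∫ x, well μ x (v n x) ≤ (r 0 + C) * (2 * ε) := fun n => by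
    have h1 := hC _ _ (hp n)
    have h3 := hnn _ _ (hp n)
    have : 0 ≤ ε / 2 * ∫ x, g n x ^ 2 := by positivity
    rw [← div_le_iff₀ (by positivity)]
    linarith [hr0 n, hrv n]
  obtain ⟨D, hD, kk, hkk, hsq⟩ := exists_sq_le_well h
  obtain ⟨V, hV⟩ : ∃ V : ℝ, ∀ n, ∫ x, v n x ^ 2 ≤ V := by
    refine ⟨D * ((r 0 + C) * (2 * ε)) + ∫ x, kk x, fun n => ?_⟩
    calc ∫ x, v n x ^ 2 ≤ ∫ x, (D * well μ x (v n x) + kk x) :=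
          integral_mono (hp n).sq_integrable
            ((((hp n).well_integrable h).const_mul D).add hkk) fun x => hsq x _
      _ = D * (∫ x, well μ x (v n x)) + ∫ x, kk x := by
          rw [integral_add (((hp n).well_integrable h).const_mul D) hkk, integral_const_mul]
      _ ≤ _ := by
          have := mul_le_mul_of_nonneg_left (hWB n) hD
          linarith
  obtain ⟨G, hG, φ, hφ, hφint, hφG⟩ := exists_weak_subseq (fun n => (hp n).memLp_deriv) hgB
  obtain ⟨c, -, ψ, hψ, hc⟩ := tendsto_subseq_of_bounded
    (Metric.isBounded_closedBall (x := (0 : ℝ)) (r := 1 + (V + (r 0 + C) / (ε / 2)) / 2))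
    (x := fun n => v (φ n) 0) fun n => by
      rw [mem_closedBall_zero_iff, Real.norm_eq_abs]
      have := (hp (φ n)).abs_le 0
      linarith [hV (φ n), hgB (φ n)]
  let σ : ℕ → ℕ := φ ∘ ψ
  have hσ : StrictMono σ := hφ.comp hψ
  let u : ℝ → ℝ := fun x => c + ∫ t in (0 : ℝ)..x, G t
  have hGloc := hG.locallyIntegrable (by norm_num : (1 : ENNReal) ≤ 2)
  have hu : ∀ x y, u y - u x = ∫ t in x..y, G t := fun x y => by
    simp only [u, add_sub_add_left_eq_sub]
    exact intervalIntegral.integral_interval_sub_left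
      (intervalIntegrable_of_locallyIntegrable hGloc _ _)
      (intervalIntegrable_of_locallyIntegrable hGloc _ _)
  have hlim : ∀ x, Tendsto (fun n => v (σ n) x) atTop (𝓝 (u x)) := fun x => by
    have h1 := hc.add ((hφint 0 x).comp hψ.tendsto_atTop)
    refine h1.congr fun n => ?_
    have := (hp (σ n)).sub_eq 0 x
    simp only [Function.comp, σ] at this ⊢
    linarith
  have hu2 : Integrable (fun x => u x ^ 2) volume :=
    (integrable_and_integral_le_of_tendsto (fun n => (hp (σ n)).sq_integrable)
      (fun n x => sq_nonneg _) (fun x => (hlim x).pow 2) (fun n => hV (σ n))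
      tendsto_const_nhds).1
  have hpair : H1Pair u G :=
    ⟨(memLp_two_iff_integrable_sq
      (continuous_of_primitive hGloc hu).aestronglyMeasurable).2 hu2, hG, hu⟩
  refine ⟨u, G, hpair, fun w k hwk => ?_⟩
  refine le_trans ?_ (csInf_le hSb ⟨w, k, hwk, rfl⟩)
  obtain ⟨q, hq, hle⟩ := exists_linear_le h ha hε
  let P : ℝ → ℝ → ℝ := fun x s => well μ x s / ε - a * f x * s + q x
  have hP0 : ∀ x s, 0 ≤ P x s := fun x s => by
    have h1 := hle x s
    have h2 := well_nonneg μ x s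
    have h3 : well μ x s / (2 * ε) ≤ well μ x s / ε :=
      div_le_div_of_nonneg_left h2 hε (by linarith)
    simp only [P]
    linarith
  have hPint : ∀ w k, H1Pair w k → Integrable (fun x => P x (w x)) volume := fun w k hw =>
    (((hw.well_integrable h).div_const ε).sub (hw.linear_integrable h a)).add hq
  have hPeq : ∀ w k, H1Pair w k →
      ∫ x, P x (w x) = renEnergy μ f a ε w k + (∫ x, q x) - ε / 2 * ∫ x, k x ^ 2 := by
    intro w k hw
    have hi : Integrable (fun x => density μ ε w k x - a * f x * w x) volume :=
      (hw.density_integrable h ε).sub (hw.linear_integrable h a)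
    have hiq : Integrable (fun x => density μ ε w k x - a * f x * w x + q x) volume := hi.add hq
    rw [renEnergy, ← integral_add hi hq, ← integral_const_mul,
      ← integral_sub hiq (hw.deriv_sq_integrable.const_mul _)]
    congr 1; ext x; simp only [P, density]; ring
  have hbound : ∀ n, ∫ x, P x (v (σ n) x) ≤ r (σ n) + (∫ x, q x) -
      ε / 2 * (2 * (∫ t, g (σ n) t * G t) - ∫ t, G t ^ 2) := fun n => by
    rw [hPeq _ _ (hp (σ n)), hrv]
    have hgi : Integrable (fun t => g (σ n) t * G t) volume :=
      (hp (σ n)).memLp_deriv.integrable_mul hG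
    have h1 : 2 * (∫ t, g (σ n) t * G t) - (∫ t, G t ^ 2) ≤ ∫ t, g (σ n) t ^ 2 := by
      rw [← integral_const_mul, ← integral_sub (hgi.const_mul 2) hpair.deriv_sq_integrable]
      refine integral_mono ((hgi.const_mul 2).sub hpair.deriv_sq_integrable)
        (hp (σ n)).deriv_sq_integrable fun t => ?_
      nlinarith [sq_nonneg (g (σ n) t - G t)]
    have := mul_le_mul_of_nonneg_left h1 (by positivity : 0 ≤ ε / 2)
    linarith
  have hfin := (integrable_and_integral_le_of_tendsto (fun n => hPint _ _ (hp (σ n)))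
    (fun n x => hP0 x _) (Q := fun x => P x (u x))
    (fun x => by
      have := hlim x
      have hcont : Continuous (P x) := by
        simp only [P, well]; fun_prop
      exact (hcont.tendsto _).comp this) hbound
    (((hrlim.comp hσ.tendsto_atTop).add_const _).sub
      ((((hφG.comp hψ.tendsto_atTop).const_mul 2).sub_const _).const_mul _))).2
  rw [hPeq _ _ hpair] at hfin
  linarith

end

section


variable {μ f : ℝ → ℝ} {ξ a ε : ℝ} {v g w k : ℝ → ℝ}

/-- Two pairs whose functions agree at `c` can be glued there. -/
lemma H1Pair.glue (h1 : H1Pair v g) (h2 : H1Pair w k) {c : ℝ} (hc : v c = w c) :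
    H1Pair (fun x => if x ≤ c then v x else w x) (fun x => if x ≤ c then g x else k x) := by
  have hmem : ∀ p q : ℝ → ℝ, MemLp p 2 volume → MemLp q 2 volume →
      MemLp (fun x => if x ≤ c then p x else q x) 2 volume := fun p q hp hq =>
    MemLp.piecewise (s := Iic c) measurableSet_Iic (hp.restrict _) (hq.restrict _)
  have hgk := hmem g k h1.memLp_deriv h2.memLp_deriv
  refine ⟨hmem v w h1.memLp h2.memLp, hgk, ?_⟩
  have hloc := hgk.locallyIntegrable (by norm_num : (1 : ENNReal) ≤ 2)
  have key : ∀ x, (if x ≤ c then v x else w x) - v c =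
      ∫ t in c..x, if t ≤ c then g t else k t := by
    intro x
    rcases le_or_gt x c with hx | hx
    · rw [if_pos hx, h1.sub_eq c x]
      refine intervalIntegral.integral_congr fun t ht => ?_
      rw [uIcc_of_ge hx] at ht
      simp only [if_pos ht.2]
    · rw [if_neg (not_le.2 hx), hc, h2.sub_eq c x]
      refine intervalIntegral.integral_congr_ae (Eventually.of_forall fun t ht => ?_)
      rw [uIoc_of_le hx.le] at ht
      simp only [if_neg (not_le.2 ht.1)]
  intro x y
  have hi := intervalIntegrable_of_locallyIntegrable hloc
  have := intervalIntegral.integral_interval_sub_left (hi c y) (hi c x)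
  rw [← this, ← key x, ← key y]
  ring

lemma H1Pair.neg (h : H1Pair v g) : H1Pair (fun x => -v x) (fun x => -g x) :=
  ⟨h.memLp.neg, h.memLp_deriv.neg, fun x y => by
    rw [intervalIntegral.integral_neg, ← h.sub_eq]; ring⟩

lemma H1Pair.comp_neg (h : H1Pair v g) : H1Pair (fun x => v (-x)) (fun x => -g (-x)) := by
  have hm : MeasurePreserving (fun x : ℝ => -x) volume volume := Measure.measurePreserving_neg _
  refine ⟨h.memLp.comp_measurePreserving hm, (h.memLp_deriv.comp_measurePreserving hm).neg,
    fun x y => ?_⟩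
  rw [intervalIntegral.integral_neg, intervalIntegral.integral_comp_neg (fun t => g t),
    ← h.sub_eq]
  ring

/-- The integrand of the renormalised energy. -/
def integrand (μ f : ℝ → ℝ) (a ε : ℝ) (v g : ℝ → ℝ) (x : ℝ) : ℝ :=
  density μ ε v g x - a * f x * v x

lemma H1Pair.integrand_integrable (hp : H1Pair v g) (h : Assumptions μ f ξ) (a ε : ℝ) :
    Integrable (integrand μ f a ε v g) volume :=
  (hp.density_integrable h ε).sub (hp.linear_integrable h a)

lemma H1Pair.renEnergy_split (hp : H1Pair v g) (h : Assumptions μ f ξ) (a ε c : ℝ) :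
    renEnergy μ f a ε v g =
      (∫ x in Iic c, integrand μ f a ε v g x) + ∫ x in Ioi c, integrand μ f a ε v g x :=
  (intervalIntegral.integral_Iic_add_Ioi (hp.integrand_integrable h a ε).integrableOn
    (hp.integrand_integrable h a ε).integrableOn).symm

lemma H1Pair.renEnergy_glue (h1 : H1Pair v g) (h2 : H1Pair w k) (h : Assumptions μ f ξ)
    (a ε : ℝ) {c : ℝ} (hc : v c = w c) :
    renEnergy μ f a ε (fun x => if x ≤ c then v x else w x) (fun x => if x ≤ c then g x else k x) =
      (∫ x in Iic c, integrand μ f a ε v g x) + ∫ x in Ioi c, integrand μ f a ε w k x := by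
  rw [(h1.glue h2 hc).renEnergy_split h a ε c]
  congr 1
  · refine setIntegral_congr_fun measurableSet_Iic fun x hx => ?_
    simp only [integrand, density, if_pos (mem_Iic.1 hx)]
  · refine setIntegral_congr_fun measurableSet_Ioi fun x hx => ?_
    simp only [integrand, density, if_neg (not_le.2 (mem_Ioi.1 hx))]

lemma IsMinPair.setIntegral_Ioi_le (hm : IsMinPair μ f a ε v g) (h : Assumptions μ f ξ)
    (h2 : H1Pair w k) {c : ℝ} (hc : v c = w c) :
    ∫ x in Ioi c, integrand μ f a ε v g x ≤ ∫ x in Ioi c, integrand μ f a ε w k x := by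
  have h1 := hm.le _ _ (hm.pair.glue h2 hc)
  rw [hm.pair.renEnergy_glue h2 h a ε hc, hm.pair.renEnergy_split h a ε c] at h1
  linarith

lemma IsMinPair.glue (hm : IsMinPair μ f a ε v g) (h : Assumptions μ f ξ)
    (h2 : H1Pair w k) {c : ℝ} (hc : v c = w c)
    (hle : ∫ x in Ioi c, integrand μ f a ε w k x ≤ ∫ x in Ioi c, integrand μ f a ε v g x) :
    IsMinPair μ f a ε (fun x => if x ≤ c then v x else w x)
      (fun x => if x ≤ c then g x else k x) := by
  refine ⟨hm.pair.glue h2 hc, fun w' k' h' => ?_⟩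
  refine le_trans ?_ (hm.le w' k' h')
  rw [hm.pair.renEnergy_glue h2 h a ε hc, hm.pair.renEnergy_split h a ε c]
  linarith

lemma renEnergy_odd_symm (h : Assumptions μ f ξ) (a ε : ℝ) (v g : ℝ → ℝ) :
    renEnergy μ f a ε (fun x => -v (-x)) (fun x => g (-x)) = renEnergy μ f a ε v g := by
  rw [renEnergy, renEnergy, ← integral_neg_eq_self]
  congr 1; ext x
  simp only [density, well, neg_neg, h.mu_even, h.posPart_even, h.f_odd]
  ring

lemma H1Pair.odd_symm (h : H1Pair v g) : H1Pair (fun x => -v (-x)) (fun x => g (-x)) := by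
  simpa using h.comp_neg.neg

lemma IsMinPair.odd_symm (hm : IsMinPair μ f a ε v g) (h : Assumptions μ f ξ) :
    IsMinPair μ f a ε (fun x => -v (-x)) (fun x => g (-x)) :=
  ⟨hm.pair.odd_symm, fun w k hw => by
    rw [renEnergy_odd_symm h]; exact hm.le w k hw⟩

lemma renEnergy_neg (μ f : ℝ → ℝ) (ε : ℝ) (v g : ℝ → ℝ) :
    renEnergy μ f 0 ε (fun x => -v x) (fun x => -g x) = renEnergy μ f 0 ε v g := by
  rw [renEnergy, renEnergy]
  congr 1; ext x
  simp only [density, well]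
  ring

lemma IsMinPair.neg (hm : IsMinPair μ f 0 ε v g) :
    IsMinPair μ f 0 ε (fun x => -v x) (fun x => -g x) :=
  ⟨hm.pair.neg, fun w k hw => by rw [renEnergy_neg]; exact hm.le w k hw⟩

/-- The right-hand side of the Euler–Lagrange equation `v'' = force x v`. -/
def force (μ f : ℝ → ℝ) (a ε x u : ℝ) : ℝ := (u ^ 3 - μ x * u - ε * a * f x) / ε ^ 2

lemma force_continuous (h : Assumptions μ f ξ) (hv : Continuous v) :
    Continuous fun x => force μ f a ε x (v x) := by
  have h1 := h.mu_continuous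
  have h2 := h.f_continuous
  unfold force
  fun_prop

lemma h1Pair_of_contDiff {φ : ℝ → ℝ} (hφ : ContDiff ℝ ∞ φ) (hc : HasCompactSupport φ) :
    H1Pair φ (deriv φ) := by
  have hd : Continuous (deriv φ) := hφ.continuous_deriv (by simp)
  refine ⟨hφ.continuous.memLp_of_hasCompactSupport hc, hd.memLp_of_hasCompactSupport hc.deriv,
    fun x y => ?_⟩
  rw [intervalIntegral.integral_deriv_eq_sub (fun t _ => (hφ.differentiable (by simp)) t)
    (hd.intervalIntegrable _ _)]

lemma H1Pair.add_smul (h1 : H1Pair v g) (h2 : H1Pair w k) (t : ℝ) :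
    H1Pair (fun x => v x + t * w x) (fun x => g x + t * k x) :=
  ⟨h1.memLp.add (h2.memLp.const_mul t), h1.memLp_deriv.add (h2.memLp_deriv.const_mul t),
    fun x y => by
      rw [intervalIntegral.integral_add (h1.intervalIntegrable _ _)
        ((h2.intervalIntegrable _ _).const_mul t), intervalIntegral.integral_const_mul,
        ← h1.sub_eq, ← h2.sub_eq]
      ring⟩

lemma eq_zero_of_quartic_nonneg {A B C D : ℝ}
    (h : ∀ t : ℝ, 0 ≤ t * A + t ^ 2 * B + t ^ 3 * C + t ^ 4 * D) : A = 0 := by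
  have hd : HasDerivAt (fun t : ℝ => t * A + t ^ 2 * B + t ^ 3 * C + t ^ 4 * D) A 0 := by
    have h1 := ((((hasDerivAt_id (0 : ℝ)).mul_const A).add
      (((hasDerivAt_id (0 : ℝ)).pow 2).mul_const B)).add
      (((hasDerivAt_id (0 : ℝ)).pow 3).mul_const C)).add
      (((hasDerivAt_id (0 : ℝ)).pow 4).mul_const D)
    exact h1.congr_deriv (by simp)
  have hmin : IsLocalMin (fun t : ℝ => t * A + t ^ 2 * B + t ^ 3 * C + t ^ 4 * D) 0 :=
    Eventually.of_forall fun t => by simpa using h t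
  exact hmin.hasDerivAt_eq_zero hd

/-- The weak Euler–Lagrange equation. -/
lemma IsMinPair.hasWeakDeriv (hm : IsMinPair μ f a ε v g) (h : Assumptions μ f ξ) (hε : 0 < ε) :
    HasWeakDeriv g fun x => force μ f a ε x (v x) := by
  have hp := hm.pair
  have hv := hp.continuous
  have hμ := h.mu_continuous
  have hf := h.f_continuous
  have hF := force_continuous (a := a) (ε := ε) h hv
  refine ⟨hp.locallyIntegrable, hF.locallyIntegrable, fun φ hφ hc => ?_⟩
  have hq := h1Pair_of_contDiff hφ hc
  have hφc := hφ.continuous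
  have hφd : Continuous (deriv φ) := hφ.continuous_deriv (by simp)
  have hci : ∀ p : ℝ → ℝ, Continuous p → Integrable (fun x => p x * φ x) volume := fun p hp =>
    (hp.mul hφc).integrable_of_hasCompactSupport hc.mul_left
  have hgd : Integrable (fun x => g x * deriv φ x) volume :=
    hp.memLp_deriv.integrable_mul hq.memLp_deriv
  have hdd : Integrable (fun x => deriv φ x ^ 2) volume := hq.deriv_sq_integrable
  let α : ℝ → ℝ := fun x => ε * (g x * deriv φ x) + ε * (force μ f a ε x (v x) * φ x)
  let β : ℝ → ℝ := fun x => ε / 2 * deriv φ x ^ 2 +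
    ((3 * v x ^ 2 * φ x / 2 - μ x * φ x / 2) / ε) * φ x
  let γ : ℝ → ℝ := fun x => (v x * φ x ^ 2 / ε) * φ x
  let δ : ℝ → ℝ := fun x => (φ x ^ 3 / (4 * ε)) * φ x
  have hα : Integrable α volume := (hgd.const_mul ε).add ((hci _ hF).const_mul ε)
  have hβ : Integrable β volume := (hdd.const_mul _).add (hci _ (by fun_prop))
  have hγ : Integrable γ volume := hci _ (by fun_prop)
  have hδ : Integrable δ volume := hci _ (by fun_prop)
  have hexp : ∀ t : ℝ, renEnergy μ f a ε (fun x => v x + t * φ x) (fun x => g x + t * deriv φ x) =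
      renEnergy μ f a ε v g + (t * (∫ x, α x) + t ^ 2 * (∫ x, β x) + t ^ 3 * (∫ x, γ x) +
        t ^ 4 * ∫ x, δ x) := by
    intro t
    have e1 : Integrable (fun x => t * α x + t ^ 2 * β x) volume :=
      (hα.const_mul t).add (hβ.const_mul _)
    have e2 : Integrable (fun x => t * α x + t ^ 2 * β x + t ^ 3 * γ x) volume :=
      e1.add (hγ.const_mul _)
    have e3 : Integrable (fun x => t * α x + t ^ 2 * β x + t ^ 3 * γ x + t ^ 4 * δ x) volume :=
      e2.add (hδ.const_mul _)
    have e0 : Integrable (fun x => density μ ε v g x - a * f x * v x) volume :=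
      hp.integrand_integrable h a ε
    rw [← integral_const_mul, ← integral_const_mul, ← integral_const_mul, ← integral_const_mul,
      ← integral_add (hα.const_mul t) (hβ.const_mul _), ← integral_add e1 (hγ.const_mul _),
      ← integral_add e2 (hδ.const_mul _), renEnergy, renEnergy, ← integral_add e0 e3]
    congr 1; ext x
    simp only [density, well, α, β, γ, δ, force]
    field_simp
    ring
  have hzero := eq_zero_of_quartic_nonneg (A := ∫ x, α x) (B := ∫ x, β x) (C := ∫ x, γ x)
    (D := ∫ x, δ x) fun t => by
      have := hm.le _ _ (hp.add_smul hq t)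
      rw [hexp] at this
      linarith
  simp only [α] at hzero
  rw [integral_add (hgd.const_mul ε) ((hci _ hF).const_mul ε), integral_const_mul,
    integral_const_mul, ← mul_add] at hzero
  have := (mul_eq_zero.1 hzero).resolve_left hε.ne'
  linarith

/-- A minimiser together with its classical regularity. -/
structure RegMin (μ f : ℝ → ℝ) (a ε : ℝ) (v : ℝ → ℝ) : Prop where
  min : IsMinPair μ f a ε v (deriv v)
  hasDerivAt : ∀ x, HasDerivAt v (deriv v x) x
  hasDerivAt_deriv : ∀ x, HasDerivAt (deriv v) (force μ f a ε x (v x)) x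

lemma IsMinPair.regMin (hm : IsMinPair μ f a ε v g) (h : Assumptions μ f ξ) (hε : 0 < ε) :
    RegMin μ f a ε v := by
  obtain ⟨c, hc⟩ := (hm.hasWeakDeriv h hε).ae_eq_primitive
  have hF := force_continuous (a := a) (ε := ε) h hm.pair.continuous
  set G : ℝ → ℝ := fun x => c + ∫ t in (0 : ℝ)..x, force μ f a ε t (v t)
  have hG : ∀ x, HasDerivAt G (force μ f a ε x (v x)) x := fun x =>
    (intervalIntegral.integral_hasDerivAt_right (hF.intervalIntegrable _ _)
      (hF.stronglyMeasurableAtFilter _ _) hF.continuousAt).const_add c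
  have hGc : Continuous G := continuous_iff_continuousAt.2 fun x => (hG x).continuousAt
  have hsub : ∀ x y, v y - v x = ∫ t in x..y, G t := fun x y => by
    rw [hm.pair.sub_eq]
    refine intervalIntegral.integral_congr_ae ?_
    filter_upwards [hc] with t ht _ using ht
  have hv : ∀ x, HasDerivAt v (G x) x := fun x => by
    rw [eq_primitive hsub 0]
    exact (intervalIntegral.integral_hasDerivAt_right (hGc.intervalIntegrable _ _)
      (hGc.stronglyMeasurableAtFilter _ _) hGc.continuousAt).const_add _
  have hdv : deriv v = G := funext fun x => (hv x).deriv
  have hpair : H1Pair v G := ⟨hm.pair.memLp, hm.pair.memLp_deriv.ae_eq hc, hsub⟩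
  rw [← hdv] at hpair hG hv hc
  refine ⟨⟨hpair, fun w k hw => ?_⟩, hv, hG⟩
  convert hm.le w k hw using 1
  refine integral_congr_ae ?_
  filter_upwards [hc] with x hx
  simp only [density, hx]

lemma IsGlobalMinimizer.regMin (h : Assumptions μ f ξ) (hε : 0 < ε)
    (hv : IsGlobalMinimizer μ f a ε v) : RegMin μ f a ε v := by
  obtain ⟨g, hg⟩ := hv.exists_isMinPair h
  exact hg.regMin h hε

lemma RegMin.continuous (hr : RegMin μ f a ε v) : Continuous v := hr.min.pair.continuous

lemma RegMin.continuous_deriv (hr : RegMin μ f a ε v) : Continuous (deriv v) :=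
  continuous_iff_continuousAt.2 fun x => (hr.hasDerivAt_deriv x).continuousAt

lemma RegMin.contDiff (hr : RegMin μ f a ε v) : ContDiff ℝ 1 v :=
  contDiff_one_iff_deriv.2 ⟨fun x => (hr.hasDerivAt x).differentiableAt, hr.continuous_deriv⟩

lemma RegMin.odd_symm (hr : RegMin μ f a ε v) (h : Assumptions μ f ξ) (hε : 0 < ε) :
    RegMin μ f a ε (fun x => -v (-x)) :=
  (hr.min.odd_symm h).regMin h hε

/-- Unique continuation for the Euler–Lagrange equation. -/
lemma RegMin.eq_of_eq (hv : RegMin μ f a ε v) (hw : RegMin μ f a ε w) (h : Assumptions μ f ξ)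
    {c : ℝ} (h0 : v c = w c) (h1 : deriv v c = deriv w c) : v = w := by
  obtain ⟨m, hm, hμ⟩ := h.exists_mu_bound
  set B := max (1 + ((∫ t, v t ^ 2) + ∫ t, deriv v t ^ 2) / 2)
    (1 + ((∫ t, w t ^ 2) + ∫ t, deriv w t ^ 2) / 2)
  have hvB : ∀ x, |v x| ≤ B := fun x => (hv.min.pair.abs_le x).trans (le_max_left _ _)
  have hwB : ∀ x, |w x| ≤ B := fun x => (hw.min.pair.abs_le x).trans (le_max_right _ _)
  have hB : 0 ≤ B := (abs_nonneg _).trans (hvB 0)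
  let K : NNReal := ⟨1 + (3 * B ^ 2 + m) / ε ^ 2, by positivity⟩
  let s : ℝ → Set (ℝ × ℝ) := fun _ => {z | |z.1| ≤ B}
  let F : ℝ → ℝ × ℝ → ℝ × ℝ := fun t z => (z.2, force μ f a ε t z.1)
  have hF : ∀ t, LipschitzOnWith K (F t) (s t) := by
    intro t
    refine LipschitzOnWith.of_dist_le_mul fun z hz y hy => ?_
    have hK : (K : ℝ) = 1 + (3 * B ^ 2 + m) / ε ^ 2 := rfl
    rw [hK, Prod.dist_eq]
    have hd1 : |z.1 - y.1| ≤ dist z y := by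
      rw [← Real.dist_eq]; exact le_max_left _ _
    have hd2 : |z.2 - y.2| ≤ dist z y := by
      rw [← Real.dist_eq]; exact le_max_right _ _
    have hq : 0 ≤ (3 * B ^ 2 + m) / ε ^ 2 := by positivity
    refine max_le ?_ ?_
    · simp only [F, Real.dist_eq]
      nlinarith [mul_nonneg hq (dist_nonneg (x := z) (y := y))]
    · simp only [F, Real.dist_eq]
      have e : force μ f a ε t z.1 - force μ f a ε t y.1 =
          (z.1 - y.1) * ((z.1 ^ 2 + z.1 * y.1 + y.1 ^ 2 - μ t) / ε ^ 2) := by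
        unfold force; ring
      rw [e, abs_mul, abs_div, abs_of_nonneg (sq_nonneg ε)]
      have hz' : |z.1| ≤ B := hz
      have hy' : |y.1| ≤ B := hy
      have b1 : |z.1 ^ 2 + z.1 * y.1 + y.1 ^ 2 - μ t| ≤ 3 * B ^ 2 + m := by
        have c1 := abs_le.1 hz'
        have c2 := abs_le.1 hy'
        have c3 := abs_le.1 (hμ t)
        rw [abs_le]
        constructor <;> nlinarith [sq_nonneg (z.1 + y.1), mul_nonneg hB hB]
      have b2 : |z.1 ^ 2 + z.1 * y.1 + y.1 ^ 2 - μ t| / ε ^ 2 ≤ (3 * B ^ 2 + m) / ε ^ 2 :=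
        div_le_div_of_nonneg_right b1 (sq_nonneg ε)
      calc |z.1 - y.1| * (|z.1 ^ 2 + z.1 * y.1 + y.1 ^ 2 - μ t| / ε ^ 2)
          ≤ dist z y * ((3 * B ^ 2 + m) / ε ^ 2) := by gcongr
        _ ≤ _ := by nlinarith [dist_nonneg (x := z) (y := y)]
  have := ODE_solution_unique_univ (t₀ := c) (v := F) (s := s) (K := K)
    (f := fun t => (v t, deriv v t)) (g := fun t => (w t, deriv w t)) hF
    (fun t => ⟨(hv.hasDerivAt t).prodMk (hv.hasDerivAt_deriv t), hvB t⟩)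
    (fun t => ⟨(hw.hasDerivAt t).prodMk (hw.hasDerivAt_deriv t), hwB t⟩) (by simp [h0, h1])
  ext x
  exact congrArg Prod.fst (congrFun this x)

lemma RegMin.eq_of_eqOn (hv : RegMin μ f a ε v) (hw : RegMin μ f a ε w) (h : Assumptions μ f ξ)
    {U : Set ℝ} (hU : IsOpen U) {c : ℝ} (hc : c ∈ U) (heq : EqOn v w U) : v = w := by
  refine hv.eq_of_eq hw h (heq hc) ?_
  exact (heq.eventuallyEq_of_mem (hU.mem_nhds hc)).deriv_eq

/-- A glued minimiser coincides with the original one. -/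
lemma RegMin.eq_of_glue (hv : RegMin μ f a ε v) (h : Assumptions μ f ξ) (hε : 0 < ε)
    (h2 : H1Pair w k) {c : ℝ} (hc : v c = w c)
    (hle : ∫ x in Ioi c, integrand μ f a ε w k x ≤
      ∫ x in Ioi c, integrand μ f a ε v (deriv v) x) {x : ℝ} (hx : c < x) : v x = w x := by
  have h3 := (hv.min.glue h h2 hc hle).regMin h hε
  have h4 : v = fun x => if x ≤ c then v x else w x :=
    hv.eq_of_eqOn h3 h (isOpen_Iio (a := c)) (mem_Iio.2 (sub_one_lt c)) fun y hy => by
      simp only [if_pos (mem_Iio.1 hy).le]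
  have h5 := congrFun h4 x
  simpa only [if_neg (not_le.2 hx)] using h5

end

section


variable {μ f : ℝ → ℝ} {ξ a ε : ℝ} {v g w k : ℝ → ℝ}

lemma hasDerivWithinAt_abs_right {v : ℝ → ℝ} {d x : ℝ} (hv : HasDerivAt v d x) (hx : v x = 0) :
    HasDerivWithinAt (fun y => |v y|) |d| (Ioi x) x := by
  rw [hasDerivWithinAt_iff_tendsto_slope' (by simp)]
  have h1 := (hasDerivWithinAt_iff_tendsto_slope' (by simp)).1 (hv.hasDerivWithinAt (s := Ioi x))
  refine h1.abs.congr' ?_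
  filter_upwards [self_mem_nhdsWithin] with y hy
  have : 0 < y - x := sub_pos.2 hy
  simp only [slope, hx, vsub_eq_sub, sub_zero, smul_eq_mul, abs_zero, abs_mul, abs_inv,
    abs_of_pos this]

/-- The absolute value of a minimiser is in `H¹(ℝ)`, with derivative of the same modulus. -/
lemma RegMin.exists_abs_pair (hr : RegMin μ f a ε v) :
    ∃ k, H1Pair (fun x => |v x|) k ∧ ∀ x, k x ^ 2 = deriv v x ^ 2 := by
  let k : ℝ → ℝ := fun x =>
    if 0 < v x then deriv v x else if v x < 0 then -deriv v x else |deriv v x|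
  have hk2 : ∀ x, |k x| = |deriv v x| := fun x => by
    simp only [k]; split_ifs <;> simp
  have hvc := hr.continuous
  have hkm : Measurable k := by
    refine Measurable.ite (measurableSet_lt measurable_const hvc.measurable)
      (measurable_deriv v) (Measurable.ite (measurableSet_lt hvc.measurable measurable_const)
      (measurable_deriv v).neg ?_)
    exact (measurable_deriv v).abs
  have hkL : MemLp k 2 volume :=
    hr.min.pair.memLp_deriv.of_le hkm.aestronglyMeasurable
      (Eventually.of_forall fun x => by simp only [Real.norm_eq_abs, hk2, le_refl])
  refine ⟨k, ⟨hr.min.pair.memLp.abs, hkL, fun x y => ?_⟩, fun x => by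
    rw [← sq_abs, hk2, sq_abs]⟩
  refine (intervalIntegral.integral_eq_sub_of_hasDeriv_right hvc.abs.continuousOn
    (fun t _ => ?_) (intervalIntegrable_of_locallyIntegrable
      (hkL.locallyIntegrable (by norm_num)) _ _)).symm
  have hd := hr.hasDerivAt t
  rcases lt_trichotomy (v t) 0 with h0 | h0 | h0
  · have : k t = -deriv v t := by simp only [k, if_neg h0.le.not_gt, if_pos h0]
    rw [this]
    refine (hd.neg.congr_of_eventuallyEq ?_).hasDerivWithinAt
    filter_upwards [hvc.continuousAt.eventually_lt continuousAt_const h0] with s hs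
    exact abs_of_neg hs
  · have : k t = |deriv v t| := by simp [k, h0]
    rw [this]
    exact hasDerivWithinAt_abs_right hd h0
  · have : k t = deriv v t := by simp only [k, if_pos h0]
    rw [this]
    refine (hd.congr_of_eventuallyEq ?_).hasDerivWithinAt
    filter_upwards [continuousAt_const.eventually_lt hvc.continuousAt h0] with s hs
    exact abs_of_pos hs

lemma RegMin.nonneg_of_zero (hr : RegMin μ f a ε v) (h : Assumptions μ f ξ) (ha : 0 < a)
    {α : ℝ} (hα : 0 ≤ α) (hv : v α = 0) {x : ℝ} (hx : α < x) : 0 ≤ v x := by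
  obtain ⟨k, hk, hk2⟩ := hr.exists_abs_pair
  have hle := hr.min.setIntegral_Ioi_le h hk (c := α) (by simp [hv])
  have hvc := hr.continuous
  have hfc := h.f_continuous
  have hiv := (hr.min.pair.linear_integrable h a)
  have hia := (hk.linear_integrable h a)
  have hdiff : Integrable (fun x => a * f x * (|v x| - v x)) volume := by
    simp only [mul_sub]
    exact hia.sub hiv
  have heq : ∀ x, integrand μ f a ε (fun x => |v x|) k x =
      integrand μ f a ε v (deriv v) x - a * f x * (|v x| - v x) := fun x => by
    simp only [integrand, density, well, hk2, sq_abs, Even.pow_abs (by decide : Even 4)]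
    ring
  simp only [heq] at hle
  rw [integral_sub (hr.min.pair.integrand_integrable h a ε).integrableOn
    hdiff.integrableOn] at hle
  have hnn : ∀ y ∈ Ioi α, 0 ≤ a * f y * (|v y| - v y) := fun y hy =>
    mul_nonneg (mul_nonneg ha.le (h.f_pos y (hα.trans_lt hy)).le) (sub_nonneg.2 (le_abs_self _))
  have hz : ∫ y in Ioi α, a * f y * (|v y| - v y) = 0 :=
    le_antisymm (by linarith) (setIntegral_nonneg measurableSet_Ioi hnn)
  have hae := (setIntegral_eq_zero_iff_of_nonneg_ae
    ((ae_restrict_iff' measurableSet_Ioi).2 (Eventually.of_forall hnn))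
    hdiff.integrableOn).1 hz
  have hcont : Continuous fun y => a * f y * (|v y| - v y) := by fun_prop
  have hall := Measure.eqOn_open_of_ae_eq hae isOpen_Ioi hcont.continuousOn
    continuous_zero.continuousOn
  have := hall hx
  simp only [Pi.zero_apply, mul_eq_zero, ha.ne', (h.f_pos x (hα.trans_lt hx)).ne', false_or,
    sub_eq_zero] at this
  exact abs_eq_self.1 this

/-- A critical point with negative second derivative is strictly above its right neighbours. -/
lemma exists_lt_of_second_deriv_neg {v g : ℝ → ℝ} {c x : ℝ} (hv : ∀ y, HasDerivAt v (g y) y)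
    (hg : HasDerivAt g c x) (hx : g x = 0) (hc : c < 0) :
    ∃ δ > 0, ∀ y, x < y → y < x + δ → v y < v x := by
  have h1 := (hasDerivWithinAt_iff_tendsto_slope' (by simp)).1 (hg.hasDerivWithinAt (s := Ioi x))
  have h2 : ∀ᶠ y in 𝓝[>] x, g y < 0 := by
    filter_upwards [h1.eventually (eventually_lt_nhds hc), self_mem_nhdsWithin] with y hy hy'
    have h3 : 0 < y - x := sub_pos.2 hy'
    rw [slope_def_field, hx, sub_zero, div_lt_iff₀ h3, zero_mul] at hy
    exact hy
  obtain ⟨u, hu, hsub⟩ := mem_nhdsGT_iff_exists_Ioo_subset.1 h2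
  refine ⟨u - x, sub_pos.2 hu, fun y hy hy' => ?_⟩
  have hanti : StrictAntiOn v (Icc x y) := by
    refine strictAntiOn_of_deriv_neg (convex_Icc x y)
      (fun z _ => (hv z).continuousAt.continuousWithinAt) fun z hz => ?_
    rw [interior_Icc] at hz
    rw [(hv z).deriv]
    exact hsub ⟨hz.1, by linarith [hz.2]⟩
  exact hanti (left_mem_Icc.2 hy.le) (right_mem_Icc.2 hy.le) hy

lemma force_zero (hε : 0 < ε) (x : ℝ) : force μ f a ε x 0 = -(a * f x) / ε := by
  unfold force; field_simp; ring

/-- A minimiser cannot touch zero from above at a point of the positive half-line. -/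
lemma RegMin.not_isLocalMin_zero (hr : RegMin μ f a ε v) (h : Assumptions μ f ξ) (ha : 0 < a)
    (hε : 0 < ε) {x : ℝ} (hx : 0 < x) (hv : v x = 0) : ¬ IsLocalMin v x := by
  intro hmin
  have hd : deriv v x = 0 := hmin.hasDerivAt_eq_zero (hr.hasDerivAt x)
  have hc : force μ f a ε x (v x) < 0 := by
    rw [hv, force_zero hε]
    exact div_neg_of_neg_of_pos (neg_neg_of_pos (mul_pos ha (h.f_pos x hx))) hε
  obtain ⟨δ, hδ, hlt⟩ := exists_lt_of_second_deriv_neg hr.hasDerivAt (hr.hasDerivAt_deriv x) hd hc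
  have h1 : ∀ᶠ y in 𝓝[>] x, v x ≤ v y := hmin.filter_mono nhdsWithin_le_nhds
  have h2 : ∀ᶠ y in 𝓝[>] x, y < x + δ :=
    nhdsWithin_le_nhds (eventually_lt_nhds (by linarith))
  obtain ⟨y, ⟨hy1, hy2⟩, hy3⟩ := ((h1.and h2).and self_mem_nhdsWithin).exists
  exact absurd (hlt y hy3 hy2) (not_lt.2 hy1)

lemma RegMin.pos_of_zero (hr : RegMin μ f a ε v) (h : Assumptions μ f ξ) (ha : 0 < a)
    (hε : 0 < ε) {α : ℝ} (hα : 0 ≤ α) (hv : v α = 0) {x : ℝ} (hx : α < x) : 0 < v x := by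
  refine lt_of_le_of_ne (hr.nonneg_of_zero h ha hα hv hx) fun h0 => ?_
  refine hr.not_isLocalMin_zero h ha hε (hα.trans_lt hx) h0.symm ?_
  filter_upwards [lt_mem_nhds hx] with y hy
  rw [← h0]
  exact hr.nonneg_of_zero h ha hα hv hy

lemma RegMin.neg_of_zero (hr : RegMin μ f a ε v) (h : Assumptions μ f ξ) (ha : 0 < a)
    (hε : 0 < ε) {α : ℝ} (hα : α ≤ 0) (hv : v α = 0) {x : ℝ} (hx : x < α) : v x < 0 := by
  have := (hr.odd_symm h hε).pos_of_zero h ha hε (α := -α) (by linarith) (by simp [hv])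
    (x := -x) (by linarith)
  rw [neg_neg] at this
  linarith

lemma neg_on_of_no_zero {v : ℝ → ℝ} (hv : Continuous v) {s : Set ℝ} (hs : s.OrdConnected) {p : ℝ}
    (hp : p ∈ s) (hvp : v p < 0) (hz : ∀ x ∈ s, v x ≠ 0) : ∀ x ∈ s, v x < 0 := by
  intro x hx
  by_contra h
  have h1 : (0 : ℝ) ∈ v '' s :=
    (hs.isPreconnected.image v hv.continuousOn).ordConnected.out
      (mem_image_of_mem v hp) (mem_image_of_mem v hx) ⟨hvp.le, not_lt.1 h⟩
  obtain ⟨z, hzs, hz0⟩ := h1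
  exact hz z hzs hz0

lemma RegMin.sign_of_zero_of_nonneg (hr : RegMin μ f a ε v) (h : Assumptions μ f ξ) (ha : 0 < a)
    (hε : 0 < ε) {z : ℝ} (hz : 0 ≤ z) (hv : v z = 0) :
    (∀ x, z < x → 0 < v x) ∧ ∀ x, x < z → v x < 0 := by
  refine ⟨fun x hx => hr.pos_of_zero h ha hε hz hv hx, ?_⟩
  rcases hz.eq_or_lt with rfl | hz0
  · exact fun x hx => hr.neg_of_zero h ha hε le_rfl hv hx
  have hnz : ∀ x ∈ Ico 0 z, v x ≠ 0 := fun x hx h0 =>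
    (hr.pos_of_zero h ha hε hx.1 h0 hx.2).ne' hv
  have hneg0 : v 0 < 0 := by
    by_contra hcon
    have hpos : 0 < v 0 := lt_of_le_of_ne (not_lt.1 hcon) (hnz 0 ⟨le_rfl, hz0⟩).symm
    have hall : ∀ x ∈ Ico 0 z, -v x < 0 :=
      neg_on_of_no_zero hr.continuous.neg ordConnected_Ico (left_mem_Ico.2 hz0) (by simpa using hpos)
        fun x hx => neg_ne_zero.2 (hnz x hx)
    refine hr.not_isLocalMin_zero h ha hε hz0 hv ?_
    filter_upwards [lt_mem_nhds hz0] with y hy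
    rw [hv]
    rcases lt_trichotomy y z with h1 | h1 | h1
    · linarith [hall y ⟨hy.le, h1⟩]
    · rw [h1, hv]
    · exact (hr.pos_of_zero h ha hε hz hv h1).le
  have hnz' : ∀ x ∈ Iio z, v x ≠ 0 := by
    intro x hx h0
    rcases le_or_gt 0 x with hx0 | hx0
    · exact hnz x ⟨hx0, hx⟩ h0
    have hnzx : ∀ y ∈ Ioc x 0, v y ≠ 0 := fun y hy h1 =>
      (hr.neg_of_zero h ha hε hy.2 h1 hy.1).ne h0
    have hall := neg_on_of_no_zero hr.continuous ordConnected_Ioc (right_mem_Ioc.2 hx0) hneg0 hnzx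
    refine (hr.odd_symm h hε).not_isLocalMin_zero h ha hε (x := -x) (by linarith)
      (by simp [h0]) ?_
    filter_upwards [lt_mem_nhds (show 0 < -x by linarith)] with y hy
    simp only [neg_neg, h0, neg_zero]
    rcases lt_trichotomy (-y) x with h1 | h1 | h1
    · linarith [hr.neg_of_zero h ha hε hx0.le h0 h1]
    · simp [h1, h0]
    · linarith [hall (-y) ⟨h1, by linarith⟩]
  exact neg_on_of_no_zero hr.continuous ordConnected_Iio (mem_Iio.2 hz0) hneg0 hnz'

/-- A zero of a minimiser separates its positive from its negative values. -/
lemma RegMin.sign_of_zero (hr : RegMin μ f a ε v) (h : Assumptions μ f ξ) (ha : 0 < a)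
    (hε : 0 < ε) {z : ℝ} (hv : v z = 0) :
    (∀ x, z < x → 0 < v x) ∧ ∀ x, x < z → v x < 0 := by
  rcases le_total 0 z with hz | hz
  · exact hr.sign_of_zero_of_nonneg h ha hε hz hv
  · obtain ⟨h1, h2⟩ := (hr.odd_symm h hε).sign_of_zero_of_nonneg h ha hε (z := -z) (by linarith)
      (by simp [hv])
    refine ⟨fun x hx => ?_, fun x hx => ?_⟩
    · have := h2 (-x) (by linarith)
      rw [neg_neg] at this; linarith
    · have := h1 (-x) (by linarith)
      rw [neg_neg] at this; linarith

lemma RegMin.eq_of_zero (hr : RegMin μ f a ε v) (h : Assumptions μ f ξ) (ha : 0 < a)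
    (hε : 0 < ε) {z y : ℝ} (hz : v z = 0) (hy : v y = 0) : y = z := by
  obtain ⟨h1, h2⟩ := hr.sign_of_zero h ha hε hz
  rcases lt_trichotomy y z with h3 | h3 | h3
  · exact absurd hy (h2 y h3).ne
  · exact h3
  · exact absurd hy (h1 y h3).ne'

lemma RegMin.tendsto_zero (hr : RegMin μ f a ε v) : Tendsto v (cocompact ℝ) (𝓝 0) := by
  have hp := hr.min.pair
  have hd : ∀ x, HasDerivAt (fun x => v x ^ 2) (2 * (v x * deriv v x)) x := fun x =>
    ((hr.hasDerivAt x).pow 2).congr_deriv (by ring)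
  have hi : Integrable (fun x => 2 * (v x * deriv v x)) volume :=
    (hp.memLp.integrable_mul hp.memLp_deriv).const_mul 2
  have hsq : Tendsto (fun x => v x ^ 2) (cocompact ℝ) (𝓝 0) := by
    rw [cocompact_eq_atBot_atTop, tendsto_sup]
    exact ⟨tendsto_zero_of_hasDerivAt_of_integrableOn_Iic (a := 0) (fun x _ => hd x)
        hi.integrableOn hp.sq_integrable.integrableOn,
      tendsto_zero_of_hasDerivAt_of_integrableOn_Ioi (a := 0) (fun x _ => hd x)
        hi.integrableOn hp.sq_integrable.integrableOn⟩
  have := (Real.continuous_sqrt.tendsto 0).comp hsq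
  simp only [Function.comp_def, Real.sqrt_sq_eq_abs, Real.sqrt_zero] at this
  exact (tendsto_zero_iff_abs_tendsto_zero v).2 this

lemma RegMin.le_bound (hr : RegMin μ f a ε v) (h : Assumptions μ f ξ) (ha : 0 ≤ a) (hε : 0 < ε)
    (hε1 : ε ≤ 1) {F : ℝ} (hF : ∀ x, |f x| ≤ F) (x : ℝ) : v x ≤ 1 + μ 0 + a * F := by
  by_contra hcon
  rw [not_le] at hcon
  have hF0 : 0 ≤ F := (abs_nonneg _).trans (hF 0)
  have hμ0 := h.mu_zero_pos
  have haF : 0 ≤ a * F := mul_nonneg ha hF0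
  have hx0 : 0 < v x := by linarith
  obtain ⟨z, hz⟩ := hr.continuous.exists_forall_ge' x
    (hr.tendsto_zero.eventually (eventually_le_nhds hx0))
  have hzv : 1 + μ 0 + a * F < v z := hcon.trans_le (hz x)
  have hmax : IsLocalMax v z := Eventually.of_forall hz
  have hd : deriv v z = 0 := hmax.hasDerivAt_eq_zero (hr.hasDerivAt z)
  have hpos : 0 < force μ f a ε z (v z) := by
    unfold force
    refine div_pos ?_ (by positivity)
    have h1 : μ z * v z ≤ μ 0 * v z := mul_le_mul_of_nonneg_right (h.mu_le z) (by linarith)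
    have h2 : ε * a * f z ≤ a * F := by
      have : a * f z ≤ a * F := mul_le_mul_of_nonneg_left ((le_abs_self _).trans (hF z)) ha
      have h3 : ε * (a * f z) ≤ ε * (a * F) := mul_le_mul_of_nonneg_left this hε.le
      nlinarith
    have h3 : v z * v z ≥ v z := by nlinarith
    nlinarith
  obtain ⟨δ, hδ, hlt⟩ := exists_lt_of_second_deriv_neg (v := fun x => -v x)
    (g := fun x => -deriv v x) (fun y => (hr.hasDerivAt y).neg) ((hr.hasDerivAt_deriv z).neg)
    (by simp [hd]) (by linarith : -force μ f a ε z (v z) < 0)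
  have := hlt (z + δ / 2) (by linarith) (by linarith)
  linarith [hz (z + δ / 2)]

/-- Bounds for minimisers, uniform in `ε ∈ (0, 1]`. -/
lemma exists_uniform_bounds (h : Assumptions μ f ξ) {a : ℝ} (ha : 0 ≤ a) :
    ∃ M L : ℝ, 0 < M ∧ 0 < L ∧ ∀ ε v, 0 < ε → ε ≤ 1 → RegMin μ f a ε v →
      (∀ x, |v x| ≤ M) ∧ (∀ x, |ε * deriv v x| ≤ L) ∧
      ∀ x, |ε ^ 2 * force μ f a ε x (v x)| ≤ L := by
  obtain ⟨F, hF0, hF⟩ := h.exists_f_bound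
  obtain ⟨B, hB0, hB⟩ := h.exists_mu_bound
  have hμ0 := h.mu_zero_pos
  set M := 1 + μ 0 + a * F
  have haF : 0 ≤ a * F := mul_nonneg ha hF0.le
  have hM : 0 < M := by positivity
  set K := M ^ 3 + B * M + a * F
  have hK : 0 ≤ K := by positivity
  refine ⟨M, 2 * M + K, hM, by positivity, fun ε v hε hε1 hr => ?_⟩
  have hv : ∀ x, |v x| ≤ M := fun x => by
    have h1 := hr.le_bound h ha hε hε1 hF x
    have h2 := (hr.odd_symm h hε).le_bound h ha hε hε1 hF (-x)
    rw [neg_neg] at h2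
    exact abs_le.2 ⟨by linarith, h1⟩
  have hforce : ∀ x, |ε ^ 2 * force μ f a ε x (v x)| ≤ K := fun x => by
    have : ε ^ 2 * force μ f a ε x (v x) = v x ^ 3 - μ x * v x - ε * a * f x := by
      unfold force; field_simp
    rw [this]
    have h1 : |v x ^ 3| ≤ M ^ 3 := by
      rw [abs_pow]; exact pow_le_pow_left₀ (abs_nonneg _) (hv x) 3
    have h2 : |μ x * v x| ≤ B * M := by
      rw [abs_mul]; exact mul_le_mul (hB x) (hv x) (abs_nonneg _) hB0.le
    have h3 : |ε * a * f x| ≤ a * F := by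
      rw [abs_mul, abs_of_nonneg (by positivity)]
      have : ε * a ≤ a := by nlinarith
      exact mul_le_mul this (hF x) (abs_nonneg _) ha
    have h4 := abs_sub (v x ^ 3 - μ x * v x) (ε * a * f x)
    have h5 := abs_sub (v x ^ 3) (μ x * v x)
    linarith
  refine ⟨hv, fun x => ?_, fun x => (hforce x).trans (by linarith)⟩
  obtain ⟨c, hc, hc'⟩ := exists_hasDerivAt_eq_slope v (deriv v) (by linarith : x < x + ε)
    hr.continuous.continuousOn fun y _ => hr.hasDerivAt y
  obtain ⟨d, hd, hd'⟩ := exists_hasDerivAt_eq_slope (deriv v) (fun y => force μ f a ε y (v y))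
    hc.1 hr.continuous_deriv.continuousOn fun y _ => hr.hasDerivAt_deriv y
  have hcx : 0 < c - x := by linarith [hc.1]
  rw [add_sub_cancel_left, eq_div_iff hε.ne'] at hc'
  rw [eq_div_iff hcx.ne'] at hd'
  have e1 : |ε * deriv v c| ≤ 2 * M := by
    rw [mul_comm, hc']
    have := abs_sub (v (x + ε)) (v x)
    linarith [hv x, hv (x + ε)]
  have e2 : |ε * deriv v c - ε * deriv v x| ≤ K := by
    have : ε * deriv v c - ε * deriv v x =
        (ε ^ 2 * force μ f a ε d (v d)) * ((c - x) / ε) := by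
      rw [← mul_sub, ← hd']; field_simp
    rw [this, abs_mul, abs_of_nonneg (a := (c - x) / ε) (by positivity)]
    have h1 : (c - x) / ε ≤ 1 := by
      rw [div_le_one hε]; linarith [hc.2]
    calc _ ≤ K * 1 := mul_le_mul (hforce d) h1 (by positivity) hK
      _ = K := mul_one K
  have := abs_sub_abs_le_abs_sub (ε * deriv v x) (ε * deriv v c)
  rw [abs_sub_comm] at this
  linarith

lemma midpoint_lower_bound {v g q : ℝ → ℝ} {x L κ M : ℝ} (hL : 0 < L)
    (hv : ∀ y, HasDerivAt v (g y) y) (hg : ∀ y, HasDerivAt g (q y) y)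
    (hq : ∀ y ∈ Ioo x (x + L), q y ≤ -κ) (h1 : -M ≤ v x) (h2 : -M ≤ v (x + L)) :
    -M + κ * L ^ 2 / 8 ≤ v (x + L / 2) := by
  have hconc : ConcaveOn ℝ (Icc x (x + L)) fun y => v y + κ / 2 * (y - x) ^ 2 := by
    have hd1 : ∀ y, HasDerivAt (fun y => v y + κ / 2 * (y - x) ^ 2) (g y + κ * (y - x)) y :=
      fun y => ((hv y).add ((((hasDerivAt_id y).sub_const x).pow 2).const_mul
        (κ / 2))).congr_deriv (by simp; ring)
    have hd2 : ∀ y, HasDerivAt (fun y => g y + κ * (y - x)) (q y + κ) y :=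
      fun y => ((hg y).add (((hasDerivAt_id y).sub_const x).const_mul κ)).congr_deriv (by simp)
    refine concaveOn_of_hasDerivWithinAt2_nonpos (convex_Icc _ _)
      (fun y _ => (hd1 y).continuousAt.continuousWithinAt)
      (fun y _ => (hd1 y).hasDerivWithinAt) (fun y _ => (hd2 y).hasDerivWithinAt) fun y hy => ?_
    rw [interior_Icc] at hy
    linarith [hq y hy]
  have := hconc.2 (left_mem_Icc.2 (by linarith : x ≤ x + L)) (right_mem_Icc.2 (by linarith))
    (by norm_num : (0 : ℝ) ≤ 1 / 2) (by norm_num : (0 : ℝ) ≤ 1 / 2) (by norm_num)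
  simp only [smul_eq_mul] at this
  have e : 1 / 2 * x + 1 / 2 * (x + L) = x + L / 2 := by ring
  rw [e] at this
  nlinarith

lemma RegMin.exists_nonneg_of_bound (hr : RegMin μ f a ε v) (h : Assumptions μ f ξ) (ha : 0 < a)
    (hε : 0 < ε) {M c L : ℝ} (hM : ∀ x, |v x| ≤ M)
    (hf : ∀ x ∈ Icc ξ (ξ + 1), c ≤ f x) (hL : 0 < L) (hL1 : L ≤ 1)
    (hLε : 8 * M * ε ≤ a * c * L ^ 2) : ∃ x ∈ Icc ξ (ξ + L), 0 ≤ v x := by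
  by_contra! hcon
  have hξ := h.xi_pos
  have := midpoint_lower_bound (x := ξ) (κ := a * c / ε) (M := M) hL hr.hasDerivAt
    hr.hasDerivAt_deriv (fun y hy => ?_) (neg_le_of_abs_le (hM _)) (neg_le_of_abs_le (hM _))
  · have h1 := hcon (ξ + L / 2) ⟨by linarith, by linarith⟩
    have h2 : M ≤ a * c / ε * L ^ 2 / 8 := by
      rw [div_mul_eq_mul_div, div_div, le_div_iff₀ (by positivity)]
      linarith
    linarith
  · have hvy := hcon y ⟨hy.1.le, hy.2.le⟩
    have hμ : μ y ≤ 0 := h.mu_nonpos (by rw [abs_of_pos (by linarith [hy.1])]; exact hy.1.le)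
    have hfy := hf y ⟨hy.1.le, by linarith [hy.2]⟩
    unfold force
    rw [div_le_iff₀ (by positivity)]
    have e : -(a * c / ε) * ε ^ 2 = -(ε * (a * c)) := by field_simp
    rw [e]
    have h1 : v y ^ 3 ≤ 0 := by
      have : v y ^ 3 = v y * v y ^ 2 := by ring
      rw [this]; exact mul_nonpos_of_nonpos_of_nonneg hvy.le (sq_nonneg _)
    have h2 : 0 ≤ μ y * v y := mul_nonneg_of_nonpos_of_nonpos hμ hvy.le
    have h3 : ε * (a * c) ≤ ε * (a * f y) :=
      mul_le_mul_of_nonneg_left (mul_le_mul_of_nonneg_left hfy ha.le) hε.le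
    linarith

theorem exists_zero_near (h : Assumptions μ f ξ) {a : ℝ} (ha : 0 < a) :
    ∃ C ε₀ : ℝ, 0 < ε₀ ∧ ε₀ ≤ 1 ∧ 0 < C ∧ C * √ε₀ ≤ 1 ∧ ∀ ε : ℝ, 0 < ε → ε < ε₀ →
      ∀ v, RegMin μ f a ε v → ∃ z, v z = 0 ∧ |z| ≤ ξ + C * √ε := by
  obtain ⟨M, _, hM0, _, hbd⟩ := exists_uniform_bounds h ha.le
  have hξ := h.xi_pos
  obtain ⟨p, hp, hpmin⟩ := isCompact_Icc.exists_isMinOn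
    (nonempty_Icc.2 (by linarith : ξ ≤ ξ + 1)) h.f_continuous.continuousOn
  set c := f p
  have hc : 0 < c := h.f_pos p (by linarith [hp.1])
  have hcf : ∀ x ∈ Icc ξ (ξ + 1), c ≤ f x := fun x hx => hpmin hx
  set C := √(8 * M / (a * c))
  have hC : 0 < C := Real.sqrt_pos.2 (by positivity)
  have hC2 : C ^ 2 = 8 * M / (a * c) := Real.sq_sqrt (by positivity)
  refine ⟨C, min 1 (1 / C ^ 2), by positivity, min_le_left _ _, hC, ?_, fun ε hε hε0 v hr => ?_⟩
  · have h1 : √(min 1 (1 / C ^ 2)) ≤ 1 / C :=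
      (Real.sqrt_le_sqrt (min_le_right _ _)).trans (by
        rw [Real.sqrt_div zero_le_one, Real.sqrt_one, Real.sqrt_sq hC.le])
    calc C * √(min 1 (1 / C ^ 2)) ≤ C * (1 / C) := mul_le_mul_of_nonneg_left h1 hC.le
      _ = 1 := by field_simp
  have hε1 : ε ≤ 1 := hε0.le.trans (min_le_left _ _)
  have hs : 0 < √ε := Real.sqrt_pos.2 hε
  have hL : 0 < C * √ε := by positivity
  have hL1 : C * √ε ≤ 1 := by
    rw [← Real.sqrt_sq hC.le, ← Real.sqrt_mul (sq_nonneg C), Real.sqrt_le_one]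
    have : ε ≤ 1 / C ^ 2 := hε0.le.trans (min_le_right _ _)
    rw [le_div_iff₀ (by positivity)] at this
    linarith
  have hLε : 8 * M * ε ≤ a * c * (C * √ε) ^ 2 := by
    rw [mul_pow, Real.sq_sqrt hε.le, hC2]
    field_simp
    exact le_rfl
  obtain ⟨x, hx, hvx⟩ := hr.exists_nonneg_of_bound h ha hε (hbd ε v hε hε1 hr).1 hcf hL hL1 hLε
  have hr' := hr.odd_symm h hε
  obtain ⟨y, hy, hvy⟩ :=
    hr'.exists_nonneg_of_bound h ha hε (hbd ε _ hε hε1 hr').1 hcf hL hL1 hLε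
  obtain ⟨z, hz, hz0⟩ := intermediate_value_Icc (by linarith [hx.1, hy.1] : -y ≤ x)
    hr.continuous.continuousOn ⟨by linarith, hvx⟩
  exact ⟨z, hz0, abs_le.2 ⟨by linarith [hz.1, hy.2], by linarith [hz.2, hx.2]⟩⟩

/-- An unforced minimiser with a zero vanishes identically. -/
lemma RegMin.eq_zero_of_zero (hr : RegMin μ f 0 ε v) (h : Assumptions μ f ξ) (hε : 0 < ε) {z : ℝ}
    (hz : v z = 0) : ∀ x, v x = 0 := by
  have hn : RegMin μ f 0 ε (fun x => -v x) := hr.min.neg.regMin h hε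
  have h1 : ∀ x, z < x → v x = -v x := fun x hx =>
    hr.eq_of_glue h hε hr.min.pair.neg (c := z) (by simp [hz]) (le_of_eq (by
      congr 1; ext y; simp only [integrand, density, well]; ring)) hx
  have h2 : v = fun x => -v x :=
    hr.eq_of_eqOn hn h (isOpen_Ioi (a := z)) (mem_Ioi.2 (lt_add_one z)) fun x hx => h1 x hx
  intro x
  have := congrFun h2 x
  linarith

/-- Unforced minimisers are even. -/
lemma RegMin.even (hr : RegMin μ f 0 ε v) (h : Assumptions μ f ξ) (hε : 0 < ε) (x : ℝ) :
    v (-x) = v x := by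
  have hs : IsMinPair μ f 0 ε (fun x => v (-x)) (fun x => -deriv v (-x)) := by
    simpa using (hr.min.odd_symm h).neg
  have hle := hs.setIntegral_Ioi_le h hr.min.pair (c := 0) (by simp)
  have key : ∀ y, 0 < y → v y = v (-y) := fun y hy =>
    hr.eq_of_glue h hε hs.pair (c := 0) (by simp) hle hy
  rcases lt_trichotomy x 0 with hx | rfl | hx
  · have := key (-x) (by linarith)
    rwa [neg_neg] at this
  · simp
  · exact (key x hx).symm

end

section


variable {μ f : ℝ → ℝ} {ξ : ℝ}

lemma hasDerivAt_tanh (x : ℝ) : HasDerivAt Real.tanh (1 - Real.tanh x ^ 2) x := by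
  have hc := (Real.cosh_pos x).ne'
  have h := (Real.hasDerivAt_sinh x).div (Real.hasDerivAt_cosh x) hc
  have e : Real.tanh = fun x => Real.sinh x / Real.cosh x :=
    funext fun y => Real.tanh_eq_sinh_div_cosh y
  rw [e]
  exact h.congr_deriv (by field_simp)

lemma tanh_nonneg {x : ℝ} (hx : 0 ≤ x) : 0 ≤ Real.tanh x := by
  rw [Real.tanh_eq_sinh_div_cosh]
  exact div_nonneg (Real.sinh_nonneg_iff.2 hx) (Real.cosh_pos x).le

lemma tanh_nonpos {x : ℝ} (hx : x ≤ 0) : Real.tanh x ≤ 0 := by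
  have := tanh_nonneg (x := -x) (by linarith)
  rw [Real.tanh_neg] at this
  linarith

lemma tanh_sq_le_one (x : ℝ) : Real.tanh x ^ 2 ≤ 1 :=
  (sq_le_one_iff_abs_le_one _).2 (Real.abs_tanh_lt_one x).le

/-- A regularisation of the Thomas–Fermi profile `√μ₊`. -/
def regProfile (μ : ℝ → ℝ) (δ x : ℝ) : ℝ := posPart μ x / √(posPart μ x + δ ^ 2)

/-- The derivative of `regProfile` away from `±ξ`. -/
def regProfileDeriv (μ : ℝ → ℝ) (ξ δ x : ℝ) : ℝ :=
  if |x| < ξ then (posPart μ x + 2 * δ ^ 2) / (2 * √(posPart μ x + δ ^ 2) ^ 3) * deriv μ x else 0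

section Profile

variable {δ : ℝ}

lemma regProfile_nonneg (μ : ℝ → ℝ) (δ x : ℝ) : 0 ≤ regProfile μ δ x :=
  div_nonneg (posPart_nonneg μ x) (Real.sqrt_nonneg _)

lemma regProfile_sq (hδ : 0 < δ) (x : ℝ) :
    regProfile μ δ x ^ 2 = posPart μ x ^ 2 / (posPart μ x + δ ^ 2) := by
  have := posPart_nonneg μ x
  rw [regProfile, div_pow, Real.sq_sqrt (by positivity)]

lemma regProfile_sq_le (hδ : 0 < δ) (x : ℝ) : regProfile μ δ x ^ 2 ≤ posPart μ x := by
  have := posPart_nonneg μ x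
  rw [regProfile_sq hδ, div_le_iff₀ (by positivity)]
  nlinarith [sq_nonneg δ]

lemma posPart_sub_regProfile_sq_le (hδ : 0 < δ) (x : ℝ) :
    posPart μ x - regProfile μ δ x ^ 2 ≤ δ ^ 2 := by
  have := posPart_nonneg μ x
  rw [regProfile_sq hδ, sub_le_iff_le_add, ← sub_le_iff_le_add', le_div_iff₀ (by positivity)]
  nlinarith [sq_nonneg (δ ^ 2)]

lemma regProfile_continuous (h : Assumptions μ f ξ) (hδ : 0 < δ) :
    Continuous (regProfile μ δ) := by
  refine h.posPart_continuous.div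
    (Real.continuous_sqrt.comp (h.posPart_continuous.add continuous_const)) fun x => ?_
  have := posPart_nonneg μ x
  exact (Real.sqrt_pos.2 (by positivity)).ne'

lemma regProfile_eq_zero (h : Assumptions μ f ξ) {x : ℝ} (hx : ξ ≤ |x|) :
    regProfile μ δ x = 0 := by
  rw [regProfile, h.posPart_of_le hx, zero_div]

lemma hasDerivAt_regProfile (h : Assumptions μ f ξ) (hδ : 0 < δ) {x : ℝ}
    (hx : x ∉ ({-ξ, ξ} : Set ℝ)) :
    HasDerivAt (regProfile μ δ) (regProfileDeriv μ ξ δ x) x := by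
  have hξ := h.xi_pos
  rcases lt_or_ge |x| ξ with hlt | hge
  · have hp : 0 < μ x := h.mu_pos hlt
    have hμ : HasDerivAt μ (deriv μ x) x :=
      ((h.mu_contDiff.differentiable (by norm_num)) x).hasDerivAt
    have hs : 0 < √(μ x + δ ^ 2) := Real.sqrt_pos.2 (by positivity)
    have hsq : √(μ x + δ ^ 2) ^ 2 = μ x + δ ^ 2 := Real.sq_sqrt (by positivity)
    have h1 := hμ.div ((hμ.add_const (δ ^ 2)).sqrt (by positivity)) hs.ne'
    have h2 : HasDerivAt (fun y => μ y / √(μ y + δ ^ 2)) (regProfileDeriv μ ξ δ x) x := by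
      refine h1.congr_deriv ?_
      rw [regProfileDeriv, if_pos hlt, h.posPart_of_lt hlt]
      set s := √(μ x + δ ^ 2)
      have hm : μ x = s ^ 2 - δ ^ 2 := by linarith
      rw [hm]
      field_simp
      ring
    refine h2.congr_of_eventuallyEq ?_
    filter_upwards [(continuous_abs.tendsto x).eventually (eventually_lt_nhds hlt)] with y hy
    rw [regProfile, h.posPart_of_lt hy]
  · have hgt : ξ < |x| := lt_of_le_of_ne hge fun he => by
      rcases abs_choice x with h1 | h1 <;> rw [h1] at he <;> apply hx
      · exact Or.inr he.symm
      · exact Or.inl (by linarith)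
    rw [regProfileDeriv, if_neg (not_lt.2 hge)]
    refine (hasDerivAt_const x (0 : ℝ)).congr_of_eventuallyEq ?_
    filter_upwards [(continuous_abs.tendsto x).eventually (eventually_gt_nhds hgt)] with y hy
    exact regProfile_eq_zero h (le_of_lt hy)

lemma regProfileDeriv_measurable (h : Assumptions μ f ξ) (δ : ℝ) :
    Measurable (regProfileDeriv μ ξ δ) := by
  have h1 : Measurable (posPart μ) := h.posPart_continuous.measurable
  have h2 : Measurable (deriv μ) := measurable_deriv μ
  refine Measurable.ite (measurableSet_lt continuous_abs.measurable measurable_const) ?_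
    measurable_const
  exact (((h1.add_const _).div ((((h1.add_const _).sqrt).pow_const 3).const_mul 2))).mul h2

lemma abs_regProfileDeriv_le (hδ : 0 < δ) {K : ℝ}
    (hK : ∀ x, |x| ≤ ξ → |deriv μ x| ≤ K) (hK0 : 0 ≤ K) (x : ℝ) :
    |regProfileDeriv μ ξ δ x| ≤ K / δ := by
  rw [regProfileDeriv]
  split_ifs with hx
  · have hp := posPart_nonneg μ x
    set p := posPart μ x
    set s := √(p + δ ^ 2)
    have hs : 0 < s := Real.sqrt_pos.2 (by positivity)
    have hsq : s ^ 2 = p + δ ^ 2 := Real.sq_sqrt (by positivity)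
    have hδs : δ ≤ s := by
      rw [← Real.sqrt_sq hδ.le]; exact Real.sqrt_le_sqrt (by linarith)
    rw [abs_mul, abs_of_nonneg (by positivity)]
    have h1 : (p + 2 * δ ^ 2) / (2 * s ^ 3) ≤ 1 / δ := by
      rw [div_le_div_iff₀ (by positivity) hδ]
      have : p + 2 * δ ^ 2 ≤ 2 * s ^ 2 := by linarith
      calc (p + 2 * δ ^ 2) * δ ≤ (2 * s ^ 2) * s := by gcongr
        _ = 1 * (2 * s ^ 3) := by ring
    calc _ ≤ 1 / δ * K := mul_le_mul h1 (hK x hx.le) (abs_nonneg _) (by positivity)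
      _ = K / δ := by ring
  · simp only [abs_zero]; positivity

lemma Assumptions.exists_deriv_bound (h : Assumptions μ f ξ) (R : ℝ) :
    ∃ K : ℝ, 0 < K ∧ ∀ x, |x| ≤ R → |deriv μ x| ≤ K := by
  obtain ⟨K, hK⟩ := (isCompact_Icc (a := -R) (b := R)).exists_bound_of_continuousOn
    (h.mu_contDiff.continuous_deriv le_rfl).continuousOn
  exact ⟨|K| + 1, by positivity, fun x hx =>
    (hK x (abs_le.1 hx)).trans ((le_abs_self K).trans (by linarith))⟩

/-- The regularised profile times a bounded `C¹` factor is in `H¹(ℝ)`. -/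
lemma h1Pair_regProfile_mul (h : Assumptions μ f ξ) (hδ : 0 < δ) {T T' : ℝ → ℝ}
    (hT : ∀ x, HasDerivAt T (T' x) x) (hT' : Continuous T') :
    H1Pair (fun x => regProfile μ δ x * T x)
      (fun x => regProfileDeriv μ ξ δ x * T x + regProfile μ δ x * T' x) := by
  have hTc : Continuous T := continuous_iff_continuousAt.2 fun x => (hT x).continuousAt
  have hρ := regProfile_continuous h hδ
  obtain ⟨K, hK0, hK⟩ := h.exists_deriv_bound ξ
  have hout : ∀ x, x ∉ Icc (-ξ) ξ → ξ < |x| := fun x hx => by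
    by_contra h'
    exact hx (abs_le.1 (not_lt.1 h'))
  have hmem : MemLp (fun x => regProfileDeriv μ ξ δ x * T x + regProfile μ δ x * T' x) 2
      volume := by
    obtain ⟨B, hB⟩ := (isCompact_Icc (a := -ξ) (b := ξ)).exists_bound_of_continuousOn
      hTc.continuousOn
    obtain ⟨B', hB'⟩ := (isCompact_Icc (a := -ξ) (b := ξ)).exists_bound_of_continuousOn
      (hρ.mul hT').continuousOn
    refine (memLp_indicator_const 2 (measurableSet_Icc (a := -ξ) (b := ξ)) (K / δ * B + B')
      (Or.inr (by simp))).of_le (((regProfileDeriv_measurable h δ).mul hTc.measurable).add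
        (hρ.mul hT').measurable).aestronglyMeasurable (Eventually.of_forall fun x => ?_)
    by_cases hx : x ∈ Icc (-ξ) ξ
    · rw [indicator_of_mem hx]
      refine le_trans ?_ (le_abs_self _)
      refine (norm_add_le _ _).trans (add_le_add ?_ (hB' x hx))
      rw [norm_mul]
      exact mul_le_mul (abs_regProfileDeriv_le hδ hK hK0.le x) (hB x hx) (norm_nonneg _)
        (by positivity)
    · rw [indicator_of_notMem hx, regProfile_eq_zero h (hout x hx).le, regProfileDeriv,
        if_neg (not_lt.2 (hout x hx).le)]
      simp
  refine ⟨(hρ.mul hTc).memLp_of_hasCompactSupport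
    (HasCompactSupport.intro (isCompact_Icc (a := -ξ) (b := ξ)) fun x hx => ?_), hmem,
    fun x y => ?_⟩
  · simp [regProfile_eq_zero h (hout x hx).le]
  · refine (integral_eq_of_hasDerivAt_off_countable _ _ (s := {-ξ, ξ}) (by simp)
      (hρ.mul hTc).continuousOn (fun t ht => ?_) (intervalIntegrable_of_locallyIntegrable
        (hmem.locallyIntegrable (by norm_num)) _ _)).symm
    exact (hasDerivAt_regProfile h hδ ht.2).mul (hT t)

/-- The potential of the test function. -/
lemma well_regProfile_mul_le (h : Assumptions μ f ξ) (hδ : 0 < δ) {t : ℝ} (ht : t ^ 2 ≤ 1)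
    {x : ℝ} (hx : |x| < ξ) :
    well μ x (regProfile μ δ x * t) ≤ (μ 0 * (1 - t ^ 2) + δ ^ 2) ^ 2 / 4 := by
  have hp := h.posPart_of_lt hx
  have h1 := regProfile_sq_le (μ := μ) hδ x
  have h2 := posPart_sub_regProfile_sq_le (μ := μ) hδ x
  have h3 := h.posPart_le x
  have h0 := posPart_nonneg μ x
  set r := regProfile μ δ x
  set p := posPart μ x
  have e : well μ x (r * t) = (p * (1 - t ^ 2) + (p - r ^ 2) * t ^ 2) ^ 2 / 4 := by
    rw [well, ← hp]; ring
  rw [e]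
  have ht0 := sq_nonneg t
  have b1 : 0 ≤ p * (1 - t ^ 2) + (p - r ^ 2) * t ^ 2 :=
    add_nonneg (mul_nonneg h0 (by linarith)) (mul_nonneg (by linarith) ht0)
  have b2 : p * (1 - t ^ 2) + (p - r ^ 2) * t ^ 2 ≤ μ 0 * (1 - t ^ 2) + δ ^ 2 := by
    have c1 : p * (1 - t ^ 2) ≤ μ 0 * (1 - t ^ 2) :=
      mul_le_mul_of_nonneg_right h3 (by linarith)
    have c2 : (p - r ^ 2) * t ^ 2 ≤ δ ^ 2 * 1 :=
      mul_le_mul h2 ht ht0 (sq_nonneg δ)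
    linarith
  have := pow_le_pow_left₀ b1 b2 2
  linarith

lemma integral_density_regProfile (h : Assumptions μ f ξ) (δ ε : ℝ) (T T' : ℝ → ℝ) :
    ∫ x, density μ ε (fun x => regProfile μ δ x * T x)
      (fun x => regProfileDeriv μ ξ δ x * T x + regProfile μ δ x * T' x) x =
    ∫ x in (-ξ)..ξ, density μ ε (fun x => regProfile μ δ x * T x)
      (fun x => regProfileDeriv μ ξ δ x * T x + regProfile μ δ x * T' x) x := by
  refine integral_eq_intervalIntegral_of_eq_zero fun x hx => ?_
  have hx' : ξ ≤ |x| := by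
    by_contra h'
    exact hx (abs_lt.1 (not_le.1 h'))
  simp [density, well, regProfile_eq_zero h hx', regProfileDeriv, not_lt.2 hx', h.posPart_of_le hx']

lemma regProfile_even (h : Assumptions μ f ξ) (x : ℝ) :
    regProfile μ δ (-x) = regProfile μ δ x := by
  rw [regProfile, regProfile, h.posPart_even]

end Profile

lemma intervalIntegral_mono_Ioo {p q : ℝ → ℝ} {c d : ℝ} (hcd : c ≤ d)
    (hp : IntervalIntegrable p volume c d) (hq : IntervalIntegrable q volume c d)
    (hle : ∀ x ∈ Ioo c d, p x ≤ q x) : ∫ x in c..d, p x ≤ ∫ x in c..d, q x :=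
  intervalIntegral.integral_mono_on_of_le_Ioo hcd hp hq hle

/-- The energy of the regularised Thomas–Fermi profile. -/
lemma exists_profile_energy_le (h : Assumptions μ f ξ) :
    ∃ K : ℝ, ∀ ε δ : ℝ, 0 < ε → 0 < δ → ∃ u k, H1Pair u k ∧ (∫ x, f x * u x = 0) ∧
      ∫ x, density μ ε u k x ≤ K * (ε / δ ^ 2 + δ ^ 4 / ε) := by
  obtain ⟨K, hK0, hK⟩ := h.exists_deriv_bound ξ
  have hξ := h.xi_pos
  refine ⟨2 * ξ * (K ^ 2 + 1), fun ε δ hε hδ => ?_⟩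
  have hp := h1Pair_regProfile_mul h hδ (T := fun _ => 1) (T' := fun _ => 0)
    (fun x => hasDerivAt_const x 1) continuous_const
  refine ⟨_, _, hp, ?_, ?_⟩
  · have hodd : ∫ x, f x * (regProfile μ δ x * 1) = -∫ x, f x * (regProfile μ δ x * 1) := by
      conv_lhs => rw [← integral_neg_eq_self]
      rw [← integral_neg]
      congr 1; ext x
      rw [h.f_odd, regProfile_even h]; ring
    linarith
  · rw [integral_density_regProfile h]
    have hle : (∫ x in (-ξ)..ξ, density μ ε (fun x => regProfile μ δ x * 1)
        (fun x => regProfileDeriv μ ξ δ x * 1 + regProfile μ δ x * 0) x) ≤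
        ∫ _ in (-ξ)..ξ, (K ^ 2 + 1) * (ε / δ ^ 2 + δ ^ 4 / ε) := by
      refine intervalIntegral_mono_Ioo (by linarith)
        (hp.density_integrable h ε).intervalIntegrable intervalIntegrable_const fun x hx => ?_
      have hx' : |x| < ξ := abs_lt.2 hx
      have h1 := well_regProfile_mul_le h hδ (t := 1) (by norm_num) hx'
      have h2 := abs_regProfileDeriv_le hδ hK hK0.le x
      have h3 : regProfileDeriv μ ξ δ x ^ 2 ≤ (K / δ) ^ 2 := sq_le_sq' (by
        linarith [neg_abs_le (regProfileDeriv μ ξ δ x)]) ((le_abs_self _).trans h2)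
      simp only [density, mul_zero, add_zero]
      have h4 : well μ x (regProfile μ δ x * 1) / ε ≤ δ ^ 4 / ε := by
        refine div_le_div_of_nonneg_right (h1.trans ?_) hε.le
        nlinarith [sq_nonneg (δ ^ 2)]
      have h5 : ε / 2 * (regProfileDeriv μ ξ δ x * 1) ^ 2 ≤ K ^ 2 * (ε / δ ^ 2) := by
        calc ε / 2 * (regProfileDeriv μ ξ δ x * 1) ^ 2 ≤ ε * (K / δ) ^ 2 := by
              rw [mul_one]; gcongr; linarith
          _ = K ^ 2 * (ε / δ ^ 2) := by field_simp
      have h6 : 0 ≤ ε / δ ^ 2 := by positivity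
      have h7 : 0 ≤ K ^ 2 * (δ ^ 4 / ε) := by positivity
      linarith
    refine hle.trans (le_of_eq ?_)
    rw [intervalIntegral.integral_const, smul_eq_mul]
    ring

/-- The interfacial energy of a kink at a point where `μ = m`. -/
def kinkCost (m : ℝ) : ℝ := 2 * √2 / 3 * √m ^ 3

/-- The energy of the regularised Thomas–Fermi profile with a kink at the origin. -/
lemma exists_kink_energy_le (h : Assumptions μ f ξ) :
    ∃ K : ℝ, ∀ ε δ : ℝ, 0 < ε → 0 < δ → ∃ u k, H1Pair u k ∧ (∀ x, 0 < x → 0 ≤ u x) ∧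
      (∀ x, x ≤ 0 → u x ≤ 0) ∧
      ∫ x, density μ ε u k x ≤
        kinkCost (μ 0) + K * (ε / δ ^ 2 + δ ^ 4 / ε + ε / δ + δ ^ 2) := by
  obtain ⟨K, hK0, hK⟩ := h.exists_deriv_bound ξ
  have hξ := h.xi_pos
  have hμ0 := h.mu_zero_pos
  set κ := √(μ 0 / 2) with hκdef
  have hκ : 0 < κ := Real.sqrt_pos.2 (by positivity)
  have hκ2 : κ ^ 2 = μ 0 / 2 := Real.sq_sqrt (by positivity)
  set s := √(μ 0) with hsdef
  have hs : 0 < s := Real.sqrt_pos.2 hμ0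
  have hs2 : s ^ 2 = μ 0 := Real.sq_sqrt hμ0.le
  have hcost : μ 0 ^ 2 / κ * (2 / 3) = kinkCost (μ 0) := by
    have h2 : √2 ^ 2 = (2 : ℝ) := Real.sq_sqrt (by norm_num)
    have h20 : √(2 : ℝ) ≠ 0 := by positivity
    have hκs : κ = s / √2 := by rw [hκdef, hsdef, Real.sqrt_div hμ0.le]
    rw [kinkCost, hκs, ← hsdef, ← hs2]
    field_simp
  refine ⟨2 * ξ * (K ^ 2 + 1) + 2 * K * s + μ 0 / κ, fun ε δ hε hδ => ?_⟩
  let T : ℝ → ℝ := fun x => Real.tanh (κ / ε * x)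
  let T' : ℝ → ℝ := fun x => κ / ε * (1 - T x ^ 2)
  have hT : ∀ x, HasDerivAt T (T' x) x := fun x =>
    ((hasDerivAt_tanh (κ / ε * x)).comp x ((hasDerivAt_id x).const_mul (κ / ε))).congr_deriv
      (by simp only [T', T]; ring)
  have hTc : Continuous T := continuous_iff_continuousAt.2 fun x => (hT x).continuousAt
  have hT'c : Continuous T' := by fun_prop
  have hT1 : ∀ x, T x ^ 2 ≤ 1 := fun x => tanh_sq_le_one _
  have hT'0 : ∀ x, 0 ≤ T' x := fun x => mul_nonneg (by positivity) (by linarith [hT1 x])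
  have hp := h1Pair_regProfile_mul h hδ hT hT'c
  refine ⟨_, _, hp, fun x hx => ?_, fun x hx => ?_, ?_⟩
  · exact mul_nonneg (regProfile_nonneg _ _ _) (tanh_nonneg (by positivity))
  · exact mul_nonpos_of_nonneg_of_nonpos (regProfile_nonneg _ _ _)
      (tanh_nonpos (mul_nonpos_of_nonneg_of_nonpos (by positivity) hx))
  rw [integral_density_regProfile h]
  let P : ℝ → ℝ := fun x => μ 0 ^ 2 / (2 * κ) * (T x - T x ^ 3 / 3) +
    (ε * (K / δ) * s + μ 0 * δ ^ 2 / (2 * κ)) * T x + (ε * K ^ 2 / (2 * δ ^ 2) + δ ^ 4 / (4 * ε)) * x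
  let P' : ℝ → ℝ := fun x => μ 0 ^ 2 / (2 * κ) * ((1 - T x ^ 2) * T' x) +
    (ε * (K / δ) * s + μ 0 * δ ^ 2 / (2 * κ)) * T' x + (ε * K ^ 2 / (2 * δ ^ 2) + δ ^ 4 / (4 * ε))
  have hP : ∀ x, HasDerivAt P (P' x) x := fun x =>
    ((((hT x).sub (((hT x).pow 3).div_const 3)).const_mul (μ 0 ^ 2 / (2 * κ))).add
      ((hT x).const_mul (ε * (K / δ) * s + μ 0 * δ ^ 2 / (2 * κ))) |>.add
      ((hasDerivAt_id x).const_mul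
        (ε * K ^ 2 / (2 * δ ^ 2) + δ ^ 4 / (4 * ε)))).congr_deriv (by
          simp only [P', Nat.cast_ofNat, Nat.reduceSub]; ring)
  have hP'c : Continuous P' := by fun_prop
  have hle : (∫ x in (-ξ)..ξ, density μ ε (fun x => regProfile μ δ x * T x)
      (fun x => regProfileDeriv μ ξ δ x * T x + regProfile μ δ x * T' x) x) ≤
      ∫ x in (-ξ)..ξ, P' x := by
    refine intervalIntegral_mono_Ioo (by linarith)
      (hp.density_integrable h ε).intervalIntegrable (hP'c.intervalIntegrable _ _) fun x hx => ?_
    have hx' : |x| < ξ := abs_lt.2 hx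
    have h1 := well_regProfile_mul_le h hδ (hT1 x) hx'
    have h2 := abs_regProfileDeriv_le hδ hK hK0.le x
    have hr0 := regProfile_nonneg μ δ x
    have hr2 : regProfile μ δ x ^ 2 ≤ μ 0 := (regProfile_sq_le hδ x).trans (h.posPart_le x)
    have hrs : regProfile μ δ x ≤ s := Real.le_sqrt_of_sq_le hr2
    have hTx := hT1 x
    have hTabs : |T x| ≤ 1 := (sq_le_one_iff_abs_le_one _).1 hTx
    have hT'x := hT'0 x
    have hT'def : T' x = κ / ε * (1 - T x ^ 2) := rfl
    simp only [density, P']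
    set D := regProfileDeriv μ ξ δ x
    set r := regProfile μ δ x
    set t := T x
    set t' := T' x
    have c1 : (D * t) ^ 2 ≤ (K / δ) ^ 2 := by
      rw [← sq_abs, abs_mul]
      refine pow_le_pow_left₀ (by positivity) ?_ 2
      calc |D| * |t| ≤ K / δ * 1 := mul_le_mul h2 hTabs (abs_nonneg _) (by positivity)
        _ = K / δ := mul_one _
    have c2 : (D * t) * (r * t') ≤ K / δ * (s * t') := by
      refine (le_abs_self _).trans ?_
      rw [abs_mul, abs_of_nonneg (mul_nonneg hr0 hT'x), abs_mul]
      refine mul_le_mul ?_ (mul_le_mul_of_nonneg_right hrs hT'x) (by positivity) (by positivity)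
      calc |D| * |t| ≤ K / δ * 1 := mul_le_mul h2 hTabs (abs_nonneg _) (by positivity)
        _ = K / δ := mul_one _
    have c3 : (r * t') ^ 2 ≤ μ 0 * t' ^ 2 := by
      rw [mul_pow]; exact mul_le_mul_of_nonneg_right hr2 (sq_nonneg _)
    have c4 : ε / 2 * (D * t + r * t') ^ 2 ≤
        ε / 2 * ((K / δ) ^ 2 + 2 * (K / δ * (s * t')) + μ 0 * t' ^ 2) := by
      refine mul_le_mul_of_nonneg_left ?_ (by positivity)
      nlinarith
    have c5 : well μ x (r * t) / ε ≤ (μ 0 * (1 - t ^ 2) + δ ^ 2) ^ 2 / 4 / ε :=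
      div_le_div_of_nonneg_right h1 hε.le
    refine (add_le_add c4 c5).trans (le_of_eq ?_)
    have ht' : 1 - t ^ 2 = ε / κ * t' := by rw [hT'def]; field_simp
    rw [ht']
    have hm : μ 0 = 2 * κ ^ 2 := by linarith
    rw [hm]
    field_simp
    ring
  refine hle.trans ?_
  rw [intervalIntegral.integral_eq_sub_of_hasDerivAt (fun x _ => hP x)
    (hP'c.intervalIntegrable _ _)]
  have hTn : T (-ξ) = -T ξ := by
    simp only [T, mul_neg, Real.tanh_neg]
  have hT0 : 0 ≤ T ξ := tanh_nonneg (by positivity)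
  have hTle : T ξ ≤ 1 := (Real.tanh_lt_one _).le
  have h3 : T ξ - T ξ ^ 3 / 3 ≤ 2 / 3 := by
    nlinarith [mul_nonneg (sq_nonneg (T ξ - 1)) (by linarith : 0 ≤ T ξ + 2)]
  have e : P ξ - P (-ξ) = μ 0 ^ 2 / κ * (T ξ - T ξ ^ 3 / 3) +
      (2 * K * s * (ε / δ) + μ 0 / κ * δ ^ 2) * T ξ +
      2 * ξ * (K ^ 2 / 2 * (ε / δ ^ 2) + 1 / 4 * (δ ^ 4 / ε)) := by
    simp only [P, hTn]; field_simp; ring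
  rw [e, ← hcost]
  have i1 : μ 0 ^ 2 / κ * (T ξ - T ξ ^ 3 / 3) ≤ μ 0 ^ 2 / κ * (2 / 3) :=
    mul_le_mul_of_nonneg_left h3 (by positivity)
  set A := ε / δ ^ 2
  set B := δ ^ 4 / ε
  set C := ε / δ
  set E := δ ^ 2
  have hA : 0 ≤ A := by positivity
  have hB : 0 ≤ B := by positivity
  have hC : 0 ≤ C := by positivity
  have hE : 0 ≤ E := by positivity
  have i2 : (2 * K * s * C + μ 0 / κ * E) * T ξ ≤ 2 * K * s * C + μ 0 / κ * E :=
    mul_le_of_le_one_right (by positivity) hTle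
  have i3 : 2 * K * s * C + μ 0 / κ * E ≤ (2 * K * s + μ 0 / κ) * (A + B + C + E) := by
    have j1 : 0 ≤ 2 * K * s * (A + B + E) := by positivity
    have j2 : 0 ≤ μ 0 / κ * (A + B + C) := by positivity
    have j3 : (2 * K * s + μ 0 / κ) * (A + B + C + E) = 2 * K * s * C + μ 0 / κ * E +
      2 * K * s * (A + B + E) + μ 0 / κ * (A + B + C) := by ring
    linarith
  have i4 : 2 * ξ * (K ^ 2 / 2 * A + 1 / 4 * B) ≤ 2 * ξ * (K ^ 2 + 1) * (A + B + C + E) := by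
    rw [mul_assoc (2 * ξ)]
    refine mul_le_mul_of_nonneg_left ?_ (by positivity)
    have j1 : 0 ≤ K ^ 2 * (B + C + E) := by positivity
    have j2 : 0 ≤ K ^ 2 * A := by positivity
    have j3 : (K ^ 2 + 1) * (A + B + C + E) =
      K ^ 2 * A + B + (K ^ 2 * (B + C + E) + A + C + E) := by ring
    linarith
  linarith

end

section


variable {μ f : ℝ → ℝ} {ξ a ε : ℝ} {v g : ℝ → ℝ}

lemma sqrt_posPart (μ : ℝ → ℝ) (x : ℝ) : √(posPart μ x) = √(μ x) := by
  rcases le_total (μ x) 0 with h | h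
  · rw [posPart, max_eq_right h, Real.sqrt_zero, Real.sqrt_eq_zero_of_nonpos h]
  · rw [posPart, max_eq_left h]

/-- The sign of `x - z`. -/
def sgnAt (z x : ℝ) : ℝ := if z < x then 1 else -1

/-- The weight `|f| √μ₊`. -/
def weight (μ f : ℝ → ℝ) (x : ℝ) : ℝ := |f x| * √(μ x)

/-- The limit of `∫ f v` when the zero of `v` is at `z`. -/
def linearLimit (μ f : ℝ → ℝ) (z : ℝ) : ℝ := ∫ x, f x * (sgnAt z x * √(μ x))

lemma weight_nonneg (μ f : ℝ → ℝ) (x : ℝ) : 0 ≤ weight μ f x :=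
  mul_nonneg (abs_nonneg _) (Real.sqrt_nonneg _)

lemma weight_continuous (h : Assumptions μ f ξ) : Continuous (weight μ f) :=
  h.f_continuous.abs.mul (Real.continuous_sqrt.comp h.mu_continuous)

lemma weight_intervalIntegrable (h : Assumptions μ f ξ) (x y : ℝ) :
    IntervalIntegrable (weight μ f) volume x y :=
  (weight_continuous h).intervalIntegrable x y

lemma weight_even (h : Assumptions μ f ξ) (x : ℝ) : weight μ f (-x) = weight μ f x := by
  rw [weight, weight, h.f_odd, h.mu_even, abs_neg]

lemma weight_eq_zero (h : Assumptions μ f ξ) {x : ℝ} (hx : ξ ≤ |x|) : weight μ f x = 0 := by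
  rw [weight, Real.sqrt_eq_zero_of_nonpos (h.mu_nonpos hx), mul_zero]

lemma weight_pos (h : Assumptions μ f ξ) {x : ℝ} (hx : |x| < ξ) (hx0 : x ≠ 0) :
    0 < weight μ f x := by
  refine mul_pos (abs_pos.2 ?_) (Real.sqrt_pos.2 (h.mu_pos hx))
  rcases lt_or_gt_of_ne hx0 with h0 | h0
  · exact (h.f_neg h0).ne
  · exact (h.f_pos x h0).ne'

lemma weight_integrable (h : Assumptions μ f ξ) : Integrable (weight μ f) volume := by
  refine (weight_continuous h).integrable_of_hasCompactSupport
    (HasCompactSupport.intro (isCompact_Icc (a := -ξ) (b := ξ)) fun x hx => weight_eq_zero h ?_)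
  by_contra h'
  exact hx (abs_le.1 (not_le.1 h').le)

lemma intervalIntegral_weight_neg (h : Assumptions μ f ξ) (x y : ℝ) :
    ∫ t in (-y)..(-x), weight μ f t = ∫ t in x..y, weight μ f t := by
  rw [← intervalIntegral.integral_comp_neg]
  simp only [weight_even h]

lemma setIntegral_uIoc_weight (h : Assumptions μ f ξ) (z : ℝ) :
    ∫ t in uIoc 0 z, weight μ f t = ∫ t in 0..|z|, weight μ f t := by
  rcases le_total 0 z with hz | hz
  · rw [uIoc_of_le hz, abs_of_nonneg hz, intervalIntegral.integral_of_le hz]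
  · rw [uIoc_of_ge hz, abs_of_nonpos hz, ← intervalIntegral.integral_of_le hz,
      ← intervalIntegral_weight_neg h 0 (-z), neg_neg, neg_zero]

lemma linearLimit_eq (h : Assumptions μ f ξ) (z : ℝ) :
    linearLimit μ f z =
      2 * (∫ t in 0..ξ, weight μ f t) - 2 * ∫ t in 0..|z|, weight μ f t := by
  have hpt : ∀ x, f x * (sgnAt z x * √(μ x)) =
      weight μ f x - 2 * (uIoc 0 z).indicator (weight μ f) x := by
    intro x
    have habs : ∀ y, 0 ≤ y → |f y| = f y := fun y hy => by
      rcases hy.eq_or_lt with rfl | hy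
      · rw [h.f_zero, abs_zero]
      · exact abs_of_pos (h.f_pos y hy)
    have habs' : ∀ y, y ≤ 0 → |f y| = -f y := fun y hy => by
      rcases hy.eq_or_lt with rfl | hy
      · rw [h.f_zero, abs_zero, neg_zero]
      · exact abs_of_neg (h.f_neg hy)
    rcases le_total 0 z with hz | hz
    · rw [uIoc_of_le hz]
      by_cases hx : x ∈ Ioc 0 z
      · rw [indicator_of_mem hx, sgnAt, if_neg (not_lt.2 hx.2), weight, habs x hx.1.le]; ring
      · rw [indicator_of_notMem hx, sgnAt, weight]
        split_ifs with hzx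
        · rw [habs x (hz.trans hzx.le)]; ring
        · rw [habs' x (not_lt.1 fun h0 => hx ⟨h0, not_lt.1 hzx⟩)]; ring
    · rw [uIoc_of_ge hz]
      by_cases hx : x ∈ Ioc z 0
      · rw [indicator_of_mem hx, sgnAt, if_pos hx.1, weight, habs' x hx.2]; ring
      · rw [indicator_of_notMem hx, sgnAt, weight]
        split_ifs with hzx
        · rw [habs x (not_lt.1 fun h0 => hx ⟨hzx, h0.le⟩)]; ring
        · rw [habs' x ((not_lt.1 hzx).trans hz)]; ring
  have hw := weight_integrable h
  rw [linearLimit, integral_congr_ae (Eventually.of_forall hpt),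
    integral_sub hw ((hw.indicator measurableSet_uIoc).const_mul 2), integral_const_mul,
    integral_indicator measurableSet_uIoc, setIntegral_uIoc_weight h,
    integral_eq_intervalIntegral_of_eq_zero (R := ξ) fun x hx => weight_eq_zero h (by
      by_contra h'
      exact hx (abs_lt.1 (not_le.1 h'))),
    ← intervalIntegral.integral_add_adjacent_intervals (weight_intervalIntegrable h (-ξ) 0)
      (weight_intervalIntegrable h 0 ξ)]
  have := intervalIntegral_weight_neg h 0 ξ
  rw [neg_zero] at this
  rw [this]
  ring

lemma abs_abs_sub_sqrt_pow_four_le (μ : ℝ → ℝ) (x u : ℝ) :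
    (|u| - √(μ x)) ^ 4 ≤ 4 * well μ x u := by
  have hs := Real.sqrt_nonneg (μ x)
  have hp : √(μ x) ^ 2 = posPart μ x := by
    rw [← sqrt_posPart]; exact Real.sq_sqrt (posPart_nonneg μ x)
  have hw := well_ge μ x u
  rw [← hp, ← sq_abs u] at hw
  have hu := abs_nonneg u
  set s := √(μ x)
  set t := |u|
  have h1 : (t - s) ^ 2 ≤ (t + s) ^ 2 := by nlinarith [mul_nonneg hu hs]
  have h2 : (t - s) ^ 4 ≤ (t ^ 2 - s ^ 2) ^ 2 := by
    calc (t - s) ^ 4 = (t - s) ^ 2 * (t - s) ^ 2 := by ring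
      _ ≤ (t - s) ^ 2 * (t + s) ^ 2 := mul_le_mul_of_nonneg_left h1 (sq_nonneg _)
      _ = _ := by ring
  linarith

lemma H1Pair.integral_well_le (hp : H1Pair v g) (h : Assumptions μ f ξ) (hε : 0 < ε) :
    ∫ x, well μ x (v x) ≤ ε * ∫ x, density μ ε v g x := by
  rw [← integral_const_mul]
  refine integral_mono (hp.well_integrable h) ((hp.density_integrable h ε).const_mul ε)
    fun x => ?_
  have : ε * density μ ε v g x = ε ^ 2 / 2 * g x ^ 2 + well μ x (v x) := by
    unfold density; field_simp
  simp only [this]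
  have : 0 ≤ ε ^ 2 / 2 * g x ^ 2 := by positivity
  linarith

lemma measurable_sgnAt (z : ℝ) : Measurable (sgnAt z) :=
  Measurable.ite measurableSet_Ioi measurable_const measurable_const

lemma integrable_linearLimit (h : Assumptions μ f ξ) (z : ℝ) :
    Integrable (fun x => f x * (sgnAt z x * √(μ x))) volume := by
  refine (weight_integrable h).mono (h.f_continuous.measurable.mul ((measurable_sgnAt z).mul
    (Real.continuous_sqrt.comp h.mu_continuous).measurable)).aestronglyMeasurable
    (Eventually.of_forall fun x => ?_)
  have : |sgnAt z x| = 1 := by unfold sgnAt; split_ifs <;> simp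
  simp only [weight, norm_mul, Real.norm_eq_abs, this, one_mul, abs_abs, le_refl]

/-- The linear term is close to its limit, quantitatively. -/
lemma H1Pair.linear_approx (hp : H1Pair v g) (h : Assumptions μ f ξ) (hε : 0 < ε) {z F l : ℝ}
    (hF : ∀ x, |f x| ≤ F) (hl : 0 < l) (hpos : ∀ x, z < x → 0 ≤ v x) (hneg : ∀ x, x ≤ z → v x ≤ 0) :
    |(∫ x, f x * v x) - linearLimit μ f z| ≤
      l * (∫ x, |f x|) + 4 * F * ε / l ^ 3 * ∫ x, density μ ε v g x := by
  have hF0 : 0 ≤ F := (abs_nonneg _).trans (hF 0)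
  have hwi := hp.well_integrable h
  rw [linearLimit, ← integral_sub (hp.f_mul_integrable h) (integrable_linearLimit h z)]
  refine abs_integral_le_integral_abs.trans ?_
  calc ∫ x, |f x * v x - f x * (sgnAt z x * √(μ x))|
      ≤ ∫ x, (l * |f x| + 4 * F / l ^ 3 * well μ x (v x)) := by
        refine integral_mono ((hp.f_mul_integrable h).sub (integrable_linearLimit h z)).abs
          ((h.f_int.abs.const_mul l).add (hwi.const_mul _)) fun x => ?_
        have e : |f x * v x - f x * (sgnAt z x * √(μ x))| = |f x| * |(|v x| - √(μ x))| := by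
          rw [← mul_sub, abs_mul, sgnAt]
          split_ifs with hz
          · rw [abs_of_nonneg (hpos x hz), one_mul]
          · rw [abs_of_nonpos (hneg x (not_lt.1 hz)), ← abs_neg (v x - _)]
            congr 2; ring
        simp only [e]
        have h1 := abs_le_add_pow_four hl (|v x| - √(μ x))
        have h2 := abs_abs_sub_sqrt_pow_four_le μ x (v x)
        have h3 : (|v x| - √(μ x)) ^ 4 / l ^ 3 ≤ 4 * well μ x (v x) / l ^ 3 :=
          div_le_div_of_nonneg_right h2 (by positivity)
        have h4 : 0 ≤ 4 * well μ x (v x) / l ^ 3 := by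
          have := well_nonneg μ x (v x); positivity
        calc |f x| * |(|v x| - √(μ x))| ≤ |f x| * (l + 4 * well μ x (v x) / l ^ 3) :=
              mul_le_mul_of_nonneg_left (h1.trans (by linarith)) (abs_nonneg _)
          _ = l * |f x| + |f x| * (4 * well μ x (v x) / l ^ 3) := by ring
          _ ≤ l * |f x| + F * (4 * well μ x (v x) / l ^ 3) := by
              have := mul_le_mul_of_nonneg_right (hF x) h4
              linarith
          _ = _ := by ring
    _ = l * (∫ x, |f x|) + 4 * F / l ^ 3 * ∫ x, well μ x (v x) := by
        rw [integral_add (h.f_int.abs.const_mul l) (hwi.const_mul _), integral_const_mul,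
          integral_const_mul]
    _ ≤ _ := by
        have := mul_le_mul_of_nonneg_left (hp.integral_well_le h hε)
          (by positivity : 0 ≤ 4 * F / l ^ 3)
        have e : 4 * F / l ^ 3 * (ε * ∫ x, density μ ε v g x) =
          4 * F * ε / l ^ 3 * ∫ x, density μ ε v g x := by ring
        linarith

/-- For fixed bounds, the linear term converges as `ε → 0`. -/
lemma eventually_linear_approx (h : Assumptions μ f ξ) (B : ℝ) {η : ℝ} (hη : 0 < η) :
    ∀ᶠ ε in 𝓝[>] (0 : ℝ), ∀ v g z, H1Pair v g → (∀ x, z < x → 0 ≤ v x) →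
      (∀ x, x ≤ z → v x ≤ 0) → (∫ x, density μ ε v g x) ≤ B →
      |(∫ x, f x * v x) - linearLimit μ f z| ≤ η := by
  obtain ⟨F, hF0, hF⟩ := h.exists_f_bound
  have hI : 0 ≤ ∫ x, |f x| := integral_nonneg fun x => abs_nonneg _
  set I := ∫ x, |f x|
  set l := η / (2 * (I + 1))
  have hl : 0 < l := by positivity
  have hlI : l * I ≤ η / 2 := by
    simp only [l]; rw [div_mul_eq_mul_div, div_le_div_iff₀ (by positivity) (by norm_num)]
    nlinarith
  have ht : Tendsto (fun ε : ℝ => 4 * F * ε / l ^ 3 * |B|) (𝓝[>] 0) (𝓝 0) := by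
    have : Continuous fun ε : ℝ => 4 * F * ε / l ^ 3 * |B| := by fun_prop
    have h1 := this.tendsto 0
    simp only [mul_zero, zero_div, zero_mul] at h1
    exact h1.mono_left nhdsWithin_le_nhds
  filter_upwards [ht.eventually (eventually_le_nhds (half_pos hη)), self_mem_nhdsWithin] with ε h1 hε
    v g z hp hpos hneg hB
  have hε' : 0 < ε := hε
  have h2 := hp.linear_approx h hε' hF hl hpos hneg
  have h3 : 4 * F * ε / l ^ 3 * (∫ x, density μ ε v g x) ≤ 4 * F * ε / l ^ 3 * |B| :=
    mul_le_mul_of_nonneg_left (hB.trans (le_abs_self B)) (by positivity)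
  linarith

lemma tendsto_root_eight :
    Tendsto (fun ε : ℝ => √√√ε) (𝓝[>] 0) (𝓝 0) := by
  have : Continuous fun ε : ℝ => √√√ε := by fun_prop
  have h1 := this.tendsto 0
  simp only [Real.sqrt_zero] at h1
  exact h1.mono_left nhdsWithin_le_nhds

lemma root_eight_pow {ε : ℝ} (hε : 0 < ε) : √√√ε ^ 8 = ε := by
  have h1 : √√√ε ^ 2 = √√ε := Real.sq_sqrt (Real.sqrt_nonneg _)
  have h2 : √√ε ^ 2 = √ε := Real.sq_sqrt (Real.sqrt_nonneg _)
  have h3 : √ε ^ 2 = ε := Real.sq_sqrt hε.le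
  calc √√√ε ^ 8 = ((√√√ε ^ 2) ^ 2) ^ 2 := by ring
    _ = ε := by rw [h1, h2, h3]

/-- Comparison with the kink-free profile. -/
lemma eventually_renEnergy_le (h : Assumptions μ f ξ) (a : ℝ) {η : ℝ} (hη : 0 < η) :
    ∀ᶠ ε in 𝓝[>] (0 : ℝ), ∀ v g, IsMinPair μ f a ε v g → renEnergy μ f a ε v g ≤ η := by
  obtain ⟨K, hK⟩ := exists_profile_energy_le h
  have ht : Tendsto (fun ε : ℝ => K * (√√√ε ^ 2 + √√√ε ^ 4)) (𝓝[>] 0) (𝓝 0) := by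
    simpa using ((tendsto_root_eight.pow 2).add (tendsto_root_eight.pow 4)).const_mul K
  filter_upwards [ht.eventually (eventually_le_nhds hη), self_mem_nhdsWithin] with ε h1 hε v g hm
  have hε' : 0 < ε := hε
  set τ := √√√ε
  have hτ : 0 < τ := by positivity
  have hτ8 : τ ^ 8 = ε := root_eight_pow hε'
  obtain ⟨u, k, hp, hlin, hle⟩ := hK ε (τ ^ 3) hε' (by positivity)
  refine (hm.le u k hp).trans ?_
  rw [hp.renEnergy_eq h, hlin, mul_zero, sub_zero]
  refine hle.trans (le_trans (le_of_eq ?_) h1)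
  rw [← hτ8]
  field_simp

/-- The nonnegative part of the energy of minimisers is bounded. -/
lemma exists_density_bound (h : Assumptions μ f ξ) {a : ℝ} (ha : 0 ≤ a) :
    ∃ B : ℝ, ∀ᶠ ε in 𝓝[>] (0 : ℝ), ∀ v, RegMin μ f a ε v →
      ∫ x, density μ ε v (deriv v) x ≤ B := by
  obtain ⟨M, _, hM0, _, hbd⟩ := exists_uniform_bounds h ha
  refine ⟨1 + a * (M * ∫ x, |f x|), ?_⟩
  filter_upwards [eventually_renEnergy_le h a one_pos, Ioc_mem_nhdsGT (zero_lt_one' ℝ)] with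
    ε h1 hε v hr
  have h2 := h1 v _ hr.min
  rw [hr.min.pair.renEnergy_eq h] at h2
  have h3 : ∫ x, f x * v x ≤ M * ∫ x, |f x| := by
    rw [← integral_const_mul]
    refine integral_mono (hr.min.pair.f_mul_integrable h) (h.f_int.abs.const_mul M) fun x => ?_
    calc f x * v x ≤ |f x * v x| := le_abs_self _
      _ = |v x| * |f x| := by rw [abs_mul, mul_comm]
      _ ≤ M * |f x| := mul_le_mul_of_nonneg_right ((hbd ε v hε.1 hε.2 hr).1 x) (abs_nonneg _)
  have := mul_le_mul_of_nonneg_left h3 ha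
  linarith

/-- Comparison with the profile with a kink at the origin. -/
lemma eventually_renEnergy_le_kink (h : Assumptions μ f ξ) {a : ℝ} (ha : 0 ≤ a) {η : ℝ}
    (hη : 0 < η) :
    ∀ᶠ ε in 𝓝[>] (0 : ℝ), ∀ v g, IsMinPair μ f a ε v g →
      renEnergy μ f a ε v g ≤ kinkCost (μ 0) - a * linearLimit μ f 0 + η := by
  obtain ⟨K, hK⟩ := exists_kink_energy_le h
  have ht : Tendsto (fun ε : ℝ => K * (√√√ε ^ 2 + √√√ε ^ 4 + √√√ε ^ 5 + √√√ε ^ 6)) (𝓝[>] 0)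
      (𝓝 0) := by
    simpa using ((((tendsto_root_eight.pow 2).add (tendsto_root_eight.pow 4)).add
      (tendsto_root_eight.pow 5)).add (tendsto_root_eight.pow 6)).const_mul K
  have hη' : 0 < η / (2 * (a + 1)) := by positivity
  filter_upwards [ht.eventually (eventually_le_nhds (half_pos hη)), self_mem_nhdsWithin,
    eventually_linear_approx h (kinkCost (μ 0) + η / 2) hη'] with ε h1 hε hlin v g hm
  have hε' : 0 < ε := hε
  set τ := √√√ε
  have hτ : 0 < τ := by positivity
  have hτ8 : τ ^ 8 = ε := root_eight_pow hε'
  obtain ⟨u, k, hp, hpos, hneg, hle⟩ := hK ε (τ ^ 3) hε' (by positivity)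
  have hle' : ∫ x, density μ ε u k x ≤ kinkCost (μ 0) + η / 2 := by
    refine hle.trans (add_le_add le_rfl (le_trans (le_of_eq ?_) h1))
    rw [← hτ8]
    field_simp
  refine (hm.le u k hp).trans ?_
  have h2 := (abs_le.1 (hlin u k 0 hp hpos hneg hle')).1
  rw [hp.renEnergy_eq h]
  have h3 : a * (η / (2 * (a + 1))) ≤ η / 2 := by
    rw [mul_div_assoc', div_le_div_iff₀ (by positivity) (by norm_num)]
    nlinarith
  have h4 := mul_le_mul_of_nonneg_left h2 ha
  linarith

/-- Upper bounds for the nonnegative part of the energy of a minimiser with zero `z`. -/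
lemma eventually_density_le (h : Assumptions μ f ξ) {a : ℝ} (ha : 0 < a) {η : ℝ} (hη : 0 < η) :
    ∀ᶠ ε in 𝓝[>] (0 : ℝ), ∀ v z, RegMin μ f a ε v → v z = 0 →
      (∫ x, density μ ε v (deriv v) x ≤
        kinkCost (μ 0) - 2 * a * (∫ t in 0..|z|, weight μ f t) + η) ∧
      ∫ x, density μ ε v (deriv v) x ≤
        2 * a * ((∫ t in 0..ξ, weight μ f t) - ∫ t in 0..|z|, weight μ f t) + η := by
  obtain ⟨B, hB⟩ := exists_density_bound h ha.le
  have hη' : 0 < η / (2 * a) := by positivity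
  filter_upwards [hB, eventually_linear_approx h B hη', self_mem_nhdsWithin,
    eventually_renEnergy_le h a (half_pos hη), eventually_renEnergy_le_kink h ha.le (half_pos hη)]
    with ε hB hlin hε h1 h2 v z hr hz
  obtain ⟨hpos, hneg⟩ := hr.sign_of_zero h ha hε hz
  have hl := (abs_le.1 (hlin v (deriv v) z hr.min.pair (fun x hx => (hpos x hx).le)
    (fun x hx => by
      rcases hx.eq_or_lt with rfl | hx
      · exact hz.le
      · exact (hneg x hx).le) (hB v hr))).2
  have e1 := h1 v _ hr.min
  have e2 := h2 v _ hr.min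
  rw [hr.min.pair.renEnergy_eq h] at e1 e2
  have h3 := mul_le_mul_of_nonneg_left hl ha.le
  have h4 : a * (η / (2 * a)) = η / 2 := by field_simp
  rw [h4, mul_sub] at h3
  rw [linearLimit_eq h] at h3 e2
  simp only [abs_zero, intervalIntegral.integral_same, mul_zero, sub_zero] at e2
  constructor <;> nlinarith

end

section


variable {μ f : ℝ → ℝ} {ξ a ε : ℝ} {v : ℝ → ℝ}

/-- The truncated well `(m - u²)₊`. -/
def truncWell (m u : ℝ) : ℝ := max (m - u ^ 2) 0

lemma truncWell_nonneg (m u : ℝ) : 0 ≤ truncWell m u := le_max_right _ _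

lemma truncWell_continuous (m : ℝ) : Continuous (truncWell m) := by
  unfold truncWell; fun_prop

lemma truncWell_neg (m u : ℝ) : truncWell m (-u) = truncWell m u := by
  rw [truncWell, truncWell, neg_sq]

lemma abs_max_sub_max_zero_le (x y : ℝ) : |max x 0 - max y 0| ≤ |x - y| :=
  abs_max_sub_max_le_abs x y 0

lemma truncWell_sub_le (m m' u : ℝ) : |truncWell m u - truncWell m' u| ≤ |m - m'| := by
  refine (abs_max_sub_max_zero_le _ _).trans (le_of_eq ?_)
  congr 1; ring

lemma truncWell_lipschitz (m : ℝ) {M u w : ℝ} (hu : |u| ≤ M) (hw : |w| ≤ M) :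
    |truncWell m u - truncWell m w| ≤ 2 * M * |u - w| := by
  refine (abs_max_sub_max_zero_le _ _).trans ?_
  have e : m - u ^ 2 - (m - w ^ 2) = -((u + w) * (u - w)) := by ring
  rw [e, abs_neg, abs_mul]
  exact mul_le_mul_of_nonneg_right ((abs_add_le u w).trans (by linarith)) (abs_nonneg _)

lemma truncWell_sq_le_well {m x u : ℝ} (hm : m ≤ posPart μ x) :
    truncWell m u ^ 2 ≤ 4 * well μ x u := by
  have h1 := well_ge μ x u
  have h0 := well_nonneg μ x u
  rw [truncWell]
  rcases le_total (m - u ^ 2) 0 with h | h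
  · rw [max_eq_right h]; simp; linarith
  · rw [max_eq_left h]
    nlinarith

/-- The part of the energy density lost in the Modica–Mortola inequality. -/
def excess (m ε : ℝ) (v : ℝ → ℝ) (x : ℝ) : ℝ :=
  (ε * deriv v x - truncWell m (v x) / √2) ^ 2 / (2 * ε)

lemma excess_nonneg (m : ℝ) (hε : 0 < ε) (v : ℝ → ℝ) (x : ℝ) : 0 ≤ excess m ε v x := by
  unfold excess; positivity

lemma excess_add_le_density {m x : ℝ} (hε : 0 < ε) (hm : m ≤ posPart μ x) :
    excess m ε v x + deriv v x * truncWell m (v x) / √2 ≤ density μ ε v (deriv v) x := by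
  have h1 := truncWell_sq_le_well (u := v x) hm
  have h2 : √2 ^ 2 = (2 : ℝ) := Real.sq_sqrt (by norm_num)
  have h20 : √(2 : ℝ) ≠ 0 := by positivity
  have e : excess m ε v x + deriv v x * truncWell m (v x) / √2 =
      ε / 2 * deriv v x ^ 2 + truncWell m (v x) ^ 2 / 4 / ε := by
    unfold excess
    have e2 : (ε * deriv v x - truncWell m (v x) / √2) ^ 2 = ε ^ 2 * deriv v x ^ 2 -
        2 * ε * (deriv v x * truncWell m (v x) / √2) + truncWell m (v x) ^ 2 / 2 := by
      rw [sub_sq, div_pow, h2]; ring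
    rw [e2]; field_simp; ring
  rw [e, density]
  have : truncWell m (v x) ^ 2 / 4 / ε ≤ well μ x (v x) / ε :=
    div_le_div_of_nonneg_right (by linarith) hε.le
  linarith

/-- The primitive of the truncated well. -/
def wellPrimitive (m s : ℝ) : ℝ := ∫ t in (0 : ℝ)..s, truncWell m t / √2

lemma hasDerivAt_wellPrimitive (m s : ℝ) :
    HasDerivAt (wellPrimitive m) (truncWell m s / √2) s := by
  have hc : Continuous fun t => truncWell m t / √2 := (truncWell_continuous m).div_const _
  exact intervalIntegral.integral_hasDerivAt_right (hc.intervalIntegrable _ _)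
    (hc.stronglyMeasurableAtFilter _ _) hc.continuousAt

lemma wellPrimitive_monotone (m : ℝ) : Monotone (wellPrimitive m) :=
  monotone_of_hasDerivAt_nonneg (hasDerivAt_wellPrimitive m) fun s =>
    div_nonneg (truncWell_nonneg m s) (Real.sqrt_nonneg _)

lemma wellPrimitive_neg (m s : ℝ) : wellPrimitive m (-s) = -wellPrimitive m s := by
  unfold wellPrimitive
  have := intervalIntegral.integral_comp_neg (a := 0) (b := s) (fun t => truncWell m t / √2)
  simp only [truncWell_neg, neg_zero] at this
  rw [this, ← intervalIntegral.integral_symm]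

lemma le_wellPrimitive {m s : ℝ} (hs : 0 ≤ s) (hm : s ^ 2 ≤ m) :
    √2 / 3 * s ^ 3 ≤ wellPrimitive m s := by
  have h2 : √2 ^ 2 = (2 : ℝ) := Real.sq_sqrt (by norm_num)
  have h20 : 0 < √(2 : ℝ) := by positivity
  have hc : Continuous fun t : ℝ => (s ^ 2 - t ^ 2) / √2 := by fun_prop
  have h1 : ∫ t in (0 : ℝ)..s, (s ^ 2 - t ^ 2) / √2 ≤ wellPrimitive m s := by
    refine intervalIntegral.integral_mono_on hs (hc.intervalIntegrable _ _)
      (((truncWell_continuous m).div_const _).intervalIntegrable _ _) fun t _ => ?_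
    refine div_le_div_of_nonneg_right ?_ h20.le
    exact le_trans (by linarith) (le_max_left _ _)
  refine le_trans (le_of_eq ?_) h1
  rw [intervalIntegral.integral_div, intervalIntegral.integral_sub
    intervalIntegrable_const ((continuous_pow 2).intervalIntegrable _ _), integral_pow,
    intervalIntegral.integral_const, eq_div_iff h20.ne']
  simp only [sub_zero, smul_eq_mul]
  have : √2 / 3 * s ^ 3 * √2 = √2 ^ 2 / 3 * s ^ 3 := by ring
  rw [this, h2]
  norm_num
  ring

lemma RegMin.density_continuous (hr : RegMin μ f a ε v) (h : Assumptions μ f ξ) :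
    Continuous (density μ ε v (deriv v)) := by
  have h1 := h.mu_continuous
  have h2 := h.posPart_continuous
  have h3 := hr.continuous
  have h4 := hr.continuous_deriv
  unfold density well
  fun_prop

lemma RegMin.excess_continuous (hr : RegMin μ f a ε v) (m : ℝ) :
    Continuous (excess m ε v) := by
  have h2 := truncWell_continuous m
  have h3 := hr.continuous
  have h4 := hr.continuous_deriv
  unfold excess
  fun_prop

lemma RegMin.intervalIntegral_density_le (hr : RegMin μ f a ε v) (h : Assumptions μ f ξ)
    (hε : 0 < ε) {c d : ℝ} (hcd : c ≤ d) :
    ∫ x in c..d, density μ ε v (deriv v) x ≤ ∫ x, density μ ε v (deriv v) x := by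
  rw [intervalIntegral.integral_of_le hcd]
  exact setIntegral_le_integral (hr.min.pair.density_integrable h ε)
    (Eventually.of_forall fun x => density_nonneg μ hε v _ x)

/-- In a long interval the minimiser comes close to the bottom of the well. -/
lemma RegMin.exists_near_well (hr : RegMin μ f a ε v) (h : Assumptions μ f ξ) (hε : 0 < ε)
    {B κ c d : ℝ} (hcd : c < d) (hκ : 0 < κ) (hB : ∫ x, density μ ε v (deriv v) x ≤ B)
    (hs : 4 * ε * B < κ ^ 2 * (d - c)) : ∃ q ∈ Icc c d, posPart μ q - κ ≤ v q ^ 2 := by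
  by_contra! hcon
  have h1 : ∫ _ in c..d, κ ^ 2 / (4 * ε) ≤ ∫ x in c..d, density μ ε v (deriv v) x := by
    refine intervalIntegral.integral_mono_on hcd.le intervalIntegrable_const
      ((hr.density_continuous h).intervalIntegrable _ _) fun x hx => ?_
    have h2 := hcon x hx
    have h3 := well_ge μ x (v x)
    have h4 : κ ^ 2 / 4 ≤ well μ x (v x) := by nlinarith
    have h5 : κ ^ 2 / (4 * ε) ≤ well μ x (v x) / ε := by
      rw [← div_div]; exact div_le_div_of_nonneg_right h4 hε.le
    unfold density
    have : 0 ≤ ε / 2 * deriv v x ^ 2 := by positivity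
    linarith
  rw [intervalIntegral.integral_const, smul_eq_mul, mul_div_assoc', div_le_iff₀ (by positivity)]
    at h1
  have h6 := (hr.intervalIntegral_density_le h hε hcd.le).trans hB
  have h7 := mul_le_mul_of_nonneg_right h6 (by positivity : 0 ≤ 4 * ε)
  linarith

/-- Lower bound for the energy of a transition layer. -/
lemma RegMin.kinkCost_le (hr : RegMin μ f a ε v) (h : Assumptions μ f ξ) (hε : 0 < ε)
    {B κ δ m z : ℝ} (hδ : 0 < δ) (hκ : 0 < κ) (hm0 : 0 ≤ m)
    (hm : ∀ x ∈ Icc (z - δ) (z + δ), m ≤ posPart μ x)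
    (hpos : ∀ x, z < x → 0 < v x) (hneg : ∀ x, x < z → v x < 0)
    (hB : ∫ x, density μ ε v (deriv v) x ≤ B) (hs : 8 * ε * B < κ ^ 2 * δ) :
    kinkCost (m - κ) + ∫ x in (z - δ / 2)..(z + δ / 2), excess m ε v x ≤
      ∫ x in (z - δ)..(z + δ), density μ ε v (deriv v) x := by
  obtain ⟨q, hq, hvq⟩ := hr.exists_near_well h hε (c := z + δ / 2) (d := z + δ) (by linarith) hκ hB
    (by linarith)
  obtain ⟨p, hp, hvp⟩ := hr.exists_near_well h hε (c := z - δ) (d := z - δ / 2) (by linarith) hκ hB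
    (by linarith)
  set s := √(m - κ)
  have hs0 : 0 ≤ s := Real.sqrt_nonneg _
  have hs2 : s ^ 2 ≤ m := by
    rcases le_total 0 (m - κ) with h0 | h0
    · rw [Real.sq_sqrt h0]; linarith
    · simp only [s]; rw [Real.sqrt_eq_zero_of_nonpos h0]; simpa using hm0
  have hqs : s ≤ v q := by
    have h1 := hm q ⟨by linarith [hq.1], hq.2⟩
    rw [← Real.sqrt_sq (hpos q (by linarith [hq.1])).le]
    exact Real.sqrt_le_sqrt (by linarith)
  have hps : v p ≤ -s := by
    have h1 := hm p ⟨hp.1, by linarith [hp.2]⟩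
    have h2 := hneg p (by linarith [hp.2])
    have : s ≤ -v p := by
      rw [← Real.sqrt_sq (by linarith : 0 ≤ -v p)]
      exact Real.sqrt_le_sqrt (by rw [neg_sq]; linarith)
    linarith
  have hpq : p ≤ q := by linarith [hp.2, hq.1]
  have hdc := hr.density_continuous h
  have hec := hr.excess_continuous m
  have hprod : Continuous fun x => deriv v x * truncWell m (v x) / √2 := by
    have h1 := truncWell_continuous m
    have h2 := hr.continuous
    have h3 := hr.continuous_deriv
    fun_prop
  have e1 : ∫ x in p..q, deriv v x * truncWell m (v x) / √2 =
      wellPrimitive m (v q) - wellPrimitive m (v p) := by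
    refine intervalIntegral.integral_eq_sub_of_hasDerivAt
      (f := fun x => wellPrimitive m (v x)) (fun x _ => ?_) (hprod.intervalIntegrable _ _)
    exact ((hasDerivAt_wellPrimitive m (v x)).comp x (hr.hasDerivAt x)).congr_deriv (by ring)
  have e2 : kinkCost (m - κ) ≤ wellPrimitive m (v q) - wellPrimitive m (v p) := by
    have h1 := wellPrimitive_monotone m hqs
    have h2 := wellPrimitive_monotone m hps
    rw [wellPrimitive_neg] at h2
    have h3 := le_wellPrimitive hs0 hs2
    have : kinkCost (m - κ) = 2 * (√2 / 3 * s ^ 3) := by unfold kinkCost; ring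
    linarith
  have e3 : ∫ x in (z - δ / 2)..(z + δ / 2), excess m ε v x ≤ ∫ x in p..q, excess m ε v x :=
    intervalIntegral.integral_mono_interval hp.2 (by linarith) hq.1
      (Eventually.of_forall fun x => excess_nonneg m hε v x) (hec.intervalIntegrable _ _)
  have e4 : (∫ x in p..q, excess m ε v x) + ∫ x in p..q, deriv v x * truncWell m (v x) / √2 ≤
      ∫ x in p..q, density μ ε v (deriv v) x := by
    rw [← intervalIntegral.integral_add (hec.intervalIntegrable _ _)
      (hprod.intervalIntegrable _ _)]
    refine intervalIntegral.integral_mono_on hpq ((hec.add hprod).intervalIntegrable _ _)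
      (hdc.intervalIntegrable _ _) fun x hx => ?_
    exact excess_add_le_density hε
      (hm x ⟨by linarith [hx.1, hp.1], by linarith [hx.2, hq.2]⟩)
  have e5 : ∫ x in p..q, density μ ε v (deriv v) x ≤
      ∫ x in (z - δ)..(z + δ), density μ ε v (deriv v) x :=
    intervalIntegral.integral_mono_interval hp.1 hpq hq.2
      (Eventually.of_forall fun x => density_nonneg μ hε v _ x) (hdc.intervalIntegrable _ _)
  linarith

lemma kinkCost_continuous : Continuous kinkCost := by
  unfold kinkCost; fun_prop

lemma kinkCost_monotone : Monotone kinkCost := fun x y hxy => by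
  unfold kinkCost
  have : √x ≤ √y := Real.sqrt_le_sqrt hxy
  gcongr

lemma posPart_uniformContinuous (h : Assumptions μ f ξ) : UniformContinuous (posPart μ) := by
  refine h.posPart_continuous.uniformContinuous_of_tendsto_cocompact (x := 0) ?_
  have hc : HasCompactSupport (posPart μ) :=
    HasCompactSupport.intro (isCompact_Icc (a := -ξ) (b := ξ)) fun x hx => h.posPart_of_le (by
      by_contra h'
      exact hx (abs_le.1 (not_le.1 h').le))
  exact hc.is_zero_at_infty

/-- Uniform lower bound for the energy of the transition layer of a minimiser. -/
lemma eventually_kinkCost_le (h : Assumptions μ f ξ) {a : ℝ} (ha : 0 < a) {γ δ₀ R : ℝ}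
    (hγ : 0 < γ) (hδ₀ : 0 < δ₀) (hR : 0 < R) :
    ∀ᶠ ε in 𝓝[>] (0 : ℝ), ∀ v z, RegMin μ f a ε v → v z = 0 →
      ∃ m, |m - posPart μ z| ≤ γ ∧
        kinkCost (posPart μ z) - γ + ∫ x in (z - ε * R)..(z + ε * R), excess m ε v x ≤
          ∫ x in (z - δ₀)..(z + δ₀), density μ ε v (deriv v) x := by
  obtain ⟨B, hB⟩ := exists_density_bound h ha.le
  have huc := (isCompact_Icc (a := (-1 : ℝ)) (b := μ 0)).uniformContinuousOn_of_continuous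
    kinkCost_continuous.continuousOn
  obtain ⟨κ₀, hκ₀, hkink⟩ := Metric.uniformContinuousOn_iff.1 huc γ hγ
  set κ := min (min (1 / 2) (κ₀ / 3)) γ
  have hκ : 0 < κ := by positivity
  have hκ1 : κ ≤ 1 / 2 := (min_le_left _ _).trans (min_le_left _ _)
  have hκ2 : κ ≤ κ₀ / 3 := (min_le_left _ _).trans (min_le_right _ _)
  have hκ3 : κ ≤ γ := min_le_right _ _
  obtain ⟨δ₁, hδ₁, hpc⟩ := Metric.uniformContinuous_iff.1 (posPart_uniformContinuous h) κ hκ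
  set δ := min δ₀ (δ₁ / 2)
  have hδ : 0 < δ := by positivity
  have hδ0 : δ ≤ δ₀ := min_le_left _ _
  have hδ1 : δ < δ₁ := (min_le_right _ _).trans_lt (by linarith)
  have t1 : Tendsto (fun ε : ℝ => 8 * ε * B) (𝓝[>] 0) (𝓝 0) := by
    have : Continuous fun ε : ℝ => 8 * ε * B := by fun_prop
    have h1 := this.tendsto 0
    simp only [mul_zero, zero_mul] at h1
    exact h1.mono_left nhdsWithin_le_nhds
  have t2 : Tendsto (fun ε : ℝ => ε * R) (𝓝[>] 0) (𝓝 0) := by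
    have : Continuous fun ε : ℝ => ε * R := by fun_prop
    have h1 := this.tendsto 0
    simp only [zero_mul] at h1
    exact h1.mono_left nhdsWithin_le_nhds
  filter_upwards [hB, t1.eventually (eventually_lt_nhds (by positivity : 0 < κ ^ 2 * δ)),
    t2.eventually (eventually_le_nhds (half_pos hδ)), self_mem_nhdsWithin] with
    ε hB h1 h2 hε v z hr hz
  have hε' : 0 < ε := hε
  obtain ⟨hpos, hneg⟩ := hr.sign_of_zero h ha hε' hz
  set p := posPart μ z
  have hp0 : 0 ≤ p := posPart_nonneg μ z
  have hpμ : p ≤ μ 0 := h.posPart_le z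
  set m := max (p - κ) 0
  have hmp : p - κ ≤ m := le_max_left _ _
  have hmp' : m ≤ p := max_le (by linarith) hp0
  have hm : ∀ x ∈ Icc (z - δ) (z + δ), m ≤ posPart μ x := by
    intro x hx
    have hd : dist x z < δ₁ := by
      rw [Real.dist_eq, abs_lt]; constructor <;> linarith [hx.1, hx.2]
    have := hpc hd
    rw [Real.dist_eq, abs_lt] at this
    exact max_le (by linarith [this.1]) (posPart_nonneg μ x)
  have key := hr.kinkCost_le h hε' hδ hκ (le_max_right _ _) hm hpos hneg (hB v hr) h1
  refine ⟨m, abs_le.2 ⟨by linarith, by linarith⟩, ?_⟩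
  have k1 : kinkCost p - γ ≤ kinkCost (m - κ) := by
    have hd := hkink p ⟨by linarith, hpμ⟩ (p - 2 * κ) ⟨by linarith, by linarith⟩ (by
      rw [Real.dist_eq, abs_lt]; constructor <;> linarith)
    rw [Real.dist_eq, abs_lt] at hd
    have := kinkCost_monotone (by linarith : p - 2 * κ ≤ m - κ)
    linarith [hd.2]
  have hεR : 0 < ε * R := by positivity
  have k2 : ∫ x in (z - ε * R)..(z + ε * R), excess m ε v x ≤
      ∫ x in (z - δ / 2)..(z + δ / 2), excess m ε v x :=
    intervalIntegral.integral_mono_interval (by linarith) (by linarith) (by linarith)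
      (Eventually.of_forall fun x => excess_nonneg m hε' v x)
      ((hr.excess_continuous m).intervalIntegrable _ _)
  have k3 : ∫ x in (z - δ)..(z + δ), density μ ε v (deriv v) x ≤
      ∫ x in (z - δ₀)..(z + δ₀), density μ ε v (deriv v) x :=
    intervalIntegral.integral_mono_interval (by linarith) (by linarith) (by linarith)
      (Eventually.of_forall fun x => density_nonneg μ hε' v _ x)
      ((hr.density_continuous h).intervalIntegrable _ _)
  linarith

end

section


variable {μ f : ℝ → ℝ} {ξ a ε : ℝ} {v : ℝ → ℝ}

lemma rpow_three_halves {m : ℝ} (hm : 0 ≤ m) : m ^ (3 / 2 : ℝ) = √m ^ 3 := by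
  rw [Real.sqrt_eq_rpow, ← Real.rpow_natCast, ← Real.rpow_mul hm]
  norm_num

lemma continuous_integral_weight_abs (h : Assumptions μ f ξ) :
    Continuous fun z : ℝ => ∫ t in 0..|z|, weight μ f t :=
  (intervalIntegral.continuous_primitive (weight_intervalIntegrable h) 0).comp continuous_abs

lemma integral_weight_of_ge (h : Assumptions μ f ξ) {z : ℝ} (hz : ξ ≤ z) :
    ∫ t in 0..z, weight μ f t = ∫ t in 0..ξ, weight μ f t := by
  rw [← intervalIntegral.integral_add_adjacent_intervals (weight_intervalIntegrable h 0 ξ)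
    (weight_intervalIntegrable h ξ z), add_eq_left]
  refine (intervalIntegral.integral_congr (g := fun _ => (0 : ℝ)) fun t ht => ?_).trans (by simp)
  rw [uIcc_of_le hz] at ht
  exact weight_eq_zero h (ht.1.trans (le_abs_self t))

lemma integral_weight_pos (h : Assumptions μ f ξ) {x y : ℝ} (hxy : x < y) (hx : 0 ≤ x)
    (hy : y ≤ ξ) : 0 < ∫ t in x..y, weight μ f t := by
  refine intervalIntegral.intervalIntegral_pos_of_pos_on (weight_intervalIntegrable h x y)
    (fun t ht => weight_pos h ?_ (by linarith [ht.1] : 0 < t).ne') hxy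
  rw [abs_of_pos (by linarith [ht.1])]
  linarith [ht.2]

/-- The zero of a minimiser is asymptotically in `[-ξ, ξ]`. -/
lemma eventually_abs_zero_le (h : Assumptions μ f ξ) {a : ℝ} (ha : 0 < a) {η : ℝ} (hη : 0 < η) :
    ∀ᶠ ε in 𝓝[>] (0 : ℝ), ∀ v z, RegMin μ f a ε v → v z = 0 → |z| ≤ ξ + η := by
  obtain ⟨C, ε₀, hε₀, -, -, -, hz⟩ := exists_zero_near h ha
  have ht : Tendsto (fun ε : ℝ => C * √ε) (𝓝[>] 0) (𝓝 0) := by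
    have : Continuous fun ε : ℝ => C * √ε := by fun_prop
    have h1 := this.tendsto 0
    simp only [Real.sqrt_zero, mul_zero] at h1
    exact h1.mono_left nhdsWithin_le_nhds
  filter_upwards [Ioo_mem_nhdsGT hε₀, ht.eventually (eventually_le_nhds hη)] with ε hε hC v z hr hvz
  obtain ⟨z', hz', hle⟩ := hz ε hε.1 hε.2 v hr
  rw [hr.eq_of_zero h ha hε.1 hz' hvz]
  linarith

lemma intervalIntegral_excess_nonneg (m : ℝ) (hε : 0 < ε) (v : ℝ → ℝ) {c d : ℝ} (hcd : c ≤ d) :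
    0 ≤ ∫ x in c..d, excess m ε v x :=
  intervalIntegral.integral_nonneg hcd fun x _ => excess_nonneg m hε v x

/-- If a centred kink is strictly favourable, the zero of the minimiser converges to the origin and
the energy concentrates there. -/
lemma eventually_centered (h : Assumptions μ f ξ) {a : ℝ} (ha : 0 < a)
    (hstrict : ∀ z, 0 < |z| →
      kinkCost (μ 0) < kinkCost (posPart μ z) + 2 * a * ∫ t in 0..|z|, weight μ f t)
    {η c R : ℝ} (hη : 0 < η) (hc : 0 < c) (hR : 0 < R) :
    ∀ᶠ ε in 𝓝[>] (0 : ℝ), ∀ v z, RegMin μ f a ε v → v z = 0 →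
      |z| < c ∧ (∫ x, density μ ε v (deriv v) x) - (∫ x in (z - c)..(z + c),
        density μ ε v (deriv v) x) ≤ η ∧
      ∃ m, |m - μ 0| ≤ η ∧ ∫ x in (z - ε * R)..(z + ε * R), excess m ε v x ≤ η := by
  have hnear : ∀ c : ℝ, 0 < c → ∀ᶠ ε in 𝓝[>] (0 : ℝ), ∀ v z, RegMin μ f a ε v → v z = 0 →
      |z| < c := by
    intro c hc
    let Ψ : ℝ → ℝ := fun z =>
      kinkCost (posPart μ z) + 2 * a * (∫ t in 0..|z|, weight μ f t) - kinkCost (μ 0)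
    have hΨ : Continuous Ψ := by
      have h1 := continuous_integral_weight_abs h
      have h2 := kinkCost_continuous.comp h.posPart_continuous
      exact (h2.add (h1.const_mul _)).sub continuous_const
    have hcpt : IsCompact ({z : ℝ | |z| ≤ ξ + 1} ∩ {z | c ≤ |z|}) := by
      have e : {z : ℝ | |z| ≤ ξ + 1} = Icc (-(ξ + 1)) (ξ + 1) := by ext z; simp [abs_le]
      rw [e]
      exact isCompact_Icc.inter_right (isClosed_le continuous_const continuous_abs)
    obtain ⟨γ, hγ, hgap⟩ : ∃ γ > 0, ∀ z, |z| ≤ ξ + 1 → c ≤ |z| → γ ≤ Ψ z := by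
      rcases ({z : ℝ | |z| ≤ ξ + 1} ∩ {z | c ≤ |z|}).eq_empty_or_nonempty with he | hne
      · refine ⟨1, one_pos, fun z h1 h2 => ?_⟩
        have : z ∈ ({z : ℝ | |z| ≤ ξ + 1} ∩ {z | c ≤ |z|}) := ⟨h1, h2⟩
        rw [he] at this
        exact this.elim
      · obtain ⟨p, hp, hmin⟩ := hcpt.exists_isMinOn hne hΨ.continuousOn
        refine ⟨Ψ p, ?_, fun z h1 h2 => hmin ⟨h1, h2⟩⟩
        have := hstrict p (hc.trans_le hp.2)
        simp only [Ψ]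
        linarith
    have hγ3 : 0 < γ / 3 := by positivity
    filter_upwards [eventually_abs_zero_le h ha one_pos, eventually_density_le h ha hγ3,
      eventually_kinkCost_le h ha hγ3 one_pos one_pos, self_mem_nhdsWithin] with
      ε h1 h2 h3 hε v z hr hz
    by_contra hcon
    have hε' : 0 < ε := hε
    have e1 := hgap z (h1 v z hr hz) (not_lt.1 hcon)
    have e2 := (h2 v z hr hz).1
    obtain ⟨m, -, e3⟩ := h3 v z hr hz
    have e4 := intervalIntegral_excess_nonneg m hε' v
      (by linarith : z - ε * 1 ≤ z + ε * 1)
    have e5 := hr.intervalIntegral_density_le h hε' (by linarith : z - 1 ≤ z + 1)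
    simp only [Ψ] at e1
    linarith
  have hη3 : 0 < η / 3 := by positivity
  have hcont : Continuous fun z => kinkCost (posPart μ z) :=
    kinkCost_continuous.comp h.posPart_continuous
  have hp0 : posPart μ 0 = μ 0 := max_eq_left h.mu_zero_pos.le
  obtain ⟨c₁, hc₁, hk⟩ := Metric.continuousAt_iff.1 (hcont.continuousAt (x := 0)) (η / 3) hη3
  obtain ⟨c₂, hc₂, hp⟩ := Metric.continuousAt_iff.1 (h.posPart_continuous.continuousAt (x := 0))
    (η / 3) hη3
  filter_upwards [hnear c hc, hnear c₁ hc₁, hnear c₂ hc₂, eventually_density_le h ha hη3,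
      eventually_kinkCost_le h ha hη3 hc hR, self_mem_nhdsWithin] with
      ε h0 h1 h2 h3 h4 hε v z hr hz
  have hε' : 0 < ε := hε
  have e1 := hk (by simpa [Real.dist_eq] using h1 v z hr hz : dist z 0 < c₁)
  have e2 := hp (by simpa [Real.dist_eq] using h2 v z hr hz : dist z 0 < c₂)
  rw [Real.dist_eq, hp0, abs_lt] at e1 e2
  have e3 := (h3 v z hr hz).1
  have e3' : 0 ≤ 2 * a * ∫ t in 0..|z|, weight μ f t :=
    mul_nonneg (by positivity) (intervalIntegral.integral_nonneg (abs_nonneg z)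
      fun t _ => weight_nonneg μ f t)
  obtain ⟨m, hm, e4⟩ := h4 v z hr hz
  have e5 := intervalIntegral_excess_nonneg m hε' v
    (by nlinarith : z - ε * R ≤ z + ε * R)
  have e6 := hr.intervalIntegral_density_le h hε' (by linarith : z - c ≤ z + c)
  refine ⟨h0 v z hr hz, by linarith, m, ?_, by linarith⟩
  rw [abs_le] at hm ⊢
  constructor <;> linarith [hm.1, hm.2]

/-- If a kink in `(-ξ, ξ)` is strictly unfavourable, the zero of the minimiser converges to the
boundary and the energy converges to zero. -/
lemma eventually_boundary (h : Assumptions μ f ξ) {a : ℝ} (ha : 0 < a)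
    (hstrict : ∀ z, |z| < ξ →
      2 * a * ((∫ t in 0..ξ, weight μ f t) - ∫ t in 0..|z|, weight μ f t) <
        kinkCost (posPart μ z))
    {η : ℝ} (hη : 0 < η) :
    ∀ᶠ ε in 𝓝[>] (0 : ℝ), ∀ v z, RegMin μ f a ε v → v z = 0 →
      |(|z| - ξ)| < η ∧ ∫ x, density μ ε v (deriv v) x ≤ η := by
  have hξ := h.xi_pos
  have hnear : ∀ c : ℝ, 0 < c → ∀ᶠ ε in 𝓝[>] (0 : ℝ), ∀ v z, RegMin μ f a ε v → v z = 0 →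
      |(|z| - ξ)| < c := by
    intro c hc
    let Ψ : ℝ → ℝ := fun z => kinkCost (posPart μ z) -
      2 * a * ((∫ t in 0..ξ, weight μ f t) - ∫ t in 0..|z|, weight μ f t)
    have hΨ : Continuous Ψ := by
      have h1 := continuous_integral_weight_abs h
      have h2 := kinkCost_continuous.comp h.posPart_continuous
      exact h2.sub ((continuous_const.sub h1).const_mul _)
    obtain ⟨γ, hγ, hgap⟩ : ∃ γ > 0, ∀ z, |z| ≤ ξ - c → γ ≤ Ψ z := by
      rcases (Icc (-(ξ - c)) (ξ - c)).eq_empty_or_nonempty with he | hne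
      · refine ⟨1, one_pos, fun z h1 => ?_⟩
        have : z ∈ Icc (-(ξ - c)) (ξ - c) := abs_le.1 h1
        rw [he] at this
        exact this.elim
      · obtain ⟨p, hp, hmin⟩ := isCompact_Icc.exists_isMinOn hne hΨ.continuousOn
        refine ⟨Ψ p, ?_, fun z h1 => hmin (abs_le.1 h1)⟩
        have := hstrict p ((abs_le.2 hp).trans_lt (by linarith))
        simp only [Ψ]
        linarith
    have hγ3 : 0 < γ / 3 := by positivity
    filter_upwards [eventually_abs_zero_le h ha (half_pos hc), eventually_density_le h ha hγ3,
      eventually_kinkCost_le h ha hγ3 one_pos one_pos, self_mem_nhdsWithin] with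
      ε h1 h2 h3 hε v z hr hz
    by_contra hcon
    have hε' : 0 < ε := hε
    have hzle : |z| ≤ ξ - c := by
      have e0 := h1 v z hr hz
      by_contra hlt
      exact hcon (abs_lt.2 ⟨by linarith, by linarith⟩)
    have e1 := hgap z hzle
    have e2 := (h2 v z hr hz).2
    obtain ⟨m, -, e3⟩ := h3 v z hr hz
    have e4 := intervalIntegral_excess_nonneg m hε' v
      (by linarith : z - ε * 1 ≤ z + ε * 1)
    have e5 := hr.intervalIntegral_density_le h hε' (by linarith : z - 1 ≤ z + 1)
    simp only [Ψ] at e1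
    linarith
  have hη2 : 0 < η / 2 := by positivity
  let Θ : ℝ → ℝ := fun r => 2 * a * ((∫ t in 0..ξ, weight μ f t) - ∫ t in 0..r, weight μ f t)
  have hΘ : Continuous Θ :=
    (continuous_const.sub
      (intervalIntegral.continuous_primitive (weight_intervalIntegrable h) 0)).const_mul _
  obtain ⟨c₁, hc₁, hk⟩ := Metric.continuousAt_iff.1 (hΘ.continuousAt (x := ξ)) (η / 2) hη2
  filter_upwards [hnear η hη, hnear c₁ hc₁, eventually_density_le h ha hη2] with
      ε h0 h1 h2 v z hr hz
  refine ⟨h0 v z hr hz, ?_⟩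
  have e1 := hk (by simpa [Real.dist_eq] using h1 v z hr hz : dist |z| ξ < c₁)
  have e2 := (h2 v z hr hz).2
  rw [Real.dist_eq, abs_lt] at e1
  have : Θ ξ = 0 := by simp [Θ]
  rw [this] at e1
  simp only [Θ] at e1
  linarith [e1.2]

/-- A function with Lipschitz constant of order `1 / ε` is small where its `L²` mean is small. -/
lemma abs_pow_three_le {p : ℝ → ℝ} {y L : ℝ} (hε : 0 < ε) (hL : 0 < L) (hp : Continuous p)
    (hlip : ∀ s ∈ Icc (y - ε) (y + ε), |p s - p y| ≤ L / ε * |s - y|) (hy : |p y| ≤ L) :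
    |p y| ^ 3 ≤ 4 * L * ((∫ s in (y - ε)..(y + ε), p s ^ 2) / ε) := by
  set c := |p y|
  have hc : 0 ≤ c := abs_nonneg _
  set r := c * ε / (2 * L)
  have hr : 0 ≤ r := by positivity
  have hrε : r ≤ ε := by
    simp only [r]; rw [div_le_iff₀ (by positivity)]; nlinarith
  have hp2 : Continuous fun s => p s ^ 2 := hp.pow 2
  have h1 : ∫ _ in (y - r)..(y + r), (c / 2) ^ 2 ≤ ∫ s in (y - r)..(y + r), p s ^ 2 := by
    refine intervalIntegral.integral_mono_on (by linarith) intervalIntegrable_const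
      (hp2.intervalIntegrable _ _) fun s hs => ?_
    have h2 := hlip s ⟨by linarith [hs.1], by linarith [hs.2]⟩
    have h3 : |s - y| ≤ r := abs_le.2 ⟨by linarith [hs.1], by linarith [hs.2]⟩
    have h4 : L / ε * |s - y| ≤ c / 2 := by
      calc L / ε * |s - y| ≤ L / ε * r := mul_le_mul_of_nonneg_left h3 (by positivity)
        _ = c / 2 := by simp only [r]; field_simp
    have h5 := abs_sub_abs_le_abs_sub (p y) (p s)
    rw [abs_sub_comm] at h5
    have h6 : c / 2 ≤ |p s| := by linarith
    rw [← sq_abs (p s)]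
    exact pow_le_pow_left₀ (by positivity) h6 2
  have h2 : ∫ s in (y - r)..(y + r), p s ^ 2 ≤ ∫ s in (y - ε)..(y + ε), p s ^ 2 :=
    intervalIntegral.integral_mono_interval (by linarith) (by linarith) (by linarith)
      (Eventually.of_forall fun s => sq_nonneg _) (hp2.intervalIntegrable _ _)
  rw [intervalIntegral.integral_const, smul_eq_mul] at h1
  have h3 := h1.trans h2
  rw [mul_div_assoc', le_div_iff₀ hε]
  have e : (y + r - (y - r)) * (c / 2) ^ 2 = c ^ 3 * ε / (4 * L) := by
    simp only [r]; field_simp; ring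
  rw [e, div_le_iff₀ (by positivity)] at h3
  linarith

lemma RegMin.deriv_lipschitz (hr : RegMin μ f a ε v) (hε : 0 < ε) {L : ℝ}
    (hL : ∀ x, |ε ^ 2 * force μ f a ε x (v x)| ≤ L) (s y : ℝ) :
    |ε * deriv v s - ε * deriv v y| ≤ L / ε * |s - y| := by
  have := Convex.norm_image_sub_le_of_norm_hasDerivWithin_le (f := fun x => ε * deriv v x)
    (f' := fun x => ε * force μ f a ε x (v x)) (C := L / ε) (s := univ) (x := y) (y := s)
    (fun x _ => ((hr.hasDerivAt_deriv x).const_mul ε).hasDerivWithinAt) (fun x _ => by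
      rw [Real.norm_eq_abs, le_div_iff₀ hε, ← abs_of_pos hε, ← abs_mul, abs_of_pos hε]
      have e : ε * force μ f a ε x (v x) * ε = ε ^ 2 * force μ f a ε x (v x) := by ring
      rw [e]; exact hL x) convex_univ (mem_univ _) (mem_univ _)
  simpa [Real.norm_eq_abs] using this

lemma RegMin.lipschitz (hr : RegMin μ f a ε v) (hε : 0 < ε) {L : ℝ}
    (hL : ∀ x, |ε * deriv v x| ≤ L) (s y : ℝ) : |v s - v y| ≤ L / ε * |s - y| := by
  have := Convex.norm_image_sub_le_of_norm_hasDerivWithin_le (f := v)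
    (f' := deriv v) (C := L / ε) (s := univ) (x := y) (y := s)
    (fun x _ => (hr.hasDerivAt x).hasDerivWithinAt) (fun x _ => by
      rw [Real.norm_eq_abs, le_div_iff₀ hε, ← abs_of_pos hε, ← abs_mul, mul_comm]
      exact hL x) convex_univ (mem_univ _) (mem_univ _)
  simpa [Real.norm_eq_abs] using this

lemma abs_posPart_sub_le (h : Assumptions μ f ξ) {K R : ℝ}
    (hK : ∀ x, |x| ≤ R → |deriv μ x| ≤ K) {s y : ℝ} (hs : |s| ≤ R) (hy : |y| ≤ R) :
    |posPart μ s - posPart μ y| ≤ K * |s - y| := by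
  refine (abs_max_sub_max_zero_le _ _).trans ?_
  have := Convex.norm_image_sub_le_of_norm_hasDerivWithin_le (f := μ)
    (f' := deriv μ) (C := K) (s := Icc (-R) R) (x := y) (y := s)
    (fun x _ => ((h.mu_contDiff.differentiable (by norm_num)) x).hasDerivAt.hasDerivWithinAt)
    (fun x hx => hK x (abs_le.2 hx)) (convex_Icc _ _) (abs_le.1 hy) (abs_le.1 hs)
  simpa [Real.norm_eq_abs] using this

/-- Where the local energy is small, the minimiser is close to the Thomas–Fermi profile. -/
lemma exists_local_smallness (h : Assumptions μ f ξ) {a : ℝ} (ha : 0 ≤ a) (R : ℝ) {C : ℝ}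
    (hC : 0 < C) :
    ∃ η > 0, ∀ ε v, 0 < ε → ε ≤ 1 → RegMin μ f a ε v → ∀ y, |y| ≤ R →
      ∫ x in (y - ε)..(y + ε), density μ ε v (deriv v) x ≤ η →
      |ε * deriv v y| ≤ C ∧ |(|v y| - √(μ y))| ≤ C := by
  obtain ⟨M, L, hM, hL, hbd⟩ := exists_uniform_bounds h ha
  obtain ⟨K, hK0, hK⟩ := h.exists_deriv_bound (R + 1)
  have hμ0 := h.mu_zero_pos
  set L' := 2 * M * L + K + M ^ 2 + μ 0
  have hL' : 0 < L' := by positivity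
  refine ⟨min (C ^ 3 / (8 * L)) (C ^ 6 / (16 * L')), by positivity, fun ε v hε hε1 hr y hy hint => ?_⟩
  obtain ⟨b1, b2, b3⟩ := hbd ε v hε hε1 hr
  have hint1 := hint.trans (min_le_left _ _)
  have hint2 := hint.trans (min_le_right _ _)
  rw [le_div_iff₀ (by positivity)] at hint1 hint2
  have hyε : y - ε ≤ y + ε := by linarith
  have hdi := (hr.density_continuous h).intervalIntegrable (μ := volume) (y - ε) (y + ε)
  have hvc := hr.continuous
  have hdc := hr.continuous_deriv
  have hpc := h.posPart_continuous
  constructor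
  · have k := abs_pow_three_le (p := fun x => ε * deriv v x) (y := y) hε hL (by fun_prop)
      (fun s _ => hr.deriv_lipschitz hε b3 s y) (b2 y)
    have k2 : (∫ s in (y - ε)..(y + ε), (ε * deriv v s) ^ 2) / ε ≤
        2 * ∫ x in (y - ε)..(y + ε), density μ ε v (deriv v) x := by
      rw [← intervalIntegral.integral_div, ← intervalIntegral.integral_const_mul]
      refine intervalIntegral.integral_mono_on hyε
        (Continuous.intervalIntegrable (by fun_prop) _ _) (hdi.const_mul 2) fun s _ => ?_
      have e : (ε * deriv v s) ^ 2 / ε = 2 * (ε / 2 * deriv v s ^ 2) := by field_simp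
      rw [e, density]
      have : 0 ≤ well μ s (v s) / ε := div_nonneg (well_nonneg _ _ _) hε.le
      linarith
    have k3 := mul_le_mul_of_nonneg_left k2 (by positivity : 0 ≤ 4 * L)
    have k4 : |ε * deriv v y| ^ 3 ≤ C ^ 3 := by linarith
    exact le_of_pow_le_pow_left₀ (by norm_num) hC.le k4
  · have hp0 : ∀ x, |posPart μ x| ≤ μ 0 := fun x => by
      rw [abs_of_nonneg (posPart_nonneg μ x)]; exact h.posPart_le x
    have k := abs_pow_three_le (p := fun x => v x ^ 2 - posPart μ x) (y := y) hε hL' (by fun_prop)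
      (fun s hs => by
        have c1 := hr.lipschitz hε b2 s y
        have c2 := abs_posPart_sub_le h hK (s := s) (y := y)
          (abs_le.2 ⟨by linarith [(abs_le.1 hy).1, hs.1], by linarith [(abs_le.1 hy).2, hs.2]⟩)
          (by linarith)
        have c3 : |v s ^ 2 - v y ^ 2| ≤ 2 * M * (L / ε * |s - y|) := by
          have e : v s ^ 2 - v y ^ 2 = (v s + v y) * (v s - v y) := by ring
          rw [e, abs_mul]
          exact mul_le_mul ((abs_add_le _ _).trans (by linarith [b1 s, b1 y])) c1 (abs_nonneg _)
            (by positivity)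
        have e : v s ^ 2 - posPart μ s - (v y ^ 2 - posPart μ y) =
          (v s ^ 2 - v y ^ 2) - (posPart μ s - posPart μ y) := by ring
        simp only [e]
        refine (abs_sub _ _).trans ?_
        have c4 : K * |s - y| ≤ (K + M ^ 2 + μ 0) / ε * |s - y| := by
          refine mul_le_mul_of_nonneg_right ?_ (abs_nonneg _)
          rw [le_div_iff₀ hε]
          nlinarith [sq_nonneg M]
        have e2 : L' / ε * |s - y| = 2 * M * (L / ε * |s - y|) +
          (K + M ^ 2 + μ 0) / ε * |s - y| := by simp only [L']; ring
        linarith)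
      (by
        refine (abs_sub _ _).trans ?_
        have : |v y ^ 2| ≤ M ^ 2 := by
          rw [abs_pow]; exact pow_le_pow_left₀ (abs_nonneg _) (b1 y) 2
        have h3 : 0 ≤ 2 * M * L := by positivity
        linarith [hp0 y])
    have k2 : (∫ s in (y - ε)..(y + ε), (v s ^ 2 - posPart μ s) ^ 2) / ε ≤
        4 * ∫ x in (y - ε)..(y + ε), density μ ε v (deriv v) x := by
      rw [← intervalIntegral.integral_div, ← intervalIntegral.integral_const_mul]
      refine intervalIntegral.integral_mono_on hyε
        (Continuous.intervalIntegrable (by fun_prop) _ _) (hdi.const_mul 4) fun s _ => ?_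
      have c1 := div_le_div_of_nonneg_right (well_ge μ s (v s)) hε.le
      have e : (v s ^ 2 - posPart μ s) ^ 2 / ε = 4 * ((v s ^ 2 - posPart μ s) ^ 2 / 4 / ε) := by
        ring
      rw [e, density]
      have : 0 ≤ ε / 2 * deriv v s ^ 2 := by positivity
      linarith
    have k3 := mul_le_mul_of_nonneg_left k2 (by positivity : 0 ≤ 4 * L')
    have k4 : |v y ^ 2 - posPart μ y| ^ 3 ≤ C ^ 6 := by linarith
    have k5 : |v y ^ 2 - posPart μ y| ≤ C ^ 2 :=
      le_of_pow_le_pow_left₀ (n := 3) (by norm_num) (by positivity) (by rw [← pow_mul]; exact k4)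
    have hs := Real.sqrt_nonneg (μ y)
    have hsq : √(μ y) ^ 2 = posPart μ y := by
      rw [← sqrt_posPart]; exact Real.sq_sqrt (posPart_nonneg μ y)
    rw [← hsq, ← sq_abs (v y)] at k5
    have hv0 := abs_nonneg (v y)
    set t := |v y|
    set s := √(μ y)
    have k6 : |t - s| ^ 2 ≤ C ^ 2 := by
      have e : t ^ 2 - s ^ 2 = (t + s) * (t - s) := by ring
      rw [e, abs_mul, abs_of_nonneg (by positivity : 0 ≤ t + s)] at k5
      have : |t - s| ≤ t + s := abs_le.2 ⟨by linarith, by linarith⟩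
      nlinarith [abs_nonneg (t - s)]
    exact le_of_pow_le_pow_left₀ (by norm_num) hC.le k6

end

section


variable {μ f : ℝ → ℝ} {ξ a ε : ℝ} {v : ℝ → ℝ}

lemma tendstoLocallyUniformly_of_eventually_forall {F : ℝ → ℝ → ℝ} {U : ℝ → ℝ} {l : Filter ℝ}
    (h : ∀ R C : ℝ, 0 < R → 0 < C → ∀ᶠ ε in l, ∀ s, |s| ≤ R → |F ε s - U s| ≤ C) :
    TendstoLocallyUniformly F U l := by
  rw [Metric.tendstoLocallyUniformly_iff]
  intro c hc x
  refine ⟨Metric.ball x 1, Metric.ball_mem_nhds x one_pos, ?_⟩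
  filter_upwards [h (|x| + 1) (c / 2) (by positivity) (by positivity)] with ε hε y hy
  rw [Metric.mem_ball, Real.dist_eq] at hy
  have := hε y (by linarith [abs_sub_abs_le_abs_sub y x])
  rw [dist_comm, Real.dist_eq]
  linarith

/-- A criterion for `C¹_loc` convergence of blow-ups. -/
lemma tendstoC1Loc_of_blowup {v : ℝ → ℝ → ℝ} {y : ℝ → ℝ} {U U' : ℝ → ℝ}
    (hU : ∀ s, HasDerivAt U (U' s) s) (hU' : Continuous U')
    (hreg : ∀ᶠ ε in 𝓝[>] (0 : ℝ), RegMin μ f a ε (v ε))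
    (hlim : ∀ R C : ℝ, 0 < R → 0 < C → ∀ᶠ ε in 𝓝[>] (0 : ℝ), ∀ s, |s| ≤ R →
      |v ε (y ε + ε * s) - U s| ≤ C ∧ |ε * deriv (v ε) (y ε + ε * s) - U' s| ≤ C) :
    TendstoC1Loc (fun ε s => v ε (y ε + ε * s)) U := by
  have hdU : deriv U = U' := funext fun s => (hU s).deriv
  refine ⟨contDiff_one_iff_deriv.2 ⟨fun s => (hU s).differentiableAt, hdU ▸ hU'⟩, ?_,
    tendstoLocallyUniformly_of_eventually_forall fun R C hR hC =>
      (hlim R C hR hC).mono fun ε h s hs => (h s hs).1,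
    tendstoLocallyUniformly_of_eventually_forall fun R C hR hC => ?_⟩
  · filter_upwards [hreg] with ε hr
    exact hr.contDiff.comp (contDiff_const.add (contDiff_const.mul contDiff_id))
  · filter_upwards [hreg, hlim R C hR hC] with ε hr h s hs
    have hd : HasDerivAt (fun s => v ε (y ε + ε * s)) (ε * deriv (v ε) (y ε + ε * s)) s :=
      ((hr.hasDerivAt (y ε + ε * s)).comp s
        (((hasDerivAt_id s).const_mul ε).const_add (y ε))).congr_deriv (by ring)
    rw [hd.deriv, hdU]
    exact (h s hs).2

lemma tendsto_mul_const_nhdsGT (R : ℝ) : Tendsto (fun ε : ℝ => ε * R) (𝓝[>] 0) (𝓝 0) := by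
  have hc : Continuous fun ε : ℝ => ε * R := by fun_prop
  have h1 := hc.tendsto 0
  simp only [zero_mul] at h1
  exact h1.mono_left nhdsWithin_le_nhds

lemma abs_mul_le_of_abs_le {ε s R : ℝ} (hε : 0 < ε) (hs : |s| ≤ R) : |ε * s| ≤ ε * R := by
  rw [abs_mul, abs_of_pos hε]; exact mul_le_mul_of_nonneg_left hs hε.le

/-- Blow-ups at a point where the local energy vanishes in the limit. -/
lemma tendstoC1Loc_const {v : ℝ → ℝ → ℝ} (h : Assumptions μ f ξ) (ha : 0 ≤ a) {x c : ℝ}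
    (hreg : ∀ᶠ ε in 𝓝[>] (0 : ℝ), RegMin μ f a ε (v ε))
    (hsmall : ∀ η R : ℝ, 0 < η → 0 < R → ∀ᶠ ε in 𝓝[>] (0 : ℝ), ∀ s, |s| ≤ R →
      ∫ t in (x + ε * s - ε)..(x + ε * s + ε), density μ ε (v ε) (deriv (v ε)) t ≤ η)
    (hsign : ∀ R : ℝ, 0 < R → ∀ᶠ ε in 𝓝[>] (0 : ℝ), ∀ s, |s| ≤ R →
      |v ε (x + ε * s) - c| = |(|v ε (x + ε * s)| - √(μ x))|) :
    TendstoC1Loc (fun ε s => v ε (x + ε * s)) (fun _ => c) := by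
  refine tendstoC1Loc_of_blowup (U' := fun _ => 0) (fun s => hasDerivAt_const s c)
    continuous_const hreg fun R C hR hC => ?_
  obtain ⟨η, hη, hloc⟩ := exists_local_smallness h ha (|x| + 1) (half_pos hC)
  have hcont : Continuous fun y => √(μ y) := Real.continuous_sqrt.comp h.mu_continuous
  obtain ⟨d, hd, hsq⟩ := Metric.continuousAt_iff.1 (hcont.continuousAt (x := x)) (C / 2)
    (half_pos hC)
  filter_upwards [hreg, hsmall η R hη hR, hsign R hR, Ioc_mem_nhdsGT (zero_lt_one' ℝ),
    (tendsto_mul_const_nhdsGT R).eventually (eventually_lt_nhds hd),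
    (tendsto_mul_const_nhdsGT R).eventually (eventually_lt_nhds one_pos)] with
    ε hr h1 h2 hε h3 h4 s hs
  have hsR := abs_mul_le_of_abs_le hε.1 hs
  have hy : |x + ε * s| ≤ |x| + 1 := (abs_add_le _ _).trans (by linarith)
  obtain ⟨e1, e2⟩ := hloc ε (v ε) hε.1 hε.2 hr _ hy (h1 s hs)
  have e3 := hsq (by
    rw [Real.dist_eq, add_sub_cancel_left]; linarith : dist (x + ε * s) x < d)
  rw [Real.dist_eq] at e3
  refine ⟨?_, by rw [sub_zero]; linarith⟩
  rw [h2 s hs]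
  have := abs_sub_le |v ε (x + ε * s)| √(μ (x + ε * s)) √(μ x)
  linarith

lemma RegMin.local_add_le (hr : RegMin μ f a ε v) (h : Assumptions μ f ξ) (hε : 0 < ε)
    {p q c d : ℝ} (hpq : p ≤ q) (hcd : c ≤ d) (hdisj : q ≤ c ∨ d ≤ p) :
    (∫ x in p..q, density μ ε v (deriv v) x) + ∫ x in c..d, density μ ε v (deriv v) x ≤
      ∫ x, density μ ε v (deriv v) x := by
  have hi := fun s t => (hr.density_continuous h).intervalIntegrable (μ := volume) s t
  have hnn : ∀ s t, s ≤ t → 0 ≤ ∫ x in s..t, density μ ε v (deriv v) x := fun s t hst =>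
    intervalIntegral.integral_nonneg hst fun x _ => density_nonneg μ hε v _ x
  rcases hdisj with h1 | h1
  · have e1 := intervalIntegral.integral_add_adjacent_intervals (hi p q) (hi q c)
    have e2 := intervalIntegral.integral_add_adjacent_intervals (hi p c) (hi c d)
    have e3 := hr.intervalIntegral_density_le h hε (by linarith : p ≤ d)
    linarith [hnn q c h1]
  · have e1 := intervalIntegral.integral_add_adjacent_intervals (hi c d) (hi d p)
    have e2 := intervalIntegral.integral_add_adjacent_intervals (hi c p) (hi p q)
    have e3 := hr.intervalIntegral_density_le h hε (by linarith : c ≤ q)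
    linarith [hnn d p h1]

/-- Where the local excess is small, the minimiser almost solves the first-order kink equation. -/
lemma exists_excess_smallness (h : Assumptions μ f ξ) {a : ℝ} (ha : 0 ≤ a) {C : ℝ} (hC : 0 < C) :
    ∃ η > 0, ∀ ε v, 0 < ε → ε ≤ 1 → RegMin μ f a ε v → ∀ m y, m ≤ μ 0 + 1 →
      ∫ x in (y - ε)..(y + ε), excess m ε v x ≤ η →
      |ε * deriv v y - truncWell m (v y) / √2| ≤ C := by
  obtain ⟨M, L, hM, hL, hbd⟩ := exists_uniform_bounds h ha
  have hμ0 := h.mu_zero_pos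
  set L' := L + 2 * M * L + (μ 0 + 1)
  have hL' : 0 < L' := by positivity
  have h2 : 1 ≤ √(2 : ℝ) := Real.one_le_sqrt.2 (by norm_num)
  refine ⟨C ^ 3 / (8 * L'), by positivity, fun ε v hε hε1 hr m y hm hint => ?_⟩
  obtain ⟨b1, b2, b3⟩ := hbd ε v hε hε1 hr
  rw [le_div_iff₀ (by positivity)] at hint
  have hdc := hr.continuous_deriv
  have htc := (truncWell_continuous m).comp hr.continuous
  have k := abs_pow_three_le (p := fun x => ε * deriv v x - truncWell m (v x) / √2) (y := y) hε hL'
    ((hdc.const_mul ε).sub (htc.div_const _))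
    (fun s _ => by
      have c1 := hr.deriv_lipschitz hε b3 s y
      have c2 := hr.lipschitz hε b2 s y
      have c3 := truncWell_lipschitz m (b1 s) (b1 y)
      have c4 : |truncWell m (v s) / √2 - truncWell m (v y) / √2| ≤ 2 * M * (L / ε * |s - y|) := by
        rw [← sub_div, abs_div, abs_of_pos (by linarith : (0 : ℝ) < √2)]
        refine (div_le_self (abs_nonneg _) h2).trans (c3.trans ?_)
        exact mul_le_mul_of_nonneg_left c2 (by positivity)
      have e : ε * deriv v s - truncWell m (v s) / √2 -
          (ε * deriv v y - truncWell m (v y) / √2) = (ε * deriv v s - ε * deriv v y) -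
          (truncWell m (v s) / √2 - truncWell m (v y) / √2) := by ring
      simp only [e]
      refine (abs_sub _ _).trans ?_
      have c5 : 0 ≤ (μ 0 + 1) / ε * |s - y| := by positivity
      have e2 : L' / ε * |s - y| = L / ε * |s - y| + 2 * M * (L / ε * |s - y|) +
        (μ 0 + 1) / ε * |s - y| := by simp only [L']; ring
      linarith)
    (by
      refine (abs_sub _ _).trans ?_
      have c1 : |truncWell m (v y) / √2| ≤ μ 0 + 1 := by
        rw [abs_div, abs_of_pos (by linarith : (0 : ℝ) < √2),
          abs_of_nonneg (truncWell_nonneg _ _)]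
        refine (div_le_self (truncWell_nonneg _ _) h2).trans (max_le ?_ (by linarith))
        linarith [sq_nonneg (v y)]
      have c2 : 0 ≤ 2 * M * L := by positivity
      linarith [b2 y])
  have k2 : (∫ s in (y - ε)..(y + ε), (ε * deriv v s - truncWell m (v s) / √2) ^ 2) / ε =
      2 * ∫ x in (y - ε)..(y + ε), excess m ε v x := by
    rw [← intervalIntegral.integral_div, ← intervalIntegral.integral_const_mul]
    congr 1; ext x
    simp only [excess]
    field_simp
  rw [k2] at k
  have k4 : |ε * deriv v y - truncWell m (v y) / √2| ^ 3 ≤ C ^ 3 := by linarith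
  exact le_of_pow_le_pow_left₀ (by norm_num) hC.le k4

lemma gronwall_half {m M R C : ℝ} (hM : 0 < M) (hC : 0 ≤ C) {V V' U U' : ℝ → ℝ}
    (hV : ∀ s, HasDerivAt V (V' s) s) (hU : ∀ s, HasDerivAt U (U' s) s) (h0 : V 0 = U 0)
    (hVM : ∀ s, |V s| ≤ M) (hUM : ∀ s, |U s| ≤ M)
    (hVC : ∀ s, |s| ≤ R → |V' s - truncWell m (V s) / √2| ≤ C)
    (hUC : ∀ s, U' s = truncWell m (U s) / √2) {s : ℝ} (hs0 : 0 ≤ s) (hsR : s ≤ R) :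
    |V s - U s| ≤ C * (Real.exp (2 * M * R) / (2 * M)) := by
  let K : NNReal := ⟨2 * M, by positivity⟩
  have hK : (K : ℝ) = 2 * M := rfl
  have h2 : 1 ≤ √(2 : ℝ) := Real.one_le_sqrt.2 (by norm_num)
  have key := dist_le_of_approx_trajectories_ODE_of_mem (v := fun _ u => truncWell m u / √2)
    (s := fun _ => {u | |u| ≤ M}) (K := K) (f := V) (g := U) (f' := V') (g' := U') (a := 0) (b := R)
    (εf := C) (εg := 0) (δ := 0)
    (fun t _ => LipschitzOnWith.of_dist_le_mul fun u hu w hw => by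
      rw [Real.dist_eq, Real.dist_eq, ← sub_div, abs_div,
        abs_of_pos (by linarith : (0 : ℝ) < √2), hK]
      exact (div_le_self (abs_nonneg _) h2).trans (truncWell_lipschitz m hu hw))
    (fun t _ => (hV t).continuousAt.continuousWithinAt)
    (fun t _ => (hV t).hasDerivWithinAt)
    (fun t ht => by
      rw [Real.dist_eq]
      exact hVC t (by rw [abs_of_nonneg ht.1]; exact ht.2.le))
    (fun t _ => hVM t)
    (fun t _ => (hU t).continuousAt.continuousWithinAt)
    (fun t _ => (hU t).hasDerivWithinAt)
    (fun t _ => by rw [hUC, dist_self]) (fun t _ => hUM t) (by rw [h0, dist_self]) s ⟨hs0, hsR⟩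
  rw [Real.dist_eq, gronwallBound_of_K_ne_0 (by rw [hK]; positivity), hK] at key
  refine key.trans ?_
  simp only [zero_mul, zero_add, add_zero, sub_zero]
  rw [div_mul_eq_mul_div, mul_div_assoc]
  refine mul_le_mul_of_nonneg_left (div_le_div_of_nonneg_right ?_ (by positivity)) hC
  have : Real.exp (2 * M * s) ≤ Real.exp (2 * M * R) := by gcongr
  linarith

lemma gronwall_kink {m M R C : ℝ} (hM : 0 < M) (hC : 0 ≤ C) {V V' U U' : ℝ → ℝ}
    (hV : ∀ s, HasDerivAt V (V' s) s) (hU : ∀ s, HasDerivAt U (U' s) s) (h0 : V 0 = U 0)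
    (hVM : ∀ s, |V s| ≤ M) (hUM : ∀ s, |U s| ≤ M)
    (hVC : ∀ s, |s| ≤ R → |V' s - truncWell m (V s) / √2| ≤ C)
    (hUC : ∀ s, U' s = truncWell m (U s) / √2) {s : ℝ} (hsR : |s| ≤ R) :
    |V s - U s| ≤ C * (Real.exp (2 * M * R) / (2 * M)) := by
  rcases le_total 0 s with hs | hs
  · exact gronwall_half hM hC hV hU h0 hVM hUM hVC hUC hs ((le_abs_self s).trans hsR)
  · have hneg : ∀ {W W' : ℝ → ℝ}, (∀ s, HasDerivAt W (W' s) s) →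
        ∀ s, HasDerivAt (fun s => -W (-s)) (W' (-s)) s := fun {W W'} hW s =>
      ((hW (-s)).comp s (hasDerivAt_neg s)).neg.congr_deriv (by ring)
    have := gronwall_half (V := fun s => -V (-s)) (V' := fun s => V' (-s)) (U := fun s => -U (-s))
      (U' := fun s => U' (-s)) (R := R) hM hC (hneg hV) (hneg hU) (by simp [h0])
      (fun s => by simpa using hVM (-s)) (fun s => by simpa using hUM (-s))
      (fun s hs => by
        rw [truncWell_neg]; exact hVC (-s) (by rwa [abs_neg]))
      (fun s => by rw [truncWell_neg]; exact hUC (-s)) (s := -s) (by linarith)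
      ((neg_le_abs s).trans hsR)
    simp only [neg_neg] at this
    have e : |V s - U s| = |-V s - -U s| := by rw [← abs_neg]; congr 1; ring
    rw [e]
    exact this

/-- The heteroclinic solution. -/
lemma hasDerivAt_heteroclinic {m : ℝ} (hm : 0 < m) (s : ℝ) :
    HasDerivAt (fun s => √m * Real.tanh (s * √(m / 2)))
      (truncWell m (√m * Real.tanh (s * √(m / 2))) / √2) s := by
  have h1 := ((hasDerivAt_tanh (s * √(m / 2))).comp s
    ((hasDerivAt_id s).mul_const √(m / 2))).const_mul √m
  refine h1.congr_deriv ?_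
  set T := Real.tanh (s * √(m / 2))
  have hT : T ^ 2 ≤ 1 := tanh_sq_le_one _
  have hs : √m ^ 2 = m := Real.sq_sqrt hm.le
  have e : truncWell m (√m * T) = m * (1 - T ^ 2) := by
    rw [truncWell, mul_pow, hs, max_eq_left (by nlinarith)]; ring
  rw [e, Real.sqrt_div hm.le]
  nth_rewrite 3 [← hs]
  ring

lemma heteroclinic_abs_le {m : ℝ} (s : ℝ) : |√m * Real.tanh (s * √(m / 2))| ≤ √m := by
  rw [abs_mul, abs_of_nonneg (Real.sqrt_nonneg m)]
  exact mul_le_of_le_one_right (Real.sqrt_nonneg m) (Real.abs_tanh_lt_one _).le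

/-- Blow-ups at the zero converge to the heteroclinic solution. -/
lemma tendstoC1Loc_kink (h : Assumptions μ f ξ) (ha : 0 ≤ a) {v : ℝ → ℝ → ℝ} {z : ℝ → ℝ}
    (hreg : ∀ᶠ ε in 𝓝[>] (0 : ℝ), RegMin μ f a ε (v ε))
    (hz : ∀ᶠ ε in 𝓝[>] (0 : ℝ), v ε (z ε) = 0)
    (hex : ∀ η R : ℝ, 0 < η → 0 < R → ∀ᶠ ε in 𝓝[>] (0 : ℝ), ∃ m, |m - μ 0| ≤ η ∧
      ∫ x in (z ε - ε * R)..(z ε + ε * R), excess m ε (v ε) x ≤ η) :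
    TendstoC1Loc (fun ε s => v ε (z ε + ε * s))
      (fun s => √(μ 0) * Real.tanh (s * √(μ 0 / 2))) := by
  have hμ0 := h.mu_zero_pos
  obtain ⟨M₀, _, hM₀, _, hbd⟩ := exists_uniform_bounds h ha
  set M := M₀ + √(μ 0)
  have hM : 0 < M := by positivity
  have h2 : 1 ≤ √(2 : ℝ) := Real.one_le_sqrt.2 (by norm_num)
  set U : ℝ → ℝ := fun s => √(μ 0) * Real.tanh (s * √(μ 0 / 2))
  have hU : ∀ s, HasDerivAt U (truncWell (μ 0) (U s) / √2) s := hasDerivAt_heteroclinic hμ0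
  have hUc : Continuous U := continuous_iff_continuousAt.2 fun s => (hU s).continuousAt
  refine tendstoC1Loc_of_blowup hU
    (((truncWell_continuous _).comp hUc).div_const _) hreg fun R C hR hC => ?_
  set A := Real.exp (2 * M * R) / (2 * M)
  have hA : 0 < A := by positivity
  set D := C / (A + 1 + 2 * M * A)
  have hD : 0 < D := by positivity
  have hDC : D * (A + 1 + 2 * M * A) = C := by simp only [D]; field_simp
  obtain ⟨η, hη, hloc⟩ := exists_excess_smallness h ha (half_pos hD)
  have hη' : 0 < min (min η 1) (D / 2) := by positivity
  filter_upwards [hreg, hz, hex _ (R + 1) hη' (by linarith), Ioc_mem_nhdsGT (zero_lt_one' ℝ)]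
    with ε hr hz hex hε
  obtain ⟨m, hm, hint⟩ := hex
  have hm1 : |m - μ 0| ≤ 1 := hm.trans ((min_le_left _ _).trans (min_le_right _ _))
  have hm2 : |m - μ 0| ≤ D / 2 := hm.trans (min_le_right _ _)
  obtain ⟨b1, -, -⟩ := hbd ε (v ε) hε.1 hε.2 hr
  have hε0 : 0 < ε := hε.1
  set V : ℝ → ℝ := fun s => v ε (z ε + ε * s)
  set V' : ℝ → ℝ := fun s => ε * deriv (v ε) (z ε + ε * s)
  have hV : ∀ s, HasDerivAt V (V' s) s := fun s =>
    ((hr.hasDerivAt (z ε + ε * s)).comp s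
      (((hasDerivAt_id s).const_mul ε).const_add (z ε))).congr_deriv (by simp only [V']; ring)
  have hs0 := Real.sqrt_nonneg (μ 0)
  have hVM : ∀ s, |V s| ≤ M := fun s => (b1 _).trans (by simp only [M]; linarith)
  have hUM : ∀ s, |U s| ≤ M := fun s => (heteroclinic_abs_le s).trans (by simp only [M]; linarith)
  have hVC : ∀ s, |s| ≤ R → |V' s - truncWell (μ 0) (V s) / √2| ≤ D := by
    intro s hs
    have hsR := abs_le.1 (abs_mul_le_of_abs_le hε0 hs)
    have e1 : ∫ x in (z ε + ε * s - ε)..(z ε + ε * s + ε), excess m ε (v ε) x ≤ η := by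
      refine le_trans (intervalIntegral.integral_mono_interval (by linarith [hsR.1]) (by linarith)
        (by linarith [hsR.2]) (Eventually.of_forall fun x => excess_nonneg m hε0 (v ε) x)
        ((hr.excess_continuous m).intervalIntegrable _ _))
        (hint.trans ((min_le_left _ _).trans (min_le_left _ _)))
    have e2 := hloc ε (v ε) hε0 hε.2 hr m _ (by linarith [(abs_le.1 hm1).2]) e1
    have e3 : |truncWell m (V s) / √2 - truncWell (μ 0) (V s) / √2| ≤ D / 2 := by
      rw [← sub_div, abs_div, abs_of_pos (by linarith : (0 : ℝ) < √2)]
      exact (div_le_self (abs_nonneg _) h2).trans ((truncWell_sub_le _ _ _).trans hm2)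
    have := abs_sub_le (V' s) (truncWell m (V s) / √2) (truncWell (μ 0) (V s) / √2)
    have e4 : |V' s - truncWell m (V s) / √2| ≤ D / 2 := e2
    linarith
  intro s hs
  have e1 : |V s - U s| ≤ D * A :=
    gronwall_kink hM hD.le hV hU (by simp [V, U, hz]) hVM hUM hVC (fun _ => rfl) hs
  have hDA : 0 ≤ D * A := by positivity
  have hDMA : 0 ≤ D * (2 * M * A) := by positivity
  have hexp : D * (A + 1 + 2 * M * A) = D * A + D + D * (2 * M * A) := by ring
  refine ⟨by linarith, ?_⟩
  have e2 : |truncWell (μ 0) (V s) / √2 - truncWell (μ 0) (U s) / √2| ≤ D * (2 * M * A) := by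
    rw [← sub_div, abs_div, abs_of_pos (by linarith : (0 : ℝ) < √2)]
    refine (div_le_self (abs_nonneg _) h2).trans ((truncWell_lipschitz _ (hVM s) (hUM s)).trans ?_)
    calc 2 * M * |V s - U s| ≤ 2 * M * (D * A) := mul_le_mul_of_nonneg_left e1 (by positivity)
      _ = _ := by ring
  have := abs_sub_le (V' s) (truncWell (μ 0) (V s) / √2) (truncWell (μ 0) (U s) / √2)
  have e3 := hVC s hs
  linarith

end

section


variable {μ f : ℝ → ℝ} {ξ a ε : ℝ} {v : ℝ → ℝ}

lemma Assumptions.mu_nonneg (h : Assumptions μ f ξ) {x : ℝ} (hx : |x| ≤ ξ) : 0 ≤ μ x := by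
  have := h.mu_le_of_abs_le (x := x) (y := ξ) (by rwa [abs_of_pos h.xi_pos])
  rwa [h.mu_xi] at this

lemma integral_weight_neg_zero (h : Assumptions μ f ξ) (r : ℝ) :
    ∫ t in (-r)..0, |f t| * √(μ t) = ∫ t in 0..r, weight μ f t := by
  have := intervalIntegral_weight_neg h 0 r
  rwa [neg_zero] at this

/-- A member of `upperSet`, written in terms of the distance to the origin. -/
lemma mem_upperSet (h : Assumptions μ f ξ) {r : ℝ} (hr : 0 < r) (hrξ : r ≤ ξ) :
    √2 * (√(μ 0) ^ 3 - √(μ r) ^ 3) / (3 * ∫ t in 0..r, weight μ f t) ∈ upperSet μ f ξ := by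
  refine ⟨-r, ⟨by linarith, by linarith⟩, ?_⟩
  have h1 : 0 ≤ μ r := h.mu_nonneg (by rwa [abs_of_pos hr])
  simp only [integral_weight_neg_zero h, h.mu_even, rpow_three_halves h.mu_zero_pos.le,
    rpow_three_halves h1]

lemma aUpper_nonneg (h : Assumptions μ f ξ) (hb : BddAbove (upperSet μ f ξ)) :
    0 ≤ aUpper μ f ξ := by
  refine le_trans ?_ (le_csSup hb (mem_upperSet h h.xi_pos le_rfl))
  have := integral_weight_pos h h.xi_pos le_rfl le_rfl
  rw [h.mu_xi, Real.sqrt_zero, zero_pow three_ne_zero, sub_zero]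
  positivity

lemma kinkCost_lt_of_aUpper_lt (h : Assumptions μ f ξ) (hb : BddAbove (upperSet μ f ξ))
    (ha : aUpper μ f ξ < a) {z : ℝ} (hz : 0 < |z|) :
    kinkCost (μ 0) < kinkCost (posPart μ z) + 2 * a * ∫ t in 0..|z|, weight μ f t := by
  have key : ∀ r, 0 < r → r ≤ ξ →
      kinkCost (μ 0) < kinkCost (μ r) + 2 * a * ∫ t in 0..r, weight μ f t := by
    intro r hr hrξ
    have h1 := (le_csSup hb (mem_upperSet h hr hrξ)).trans_lt ha
    have hW := integral_weight_pos h hr le_rfl hrξ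
    rw [div_lt_iff₀ (by positivity)] at h1
    unfold kinkCost
    linarith
  have e : kinkCost (posPart μ z) = kinkCost (μ |z|) := by
    rw [kinkCost, kinkCost, sqrt_posPart, h.mu_abs]
  rw [e]
  rcases le_total |z| ξ with hle | hle
  · exact key _ hz hle
  · have h1 := key ξ h.xi_pos le_rfl
    have h2 : kinkCost (μ ξ) = kinkCost (μ |z|) := by
      have h3 : μ |z| ≤ 0 := h.mu_nonpos (by rwa [abs_abs])
      rw [kinkCost, kinkCost, h.mu_xi, Real.sqrt_zero, Real.sqrt_eq_zero_of_nonpos h3]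
    rwa [integral_weight_of_ge h hle, ← h2]

lemma aLower_quotient_eq (h : Assumptions μ f ξ) {r : ℝ} (hrξ : |r| ≤ ξ) :
    √2 * μ (-r) ^ (3 / 2 : ℝ) / (3 * ∫ t in (-ξ)..(-r), |f t| * √(μ t)) =
      √2 * √(μ r) ^ 3 / (3 * ∫ t in r..ξ, weight μ f t) := by
  rw [h.mu_even, rpow_three_halves (h.mu_nonneg hrξ)]
  congr 2
  exact intervalIntegral_weight_neg h r ξ

lemma lt_kinkCost_of_lt_aLower (h : Assumptions μ f ξ) (ha : a < aLower μ f ξ) {z : ℝ}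
    (hz : |z| < ξ) :
    2 * a * ((∫ t in 0..ξ, weight μ f t) - ∫ t in 0..|z|, weight μ f t) <
      kinkCost (posPart μ z) := by
  have hW := integral_weight_pos h hz (abs_nonneg z) le_rfl
  have hb : BddBelow ((fun x => √2 * μ x ^ (3 / 2 : ℝ) / (3 * ∫ t in (-ξ)..x, |f t| * √(μ t))) ''
      Ioc (-ξ) 0) := by
    refine ⟨0, ?_⟩
    rintro _ ⟨x, hx, rfl⟩
    have h1 : 0 ≤ ∫ t in (-ξ)..x, |f t| * √(μ t) :=
      intervalIntegral.integral_nonneg hx.1.le fun t _ => weight_nonneg μ f t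
    have h2 : 0 ≤ μ x := h.mu_nonneg (by rw [abs_of_nonpos hx.2]; linarith [hx.1])
    positivity
  have h1 := ha.trans_le (csInf_le hb ⟨-|z|, ⟨by linarith, by linarith [abs_nonneg z]⟩, rfl⟩)
  simp only [aLower_quotient_eq h (r := |z|) (by rw [abs_abs]; exact hz.le)] at h1
  rw [lt_div_iff₀ (by positivity), h.mu_abs] at h1
  rw [intervalIntegral.integral_interval_sub_left (weight_intervalIntegrable h _ _)
    (weight_intervalIntegrable h _ _), kinkCost, sqrt_posPart]
  linarith

/-- `μ` vanishes at most linearly at `ξ`. -/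
lemma exists_linear_le_mu (h : Assumptions μ f ξ) :
    ∃ k : ℝ, 0 < k ∧ ∀ r, 0 ≤ r → r ≤ ξ → k * (ξ - r) ≤ μ r := by
  have hξ := h.xi_pos
  obtain ⟨p, hp, hmax⟩ := isCompact_Icc.exists_isMaxOn
    (nonempty_Icc.2 (by linarith : ξ / 2 ≤ ξ)) (h.mu_contDiff.continuous_deriv_one.continuousOn)
  have hp0 : deriv μ p < 0 := h.mu_deriv_neg p (by linarith [hp.1])
  refine ⟨-deriv μ p / 2, by linarith, fun r hr hrξ => ?_⟩
  have h1 : ∀ ρ, ξ / 2 ≤ ρ → ρ ≤ ξ → -deriv μ p * (ξ - ρ) ≤ μ ρ := by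
    intro ρ h2 h3
    have := (convex_Icc (ξ / 2) ξ).image_sub_le_mul_sub_of_deriv_le h.mu_continuous.continuousOn
      (h.mu_contDiff.differentiable one_ne_zero).differentiableOn
      (fun x hx => hmax (interior_subset hx)) ρ ⟨h2, h3⟩ ξ ⟨by linarith, le_rfl⟩ h3
    rw [h.mu_xi] at this
    linarith
  rcases le_total (ξ / 2) r with h2 | h2
  · refine le_trans ?_ (h1 r h2 hrξ)
    nlinarith [mul_nonneg (neg_nonneg.2 hp0.le) (sub_nonneg.2 hrξ)]
  · have h3 : μ (ξ / 2) ≤ μ r := h.mu_le_of_abs_le (by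
      rw [abs_of_nonneg hr, abs_of_pos (by linarith)]; exact h2)
    have h4 := h1 (ξ / 2) le_rfl (by linarith)
    nlinarith [mul_nonneg (neg_nonneg.2 hp0.le) hr]

lemma aLower_pos (h : Assumptions μ f ξ) : 0 < aLower μ f ξ := by
  obtain ⟨k, hk, hμ⟩ := exists_linear_le_mu h
  obtain ⟨F, hF, hf⟩ := h.exists_f_bound
  have hξ := h.xi_pos
  refine lt_of_lt_of_le (by positivity : 0 < √2 * k / (3 * F))
    (le_csInf ((nonempty_Ioc.2 (by linarith)).image _) ?_)
  rintro _ ⟨x, hx, rfl⟩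
  obtain ⟨r, rfl⟩ : ∃ r, x = -r := ⟨-x, (neg_neg x).symm⟩
  have hr0 : 0 ≤ r := by linarith [hx.2]
  have hrξ : r < ξ := by linarith [hx.1]
  have har : |r| = r := abs_of_nonneg hr0
  simp only [aLower_quotient_eq h (r := r) (by rw [har]; exact hrξ.le)]
  have hW := integral_weight_pos h hrξ hr0 le_rfl
  have hμr := h.mu_pos (x := r) (by rwa [har])
  have h1 : ∫ t in r..ξ, weight μ f t ≤ F * √(μ r) * (ξ - r) := by
    have : ∫ t in r..ξ, weight μ f t ≤ ∫ _ in r..ξ, F * √(μ r) := by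
      refine intervalIntegral.integral_mono_on hrξ.le (weight_intervalIntegrable h _ _)
        intervalIntegrable_const fun t ht => ?_
      refine mul_le_mul (hf t) (Real.sqrt_le_sqrt (h.mu_le_of_abs_le ?_)) (Real.sqrt_nonneg _) hF.le
      rw [har, abs_of_nonneg (hr0.trans ht.1)]
      exact ht.1
    rwa [intervalIntegral.integral_const, smul_eq_mul, mul_comm] at this
  rw [div_le_div_iff₀ (by positivity) (by positivity)]
  have h2 := hμ r hr0 hrξ.le
  have h3 : √(μ r) ^ 3 = μ r * √(μ r) := by rw [pow_succ, Real.sq_sqrt hμr.le]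
  rw [h3]
  calc √2 * k * (3 * ∫ t in r..ξ, weight μ f t)
      ≤ √2 * k * (3 * (F * √(μ r) * (ξ - r))) := by gcongr
    _ = √2 * (k * (ξ - r) * √(μ r)) * (3 * F) := by ring
    _ ≤ √2 * (μ r * √(μ r)) * (3 * F) := by gcongr

/-- The weight has an explicit primitive in the model case `f = -μ' / 2`. -/
lemma integral_weight_of_eq_deriv (h : Assumptions μ f ξ) (hf : ∀ x, f x = -deriv μ x / 2)
    {x y : ℝ} (hx : x ≤ 0) (hy : y ≤ 0) :
    3 * ∫ t in x..y, |f t| * √(μ t) = μ y ^ (3 / 2 : ℝ) - μ x ^ (3 / 2 : ℝ) := by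
  have key : ∫ t in x..y, 3 * (|f t| * √(μ t)) = μ y ^ (3 / 2 : ℝ) - μ x ^ (3 / 2 : ℝ) := by
    refine intervalIntegral.integral_eq_sub_of_hasDerivAt (f := fun t => μ t ^ (3 / 2 : ℝ))
      (fun t ht => ?_) ((weight_intervalIntegrable h x y).const_mul 3)
    have ht0 : t ≤ 0 := ht.2.trans (max_le hx hy)
    have hft : |f t| = deriv μ t / 2 := by
      rw [abs_of_nonpos, hf]
      · ring
      · rcases ht0.eq_or_lt with rfl | h0
        · exact h.f_zero.le
        · exact (h.f_neg h0).le
    refine (((h.mu_contDiff.differentiable one_ne_zero t).hasDerivAt).rpow_const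
      (Or.inr (by norm_num))).congr_deriv ?_
    rw [hft, Real.sqrt_eq_rpow]
    norm_num
    ring
  rw [← key, intervalIntegral.integral_const_mul]

lemma thresholds_of_eq_deriv (h : Assumptions μ f ξ) (hf : ∀ x, f x = -deriv μ x / 2) :
    aLower μ f ξ = √2 ∧ upperSet μ f ξ = {√2} := by
  have hξ := h.xi_pos
  have hxi : μ (-ξ) = 0 := by rw [h.mu_even, h.mu_xi]
  constructor
  · have : (fun x => √2 * μ x ^ (3 / 2 : ℝ) / (3 * ∫ t in (-ξ)..x, |f t| * √(μ t))) ''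
        Ioc (-ξ) 0 = {√2} := by
      rw [eq_singleton_iff_nonempty_unique_mem]
      refine ⟨(nonempty_Ioc.2 (by linarith)).image _, ?_⟩
      rintro _ ⟨x, hx, rfl⟩
      have hμ : 0 < μ x := h.mu_pos (by rw [abs_of_nonpos hx.2]; linarith [hx.1])
      simp only [integral_weight_of_eq_deriv h hf (by linarith : -ξ ≤ 0) hx.2, hxi]
      rw [Real.zero_rpow (by norm_num), sub_zero, mul_div_cancel_right₀]
      exact (Real.rpow_pos_of_pos hμ _).ne'
    rw [aLower, this, csInf_singleton]
  · rw [upperSet, eq_singleton_iff_nonempty_unique_mem]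
    refine ⟨(nonempty_Ico.2 (by linarith)).image _, ?_⟩
    rintro _ ⟨x, hx, rfl⟩
    have hμ : 0 ≤ μ x := h.mu_nonneg (by rw [abs_of_neg hx.2]; linarith [hx.1])
    have hlt : μ x < μ 0 := h.mu_lt_of_abs_lt (by rw [abs_zero]; exact abs_pos.2 hx.2.ne)
    simp only [integral_weight_of_eq_deriv h hf hx.2.le le_rfl]
    rw [mul_div_cancel_right₀]
    exact (sub_pos.2 (Real.rpow_lt_rpow hμ hlt (by norm_num))).ne'

end

section


variable {μ f : ℝ → ℝ} {ξ a ε : ℝ} {v : ℝ → ℝ}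

lemma eventually_regMin (h : Assumptions μ f ξ) {v : ℝ → ℝ → ℝ} (hv : IsMinimizerFamily μ f a v) :
    ∀ᶠ ε in 𝓝[>] (0 : ℝ), RegMin μ f a ε (v ε) := by
  filter_upwards [hv, self_mem_nhdsWithin] with ε h1 hε
  exact h1.regMin h hε

lemma integral_posPart_sq_pos (h : Assumptions μ f ξ) : 0 < ∫ x, posPart μ x ^ 2 := by
  refine (h.posPart_continuous.pow 2).integral_pos_of_hasCompactSupport_nonneg_nonzero
    (HasCompactSupport.intro (isCompact_Icc (a := -ξ) (b := ξ)) fun x hx => ?_)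
    (fun x => sq_nonneg _) (x := 0) ?_
  · have : ξ ≤ |x| := by
      by_contra h'
      exact hx (abs_le.1 (not_le.1 h').le)
    simp [h.posPart_of_le this]
  · rw [h.posPart_of_lt (by simpa using h.xi_pos)]
    exact pow_ne_zero 2 h.mu_zero_pos.ne'

/-- Without forcing, the zero function has too much energy to be a minimiser for small `ε`. -/
lemma eventually_ne_zero (h : Assumptions μ f ξ) :
    ∀ᶠ ε in 𝓝[>] (0 : ℝ), ∀ v, RegMin μ f 0 ε v → ∀ x, v x ≠ 0 := by
  have hI := integral_posPart_sq_pos h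
  filter_upwards [eventually_renEnergy_le h 0 one_pos,
    Ioo_mem_nhdsGT (by positivity : 0 < (∫ x, posPart μ x ^ 2) / 4)] with ε h1 hε v hr z hz
  have hv : v = fun _ => 0 := funext (hr.eq_zero_of_zero h hε.1 hz)
  have h2 := h1 v _ hr.min
  rw [hr.min.pair.renEnergy_eq h, zero_mul, sub_zero] at h2
  have h3 : density μ ε v (deriv v) = fun x => posPart μ x ^ 2 / (4 * ε) := by
    ext x
    simp only [density, well, hv, deriv_const]
    field_simp
    ring
  rw [h3, integral_div, div_le_one (by linarith [hε.1])] at h2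
  linarith [hε.2]

lemma pos_or_neg_of_ne_zero {v : ℝ → ℝ} (hv : Continuous v) (hz : ∀ x, v x ≠ 0) :
    (∀ x, 0 < v x) ∨ ∀ x, v x < 0 := by
  rcases lt_or_gt_of_ne (hz 0) with h0 | h0
  · exact Or.inr fun x => neg_on_of_no_zero hv ordConnected_univ (mem_univ 0) h0
      (fun x _ => hz x) x (mem_univ x)
  · refine Or.inl fun x => ?_
    have := neg_on_of_no_zero hv.neg ordConnected_univ (mem_univ 0) (by simpa using h0)
      (fun x _ => neg_ne_zero.2 (hz x)) x (mem_univ x)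
    simpa using this

lemma exists_forall_of_eventually {p : ℝ → Prop} (hp : ∀ᶠ ε in 𝓝[>] (0 : ℝ), p ε) :
    ∃ ε₀ : ℝ, 0 < ε₀ ∧ ∀ ε, 0 < ε → ε < ε₀ → p ε := by
  obtain ⟨ε₀, hε₀, hs⟩ := mem_nhdsGT_iff_exists_Ioo_subset.1 hp
  exact ⟨ε₀, hε₀, fun ε h1 h2 => hs ⟨h1, h2⟩⟩

/-- Minimisers without forcing are even and of one sign. -/
theorem even_and_sign (h : Assumptions μ f ξ) :
    ∃ ε₀ : ℝ, 0 < ε₀ ∧ ∀ ε : ℝ, 0 < ε → ε < ε₀ → ∀ v, IsGlobalMinimizer μ f 0 ε v →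
      (∀ x, v (-x) = v x) ∧ ((∀ x, 0 < v x) ∨ (∀ x, v x < 0)) := by
  obtain ⟨ε₀, hε₀, hz⟩ := exists_forall_of_eventually (eventually_ne_zero h)
  refine ⟨ε₀, hε₀, fun ε h1 h2 v hv => ?_⟩
  have hr := hv.regMin h h1
  exact ⟨hr.even h h1, pos_or_neg_of_ne_zero hr.continuous (hz ε h1 h2 v hr)⟩

/-- Minimisers with forcing change sign exactly once. -/
theorem exists_unique_zero (h : Assumptions μ f ξ) (ha : 0 < a) :
    ∃ C ε₀ : ℝ, 0 < ε₀ ∧ ∀ ε : ℝ, 0 < ε → ε < ε₀ → ∀ v, IsGlobalMinimizer μ f a ε v →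
      ∃ xbar : ℝ, (∀ x, v x = 0 ↔ x = xbar) ∧ |xbar| ≤ ξ + C * √ε ∧
        (∀ x, xbar < x → 0 < v x) ∧ (∀ x, x < xbar → v x < 0) := by
  obtain ⟨C, ε₀, hε₀, -, -, -, hz⟩ := exists_zero_near h ha
  refine ⟨C, ε₀, hε₀, fun ε h1 h2 v hv => ?_⟩
  have hr := hv.regMin h h1
  obtain ⟨z, hz0, hzle⟩ := hz ε h1 h2 v hr
  exact ⟨z, fun x => ⟨fun hx => hr.eq_of_zero h ha h1 hz0 hx, fun hx => hx ▸ hz0⟩, hzle,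
    hr.sign_of_zero h ha h1 hz0⟩

lemma eventually_exists_zero (h : Assumptions μ f ξ) (ha : 0 < a) :
    ∀ᶠ ε in 𝓝[>] (0 : ℝ), ∀ v, RegMin μ f a ε v → ∃ z, v z = 0 := by
  obtain ⟨C, ε₀, hε₀, -, -, -, hz⟩ := exists_zero_near h ha
  filter_upwards [Ioo_mem_nhdsGT hε₀] with ε hε v hr
  obtain ⟨z, hz0, -⟩ := hz ε hε.1 hε.2 v hr
  exact ⟨z, hz0⟩

/-- Points `x + ε s` with `s` bounded stay close to `x`. -/
lemma eventually_abs_mul_lt {R d : ℝ} (hd : 0 < d) :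
    ∀ᶠ ε in 𝓝[>] (0 : ℝ), ∀ s, |s| ≤ R → |ε * s| < d := by
  filter_upwards [(tendsto_mul_const_nhdsGT R).eventually (eventually_lt_nhds hd),
    self_mem_nhdsWithin] with ε h1 hε s hs
  exact (abs_mul_le_of_abs_le hε hs).trans_lt h1

/-- Blow-ups at a point that stays away from a zero tending to `z₀`, and carries no energy. -/
lemma tendstoC1Loc_away (h : Assumptions μ f ξ) (ha : 0 < a) {v : ℝ → ℝ → ℝ} {z : ℝ → ℝ} {x z₀ : ℝ}
    (hreg : ∀ᶠ ε in 𝓝[>] (0 : ℝ), RegMin μ f a ε (v ε))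
    (hz : ∀ᶠ ε in 𝓝[>] (0 : ℝ), v ε (z ε) = 0) (hlim : Tendsto z (𝓝[>] 0) (𝓝 z₀))
    (hsmall : ∀ η R : ℝ, 0 < η → 0 < R → ∀ᶠ ε in 𝓝[>] (0 : ℝ), ∀ s, |s| ≤ R →
      ∫ t in (x + ε * s - ε)..(x + ε * s + ε), density μ ε (v ε) (deriv (v ε)) t ≤ η) :
    (z₀ < x → TendstoC1Loc (fun ε s => v ε (x + ε * s)) (fun _ => √(μ x))) ∧
      (x < z₀ → TendstoC1Loc (fun ε s => v ε (x + ε * s)) (fun _ => -√(μ x))) := by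
  constructor
  · refine fun hx => tendstoC1Loc_const h ha.le hreg hsmall fun R _ => ?_
    filter_upwards [hreg, hz, self_mem_nhdsWithin,
      hlim.eventually (eventually_lt_nhds (by linarith : z₀ < (z₀ + x) / 2)),
      eventually_abs_mul_lt (R := R) (by linarith : 0 < (x - z₀) / 2)] with ε hr hz0 hε h1 h2 s hs
    rw [abs_of_pos ((hr.sign_of_zero h ha hε hz0).1 _ (by linarith [(abs_lt.1 (h2 s hs)).1]))]
  · refine fun hx => tendstoC1Loc_const h ha.le hreg hsmall fun R _ => ?_
    filter_upwards [hreg, hz, self_mem_nhdsWithin,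
      hlim.eventually (eventually_gt_nhds (by linarith : (z₀ + x) / 2 < z₀)),
      eventually_abs_mul_lt (R := R) (by linarith : 0 < (z₀ - x) / 2)] with ε hr hz0 hε h1 h2 s hs
    rw [abs_of_neg ((hr.sign_of_zero h ha hε hz0).2 _ (by linarith [(abs_lt.1 (h2 s hs)).2])),
      ← abs_neg]
    congr 1
    ring

lemma tendstoC1Loc_zero (h : Assumptions μ f ξ) (ha : 0 ≤ a) {v : ℝ → ℝ → ℝ} {x : ℝ}
    (hx : ξ ≤ |x|) (hreg : ∀ᶠ ε in 𝓝[>] (0 : ℝ), RegMin μ f a ε (v ε))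
    (hsmall : ∀ η R : ℝ, 0 < η → 0 < R → ∀ᶠ ε in 𝓝[>] (0 : ℝ), ∀ s, |s| ≤ R →
      ∫ t in (x + ε * s - ε)..(x + ε * s + ε), density μ ε (v ε) (deriv (v ε)) t ≤ η) :
    TendstoC1Loc (fun ε s => v ε (x + ε * s)) (fun _ => 0) :=
  tendstoC1Loc_const h ha hreg hsmall fun R _ => Eventually.of_forall fun ε s _ => by
    rw [Real.sqrt_eq_zero_of_nonpos (h.mu_nonpos hx), sub_zero, sub_zero, abs_abs]

/-- The limit for strong forcing: the zero tends to the origin. -/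
theorem limit_of_aUpper_lt (h : Assumptions μ f ξ) (hb : BddAbove (upperSet μ f ξ))
    (ha : aUpper μ f ξ < a) {v : ℝ → ℝ → ℝ} (hv : IsMinimizerFamily μ f a v) {xbar : ℝ → ℝ}
    (hz : ∀ᶠ ε in 𝓝[>] (0 : ℝ), v ε (xbar ε) = 0) :
    Tendsto xbar (𝓝[>] (0 : ℝ)) (𝓝 0) ∧
      TendstoC1Loc (fun ε s => v ε (xbar ε + ε * s))
        (fun s => √(μ 0) * Real.tanh (s * √(μ 0 / 2))) ∧
      (∀ x, 0 < x → x < ξ → TendstoC1Loc (fun ε s => v ε (x + ε * s)) (fun _ => √(μ x))) ∧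
      (∀ x, -ξ < x → x < 0 → TendstoC1Loc (fun ε s => v ε (x + ε * s)) (fun _ => -√(μ x))) ∧
      (∀ x, ξ ≤ |x| → TendstoC1Loc (fun ε s => v ε (x + ε * s)) (fun _ => 0)) := by
  have ha0 : 0 < a := (aUpper_nonneg h hb).trans_lt ha
  have hreg := eventually_regMin h hv
  have hcen := fun {η c R : ℝ} => eventually_centered (η := η) (c := c) (R := R) h ha0
    fun z hz => kinkCost_lt_of_aUpper_lt h hb ha hz
  have hlim : Tendsto xbar (𝓝[>] (0 : ℝ)) (𝓝 0) := by
    refine Metric.tendsto_nhds.2 fun c hc => ?_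
    filter_upwards [hcen one_pos hc one_pos, hreg, hz] with ε h1 hr hz0
    rw [Real.dist_eq, sub_zero]
    exact (h1 _ _ hr hz0).1
  have hsmall : ∀ x, x ≠ 0 → ∀ η R : ℝ, 0 < η → 0 < R → ∀ᶠ ε in 𝓝[>] (0 : ℝ), ∀ s, |s| ≤ R →
      ∫ t in (x + ε * s - ε)..(x + ε * s + ε), density μ ε (v ε) (deriv (v ε)) t ≤ η := by
    intro x hx η R hη hR
    have hc : 0 < |x| / 4 := by positivity
    filter_upwards [hcen hη hc one_pos, hreg, hz, eventually_abs_mul_lt (R := R) hc,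
      Ioo_mem_nhdsGT hc] with ε h1 hr hz0 h2 hε s hs
    obtain ⟨e1, e2, -⟩ := h1 _ _ hr hz0
    have e3 := abs_lt.1 e1
    have e4 := abs_lt.1 (h2 s hs)
    have := hr.local_add_le h hε.1 (p := x + ε * s - ε) (q := x + ε * s + ε)
      (c := xbar ε - |x| / 4) (d := xbar ε + |x| / 4) (by linarith [hε.1]) (by linarith) (by
        rcases lt_or_gt_of_ne hx with h0 | h0
        · left
          rw [abs_of_neg h0] at *
          linarith [hε.2]
        · right
          rw [abs_of_pos h0] at *
          linarith [hε.2])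
    linarith
  refine ⟨hlim, ?_, fun x hx _ => ?_, fun x _ hx => ?_, fun x hx => ?_⟩
  · refine tendstoC1Loc_kink h ha0.le hreg hz fun η R hη hR => ?_
    filter_upwards [hcen hη one_pos hR, hreg, hz] with ε h1 hr hz0
    exact (h1 _ _ hr hz0).2.2
  · exact (tendstoC1Loc_away h ha0 hreg hz hlim (hsmall x hx.ne')).1 hx
  · exact (tendstoC1Loc_away h ha0 hreg hz hlim (hsmall x hx.ne)).2 hx
  · refine tendstoC1Loc_zero h ha0.le hx hreg (hsmall x ?_)
    rintro rfl
    linarith [h.xi_pos, abs_zero (α := ℝ)]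

lemma eventually_local_le_of_total_le (h : Assumptions μ f ξ) {v : ℝ → ℝ → ℝ}
    (hreg : ∀ᶠ ε in 𝓝[>] (0 : ℝ), RegMin μ f a ε (v ε))
    (hsmall : ∀ η : ℝ, 0 < η → ∀ᶠ ε in 𝓝[>] (0 : ℝ),
      ∫ t, density μ ε (v ε) (deriv (v ε)) t ≤ η) (x η R : ℝ) (hη : 0 < η) (_ : 0 < R) :
    ∀ᶠ ε in 𝓝[>] (0 : ℝ), ∀ s, |s| ≤ R →
      ∫ t in (x + ε * s - ε)..(x + ε * s + ε), density μ ε (v ε) (deriv (v ε)) t ≤ η := by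
  filter_upwards [hreg, hsmall η hη, self_mem_nhdsWithin] with ε hr h1 hε s _
  have hε' : 0 < ε := hε
  exact (hr.intervalIntegral_density_le h hε' (by linarith)).trans h1

open Classical in
/-- The limit for weak forcing: up to symmetry, the zero tends to `-ξ`. -/
theorem limit_of_lt_aLower (h : Assumptions μ f ξ) (ha0 : 0 < a) (ha : a < aLower μ f ξ)
    {v : ℝ → ℝ → ℝ} (hv : IsMinimizerFamily μ f a v) :
    ∃ w : ℝ → ℝ → ℝ, EqUpToOddSymmetry v w ∧
      (∀ xbar : ℝ → ℝ, (∀ᶠ ε in 𝓝[>] (0 : ℝ), w ε (xbar ε) = 0) →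
        Tendsto xbar (𝓝[>] (0 : ℝ)) (𝓝 (-ξ))) ∧
      ThomasFermiLimit μ ξ w := by
  let w : ℝ → ℝ → ℝ := fun ε => if ∃ z, 0 < z ∧ v ε z = 0 then fun x => -v ε (-x) else v ε
  have hsymm : EqUpToOddSymmetry v w := fun ε => by
    by_cases hz : ∃ z, 0 < z ∧ v ε z = 0
    · exact Or.inr (if_pos hz)
    · exact Or.inl (if_neg hz)
  have hregv := eventually_regMin h hv
  have hreg : ∀ᶠ ε in 𝓝[>] (0 : ℝ), RegMin μ f a ε (w ε) := by
    filter_upwards [hregv, self_mem_nhdsWithin] with ε hr hε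
    rcases hsymm ε with e | e <;> rw [e]
    · exact hr
    · exact hr.odd_symm h hε
  have hnonpos : ∀ᶠ ε in 𝓝[>] (0 : ℝ), ∀ z, w ε z = 0 → z ≤ 0 := by
    filter_upwards [hregv, self_mem_nhdsWithin] with ε hr hε z hz
    by_cases hex : ∃ z, 0 < z ∧ v ε z = 0
    · have e : w ε = fun x => -v ε (-x) := if_pos hex
      simp only [e, neg_eq_zero] at hz
      obtain ⟨y, hy, hvy⟩ := hex
      linarith [hr.eq_of_zero h ha0 hε hvy hz]
    · have e : w ε = v ε := if_neg hex
      rw [e] at hz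
      by_contra hcon
      exact hex ⟨z, not_le.1 hcon, hz⟩
  have hbdry := fun {η : ℝ} => eventually_boundary (η := η) h ha0
    fun z hz => lt_kinkCost_of_lt_aLower h ha hz
  have hlim : ∀ xbar : ℝ → ℝ, (∀ᶠ ε in 𝓝[>] (0 : ℝ), w ε (xbar ε) = 0) →
      Tendsto xbar (𝓝[>] (0 : ℝ)) (𝓝 (-ξ)) := by
    refine fun xbar hx => Metric.tendsto_nhds.2 fun c hc => ?_
    filter_upwards [hbdry hc, hreg, hx, hnonpos] with ε h1 hr hz0 h2
    have h3 := (h1 _ _ hr hz0).1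
    rw [abs_of_nonpos (h2 _ hz0)] at h3
    rw [Real.dist_eq, ← abs_neg]
    convert h3 using 2
    ring
  have hzero : ∀ᶠ ε in 𝓝[>] (0 : ℝ), ∃ z, w ε z = 0 := by
    filter_upwards [hreg, eventually_exists_zero h ha0] with ε hr h1
    exact h1 _ hr
  obtain ⟨xbar, hxbar⟩ : ∃ xbar : ℝ → ℝ, ∀ᶠ ε in 𝓝[>] (0 : ℝ), w ε (xbar ε) = 0 := hzero.choice
  have hsmall := eventually_local_le_of_total_le h hreg fun η hη => by
    filter_upwards [hbdry hη, hreg, hxbar] with ε h1 hr hz0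
    exact (h1 _ _ hr hz0).2
  refine ⟨w, hsymm, hlim, fun x hx => ?_, fun x hx => ?_⟩
  · exact (tendstoC1Loc_away h ha0 hreg hxbar (hlim xbar hxbar) (hsmall x)).1 (abs_lt.1 hx).1
  · exact tendstoC1Loc_zero h ha0.le hx hreg (hsmall x)

open Classical in
/-- The limit without forcing. -/
theorem limit_without_forcing (h : Assumptions μ f ξ) {v : ℝ → ℝ → ℝ}
    (hv : IsMinimizerFamily μ f 0 v) :
    ∃ w : ℝ → ℝ → ℝ, EqUpToOddSymmetry v w ∧ ThomasFermiLimit μ ξ w := by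
  let w : ℝ → ℝ → ℝ := fun ε => if ∀ x, 0 < v ε x then v ε else fun x => -v ε (-x)
  have hsymm : EqUpToOddSymmetry v w := fun ε => by
    by_cases hz : ∀ x, 0 < v ε x
    · exact Or.inl (if_pos hz)
    · exact Or.inr (if_neg hz)
  have hregv := eventually_regMin h hv
  have hreg : ∀ᶠ ε in 𝓝[>] (0 : ℝ), RegMin μ f 0 ε (w ε) := by
    filter_upwards [hregv, self_mem_nhdsWithin] with ε hr hε
    rcases hsymm ε with e | e <;> rw [e]
    · exact hr
    · exact hr.odd_symm h hε
  have hpos : ∀ᶠ ε in 𝓝[>] (0 : ℝ), ∀ x, 0 < w ε x := by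
    filter_upwards [hregv, eventually_ne_zero h] with ε hr h1
    by_cases hex : ∀ x, 0 < v ε x
    · have e : w ε = v ε := if_pos hex
      rwa [e]
    · have e : w ε = fun x => -v ε (-x) := if_neg hex
      rw [e]
      intro x
      have := (pos_or_neg_of_ne_zero hr.continuous (h1 _ hr)).resolve_left hex (-x)
      linarith
  have hsmall := eventually_local_le_of_total_le h hreg fun η hη => by
    filter_upwards [eventually_renEnergy_le h 0 hη, hreg] with ε h1 hr
    have h2 := h1 _ _ hr.min
    rwa [hr.min.pair.renEnergy_eq h, zero_mul, sub_zero] at h2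
  refine ⟨w, hsymm, fun x _ => ?_, fun x hx => tendstoC1Loc_zero h le_rfl hx hreg (hsmall x)⟩
  refine tendstoC1Loc_const h le_rfl hreg (hsmall x) fun R _ => ?_
  filter_upwards [hpos] with ε h1 s _
  rw [abs_of_pos (h1 _)]

end

end ShadowKink

end

theorem theorem1 (μ f : ℝ → ℝ) (ξ : ℝ) (h : ShadowKink.Assumptions μ f ξ) :
    -- global minimizers exist
    (∀ a : ℝ, 0 ≤ a → ∀ ε : ℝ, 0 < ε → ∃ v, ShadowKink.IsGlobalMinimizer μ f a ε v) ∧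
    -- (i)
    (∃ ε₀ : ℝ, 0 < ε₀ ∧ ∀ ε : ℝ, 0 < ε → ε < ε₀ →
      ∀ v, ShadowKink.IsGlobalMinimizer μ f 0 ε v →
        (∀ x, v (-x) = v x) ∧ ((∀ x, 0 < v x) ∨ (∀ x, v x < 0))) ∧
    -- (ii)
    (∀ a : ℝ, 0 < a → ∃ C ε₀ : ℝ, 0 < ε₀ ∧ ∀ ε : ℝ, 0 < ε → ε < ε₀ →
      ∀ v, ShadowKink.IsGlobalMinimizer μ f a ε v →
        ∃ xbar : ℝ, (∀ x, v x = 0 ↔ x = xbar) ∧ |xbar| ≤ ξ + C * √ε ∧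
          (∀ x, xbar < x → 0 < v x) ∧ (∀ x, x < xbar → v x < 0)) ∧
    -- (iii)
    (BddAbove (ShadowKink.upperSet μ f ξ) →
      ∀ a : ℝ, ShadowKink.aUpper μ f ξ < a →
      ∀ v : ℝ → ℝ → ℝ, ShadowKink.IsMinimizerFamily μ f a v →
      ∀ xbar : ℝ → ℝ, (∀ᶠ ε in 𝓝[>] (0 : ℝ), v ε (xbar ε) = 0) →
        Tendsto xbar (𝓝[>] (0 : ℝ)) (𝓝 0) ∧
        ShadowKink.TendstoC1Loc (fun ε s => v ε (xbar ε + ε * s))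
          (fun s => √(μ 0) * Real.tanh (s * √(μ 0 / 2))) ∧
        (∀ x, 0 < x → x < ξ →
          ShadowKink.TendstoC1Loc (fun ε s => v ε (x + ε * s)) (fun _ => √(μ x))) ∧
        (∀ x, -ξ < x → x < 0 →
          ShadowKink.TendstoC1Loc (fun ε s => v ε (x + ε * s)) (fun _ => -√(μ x))) ∧
        (∀ x, ξ ≤ |x| →
          ShadowKink.TendstoC1Loc (fun ε s => v ε (x + ε * s)) (fun _ => 0))) ∧
    -- (iv)
    0 < ShadowKink.aLower μ f ξ ∧
    (∀ a : ℝ, 0 < a → a < ShadowKink.aLower μ f ξ →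
      ∀ v : ℝ → ℝ → ℝ, ShadowKink.IsMinimizerFamily μ f a v →
      ∃ w : ℝ → ℝ → ℝ, ShadowKink.EqUpToOddSymmetry v w ∧
        (∀ xbar : ℝ → ℝ, (∀ᶠ ε in 𝓝[>] (0 : ℝ), w ε (xbar ε) = 0) →
          Tendsto xbar (𝓝[>] (0 : ℝ)) (𝓝 (-ξ))) ∧
        ShadowKink.ThomasFermiLimit μ ξ w) ∧
    (∀ v : ℝ → ℝ → ℝ, ShadowKink.IsMinimizerFamily μ f 0 v →
      ∃ w : ℝ → ℝ → ℝ, ShadowKink.EqUpToOddSymmetry v w ∧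
        ShadowKink.ThomasFermiLimit μ ξ w) ∧
    ((∀ x, f x = -deriv μ x / 2) →
      ShadowKink.aLower μ f ξ = √2 ∧
      BddAbove (ShadowKink.upperSet μ f ξ) ∧ ShadowKink.aUpper μ f ξ = √2) := by
  refine ⟨fun a ha ε hε => ?_, ShadowKink.even_and_sign h,
    fun a ha => ShadowKink.exists_unique_zero h ha,
    fun hb a ha v hv xbar hz => ShadowKink.limit_of_aUpper_lt h hb ha hv hz,
    ShadowKink.aLower_pos h, fun a ha0 ha v hv => ShadowKink.limit_of_lt_aLower h ha0 ha hv,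
    fun v hv => ShadowKink.limit_without_forcing h hv, fun hf => ?_⟩
  · obtain ⟨v, g, hm⟩ := ShadowKink.exists_isMinPair h ha hε
    exact ⟨v, hm.isGlobalMinimizer h⟩
  · obtain ⟨h1, h2⟩ := ShadowKink.thresholds_of_eq_deriv h hf
    rw [ShadowKink.aUpper, h2]
    exact ⟨h1, bddAbove_singleton, csSup_singleton _⟩
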